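/- Let $\beta$ be an indeterminate, $x\oplus y=x+y+\beta xy$, $\bar x=-x/(1+\beta x)$, and let $X\in\{B,C,D\}$. Let $W(X)$ be the Weyl group of infinite rank: for $X=B,C$ the group of signed permutations generated by $s_0$ (the sign change of $1$) and $s_1,s_2,\dots$ (the exchanges of $i$ and $i+1$), and for $X=D$ its subgroup generated by $s_{\hat 1}=s_0s_1s_0$ and $s_1,s_2,\dots$. Let $SS_\beta(x_1,\dots,x_n)$ be the ring of symmetric $f\in\mathbb Z[\beta][x_1,\dots,x_n]$ such that, if $n\ge 2$, $f(t,\bar t,x_3,\dots,x_n)=f(0,0,x_3,\dots,x_n)$. Let $SS_\beta(x)=\varprojlim_n SS_\beta(x_1,\dots,x_n)$ (with transition maps $x_{n+1}\mapsto 0$), $R_\beta^{(a)}=\mathbb Z[\beta][a_1,a_2,\dots]$ and $R_\beta^{(b)}=\mathbb Z[\beta][b_1,b_2,\dots]$. All of these are regarded inside $\mathcal P=\mathbb Q[\beta][[x_1,x_2,\dots,a_1,a_2,\dots,b_1,b_2,\dots]]$. *Operators.* For $i\ge1$, $s_i^{(a)}$ exchanges $a_i$ and $a_{i+1}$. The operator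 $s_0^{(a)}$ maps $a_1\mapsto\bar a_1$ and $f(x)\mapsto f(a_1,x)$; the operator $s_{\hat 1}^{(a)}$ maps $a_1\mapsto\bar a_2$, $a_2\mapsto\bar a_1$ and $f(x)\mapsto f(a_1,a_2,x)$. All other variables are fixed. Put $\alpha_i=a_i\oplus\bar a_{i+1}$ for $i\ge1$, $\alpha_0=\bar a_1$ for $X=B$, $\alpha_0=\bar a_1\oplus\bar a_1$ for $X=C$, $\alpha_{\hat 1}=\bar a_1\oplus\bar a_2$ for $X=D$, and $$\pi_i^{(a)}(f)=\frac{f-(1+\beta\alpha_i)\,s_i^{(a)}f}{\alpha_i},\qquad \psi_i^{(a)}=\pi_i^{(a)}+\beta,\qquad \psi_v^{(a)}=\psi_{i_1}^{(a)}\cdots\psi_{i_\ell}^{(a)}$$ for a reduced expression $v=s_{i_1}\cdots s_{i_\ell}$. *Double Grothendieck polynomials.* Let $\mathrm{Id}_\beta(W(X))$ be the idCoxeter algebra, with basis $(u_w)_{w\in W(X)}$ and $u_wu_i=u_{ws_i}$ if $\ell(ws_i)>\ell(w)$, $u_wu_i=\beta u_w$ otherwise. Put $h_i(y)=1+yu_i$,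 $A^{(n)}_i(y)=h_{n-1}(y)\cdots h_i(y)$, $G_{A_{n-1}}(y)=A^{(n)}_1(y_1)\cdots A^{(n)}_{n-1}(y_{n-1})$, and $$F^B_n(y)=A^{(n)}_1(y)h_0(y)A^{(n)}_1(\bar y)^{-1},\quad F^C_n(y)=A^{(n)}_1(y)h_0(y)^2A^{(n)}_1(\bar y)^{-1},\quad F^D_n(y)=A^{(n)}_2(y)h_{\hat 1}(y)h_1(y)A^{(n)}_2(\bar y)^{-1}.$$ Let $\mathcal G^X_{n,w}(a,b;x)$ be the coefficient of $u_w$ in $G_{A_{n-1}}(\bar b)^{-1}F^X_n(x_1)\cdots F^X_n(x_n)\,G_{A_{n-1}}(a)$. **Claim.** For every $w\in W(X)$ the limit $\mathcal G^X_w(a,b;x)=\lim_{n\to\infty}\mathcal G^X_{n,w}(a,b;x)$ exists coefficientwise in $\mathcal P$ (each coefficient is eventually constant). For every $F\in SS_\beta(x)\otimes_{\mathbb Z[\beta]}R_\beta^{(a)}\otimes_{\mathbb Z[\beta]}R_\beta^{(b)}$, all the divisions in iterated operators $\pi_i^{(a)},\psi_i^{(a)}$ applied to $F$ are exact in $\mathcal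 P$, the element $\psi_v^{(a)}(F)$ does not depend on the reduced expression of $v$, and $$F=\sum_{v\in W(X)}\bigl(\psi_v^{(a)}(F)\big|_e\bigr)\,\mathcal G^X_v(a,b;x),$$ where $|_e$ is the substitution $a_i=\bar b_i$, $x_i=0$ for all $i$. The sum is in general infinite; it is a formal sum in $\mathcal P$, that is, every monomial occurs in only finitely many terms, and its coefficients add up to its coefficient in $F$. -/

import Mathlib

open scoped TensorProduct

namespace DoubleGroth

/-! ### Formal group operations and formal power series -/

section FormalGroup

variable {σ R : Type*} [CommRing R]

/-- `x ⊕ y = x + y + β x y`. -/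
noncomputable def oplus (β : R) (x y : MvPowerSeries σ R) : MvPowerSeries σ R :=
  x + y + MvPowerSeries.C β * x * y

/-- `x̄ = ⊖ x = - x / (1 + β x)`, for a power series `x` without constant term. -/
noncomputable def bar (β : R) (x : MvPowerSeries σ R) : MvPowerSeries σ R :=
  -(x * MvPowerSeries.invOfUnit (1 + MvPowerSeries.C β * x) 1)

theorem oplus_bar (β : R) (x : MvPowerSeries σ R) (hx : MvPowerSeries.constantCoeff x = 0) :
    oplus β x (bar β x) = 0 := by
  have h : (1 + MvPowerSeries.C β * x) *
      MvPowerSeries.invOfUnit (1 + MvPowerSeries.C β * x) 1 = 1 :=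
    MvPowerSeries.mul_invOfUnit _ _ (by simp [hx])
  unfold oplus bar
  linear_combination (-x) * h

/-- `F` is the formal sum of the family `f`: every monomial occurs in only finitely many members of
the family, and the coefficients of each monomial add up to that of `F`. -/
def IsFormalSum {ι : Type*} (f : ι → MvPowerSeries σ R) (F : MvPowerSeries σ R) : Prop :=
  ∀ d : σ →₀ ℕ, {i | MvPowerSeries.coeff d (f i) ≠ 0}.Finite ∧
    ∑ᶠ i, MvPowerSeries.coeff d (f i) = MvPowerSeries.coeff d F

/-- `F` is the formal limit of the sequence `f`: each coefficient is eventually that of `F`. -/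
def IsFormalLim (f : ℕ → MvPowerSeries σ R) (F : MvPowerSeries σ R) : Prop :=
  ∀ d : σ →₀ ℕ, ∀ᶠ n in Filter.atTop, MvPowerSeries.coeff d (f n) = MvPowerSeries.coeff d F

open Classical in
/-- The formal limit of a sequence of power series (`0` if there is none). -/
noncomputable def formalLim (f : ℕ → MvPowerSeries σ R) : MvPowerSeries σ R :=
  if h : ∃ F, IsFormalLim f F then h.choose else 0

end FormalGroup

/-! ### `β`-supersymmetric functions -/

/-- The ring `ℤ[β]`. -/
abbrev ZBeta : Type := Polynomial ℤ

/-- The substitution `x₁ = t`, `x₂ = t̄` in a polynomial in `x₁, …, xₙ`; the new variable `t` is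
`X none`, and the variables are numbered from `0`. -/
noncomputable def substPair (n : ℕ) :
    MvPolynomial (Fin n) ZBeta →ₐ[ZBeta] MvPowerSeries (Option (Fin n)) ZBeta :=
  MvPolynomial.aeval fun k =>
    if k.val = 0 then MvPowerSeries.X none
    else if k.val = 1 then bar Polynomial.X (MvPowerSeries.X none)
    else MvPowerSeries.X (some k)

/-- The substitution `x₁ = x₂ = 0` in a polynomial in `x₁, …, xₙ`. -/
noncomputable def substZero (n : ℕ) :
    MvPolynomial (Fin n) ZBeta →ₐ[ZBeta] MvPowerSeries (Option (Fin n)) ZBeta :=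
  MvPolynomial.aeval fun k => if k.val < 2 then 0 else MvPowerSeries.X (some k)

/-- `f(x₁, …, xₙ)` is `β`-supersymmetric: it is symmetric, and
`f(t, t̄, x₃, …, xₙ) = f(0, 0, x₃, …, xₙ)` (a condition when `n ≥ 2`). -/
def IsBetaSupersymmetric {n : ℕ} (f : MvPolynomial (Fin n) ZBeta) : Prop :=
  f.IsSymmetric ∧ (2 ≤ n → substPair n f = substZero n f)

/-- The ring `SS_β(x₁, …, xₙ)`. -/
noncomputable def SSn (n : ℕ) : Subalgebra ZBeta (MvPolynomial (Fin n) ZBeta) where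
  carrier := {f | IsBetaSupersymmetric f}
  mul_mem' := fun {f g} hf hg =>
    ⟨hf.1.mul hg.1, fun h => by rw [map_mul, map_mul, hf.2 h, hg.2 h]⟩
  add_mem' := fun {f g} hf hg =>
    ⟨hf.1.add hg.1, fun h => by rw [map_add, map_add, hf.2 h, hg.2 h]⟩
  algebraMap_mem' r :=
    ⟨MvPolynomial.IsSymmetric.C r, fun _ => by rw [AlgHom.commutes, AlgHom.commutes]⟩

/-- The ring `SS_β(x)` of `β`-supersymmetric functions, the inverse limit of the rings
`SS_β(x₁, …, xₙ)` under the maps `x_{n+1} ↦ 0`. A compatible sequence `(f_n)` is the same as the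
power series `f` in `x₁, x₂, …` with `f(x₁, …, xₙ, 0, 0, …) = f_n` for all `n`. -/
noncomputable def SS : Subalgebra ZBeta (MvPowerSeries ℕ ZBeta) where
  carrier := {f | ∀ n : ℕ, ∃ p ∈ SSn n,
    MvPowerSeries.killCompl (Fin.valEmbedding : Fin n ↪ ℕ) f = (p : MvPowerSeries (Fin n) ZBeta)}
  mul_mem' := fun {f g} hf hg n => by
    obtain ⟨p, hp, hfp⟩ := hf n
    obtain ⟨q, hq, hgq⟩ := hg n
    exact ⟨p * q, mul_mem hp hq, by rw [map_mul, hfp, hgq, MvPolynomial.coe_mul]⟩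
  add_mem' := fun {f g} hf hg n => by
    obtain ⟨p, hp, hfp⟩ := hf n
    obtain ⟨q, hq, hgq⟩ := hg n
    exact ⟨p + q, add_mem hp hq, by rw [map_add, hfp, hgq, MvPolynomial.coe_add]⟩
  algebraMap_mem' r n :=
    ⟨algebraMap _ _ r, Subalgebra.algebraMap_mem _ r, by
      rw [AlgHom.commutes, MvPolynomial.algebraMap_eq, MvPolynomial.coe_C]; rfl⟩

/-! ### The ambient ring of power series in `x`, `a`, `b` -/

/-- The variables; `x i`, `a i`, `b i` stand for `x_{i+1}`, `a_{i+1}`, `b_{i+1}`. -/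
inductive Var : Type
  | x (i : ℕ)
  | a (i : ℕ)
  | b (i : ℕ)

/-- The ring `ℚ[β]⟦x₁, x₂, …, a₁, a₂, …, b₁, b₂, …⟧`, in which all computations take place. -/
abbrev Ser : Type := MvPowerSeries Var (Polynomial ℚ)

/-- The parameter `β`. -/
noncomputable def β : Polynomial ℚ := Polynomial.X

noncomputable def xv (i : ℕ) : Ser := MvPowerSeries.X (Var.x i)
noncomputable def av (i : ℕ) : Ser := MvPowerSeries.X (Var.a i)
noncomputable def bv (i : ℕ) : Ser := MvPowerSeries.X (Var.b i)

/-- The ring `R_β^{(a)} = ℤ[β][a₁, a₂, …]` (or `R_β^{(b)}`, with `b` in place of `a`). -/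
abbrev RBeta : Type := MvPolynomial ℕ ZBeta

instance tendstoCofinite_x : Filter.TendstoCofinite Var.x :=
  ⟨Function.Injective.tendsto_cofinite fun _ _ h => by injection h⟩

/-- The multiplication map from `SS_β(x) ⊗ R_β^{(a)} ⊗ R_β^{(b)}` to power series over `ℤ[β]`. -/
noncomputable def toSerZ :
    ((SS ⊗[ZBeta] RBeta) ⊗[ZBeta] RBeta) →ₐ[ZBeta] MvPowerSeries Var ZBeta :=
  Algebra.TensorProduct.productMap
    (Algebra.TensorProduct.productMap ((MvPowerSeries.rename Var.x).comp SS.val)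
      (MvPolynomial.aeval fun i => MvPowerSeries.X (Var.a i)))
    (MvPolynomial.aeval fun i => MvPowerSeries.X (Var.b i))

/-- An element of `SS_β(x) ⊗ R_β^{(a)} ⊗ R_β^{(b)}` as an element of the ambient ring. -/
noncomputable def toSer : ((SS ⊗[ZBeta] RBeta) ⊗[ZBeta] RBeta) →+* Ser :=
  (MvPowerSeries.map (Polynomial.mapRingHom (Int.castRingHom ℚ))).comp toSerZ.toRingHom

/-! ### Weyl groups -/

/-- The classical types `B`, `C`, `D` (of infinite rank). -/
inductive CType : Type
  | B
  | C
  | D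

/-- The simple reflections as signed permutations, that is, permutations of `ℤ`. For `i ≥ 1` the
index `i` stands for `s_i`; the index `0` stands for `s_0` in types `B`, `C` and for
`s_{1̂} = s_0 s_1 s_0` in type `D`. -/
def simplePerm : CType → ℕ → Equiv.Perm ℤ
  | .B, 0 => Equiv.swap 1 (-1)
  | .C, 0 => Equiv.swap 1 (-1)
  | .D, 0 => Equiv.swap 1 (-1) * (Equiv.swap 1 2 * Equiv.swap (-1) (-2)) * Equiv.swap 1 (-1)
  | _, (i + 1) => Equiv.swap ((i : ℤ) + 1) (i + 2) * Equiv.swap (-((i : ℤ) + 1)) (-((i : ℤ) + 2))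

/-- The Weyl group `W(X)`. -/
abbrev Weyl (X : CType) : Type := Subgroup.closure (Set.range (simplePerm X))

/-- The simple reflections as elements of `W(X)`. -/
def s (X : CType) (i : ℕ) : Weyl X :=
  ⟨simplePerm X i, Subgroup.subset_closure ⟨i, rfl⟩⟩

/-- The product `s_{i_1} ⋯ s_{i_l}`. -/
def wordProd (X : CType) (l : List ℕ) : Weyl X := (l.map (s X)).prod

/-- `l` is a reduced word of `w`. -/
def IsReducedWord (X : CType) (w : Weyl X) (l : List ℕ) : Prop :=
  wordProd X l = w ∧ ∀ l' : List ℕ, wordProd X l' = w → l.length ≤ l'.length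

theorem s_mul_self (X : CType) (i : ℕ) : s X i * s X i = 1 := by
  apply Subtype.ext
  have key : ∀ a b c d : ℤ, a ≠ c → a ≠ d → b ≠ c → b ≠ d →
      (Equiv.swap a b * Equiv.swap c d) * (Equiv.swap a b * Equiv.swap c d) = 1 := by
    intro a b c d h1 h2 h3 h4
    have hc : Equiv.swap a b * Equiv.swap c d = Equiv.swap c d * Equiv.swap a b := by
      have hd : Equiv.Perm.Disjoint (Equiv.swap a b) (Equiv.swap c d) := by
        intro z
        by_cases hz : z = a ∨ z = b
        · right
          rcases hz with rfl | rfl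
          · exact Equiv.swap_apply_of_ne_of_ne h1 h2
          · exact Equiv.swap_apply_of_ne_of_ne h3 h4
        · left
          push Not at hz
          exact Equiv.swap_apply_of_ne_of_ne hz.1 hz.2
      exact hd.commute
    calc (Equiv.swap a b * Equiv.swap c d) * (Equiv.swap a b * Equiv.swap c d)
        = (Equiv.swap a b * Equiv.swap c d) * (Equiv.swap c d * Equiv.swap a b) := by rw [← hc]
      _ = Equiv.swap a b * (Equiv.swap c d * Equiv.swap c d) * Equiv.swap a b := by group
      _ = 1 := by simp
  change simplePerm X i * simplePerm X i = 1
  cases i with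
  | zero =>
    cases X with
    | B => simp [simplePerm]
    | C => simp [simplePerm]
    | D =>
      have h := key 1 2 (-1) (-2) (by norm_num) (by norm_num) (by norm_num) (by norm_num)
      simp only [simplePerm]
      set r : Equiv.Perm ℤ := Equiv.swap 1 (-1) with hr
      set q : Equiv.Perm ℤ := Equiv.swap 1 2 * Equiv.swap (-1) (-2) with hq
      have hrr : r * r = 1 := by rw [hr]; simp
      calc r * q * r * (r * q * r) = r * q * (r * r) * q * r := by group
        _ = r * (q * q) * r := by rw [hrr]; group
        _ = 1 := by rw [h, mul_one, hrr]
  | succ i =>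
    have h := key ((i : ℤ) + 1) (i + 2) (-((i : ℤ) + 1)) (-((i : ℤ) + 2))
      (by omega) (by omega) (by omega) (by omega)
    cases X <;> exact h

theorem exists_word (X : CType) (w : Weyl X) : ∃ l : List ℕ, wordProd X l = w := by
  obtain ⟨w, hw⟩ := w
  induction hw using Subgroup.closure_induction with
  | mem g hg =>
    obtain ⟨i, rfl⟩ := hg
    exact ⟨[i], by simp [wordProd, s]⟩
  | one => exact ⟨[], rfl⟩
  | mul g h hg hh ihg ihh =>
    obtain ⟨l, hl⟩ := ihg
    obtain ⟨m, hm⟩ := ihh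
    refine ⟨l ++ m, ?_⟩
    have : wordProd X (l ++ m) = wordProd X l * wordProd X m := by simp [wordProd]
    rw [this, hl, hm]; rfl
  | inv g hg ih =>
    obtain ⟨l, hl⟩ := ih
    refine ⟨l.reverse, ?_⟩
    have key : ∀ l : List ℕ, wordProd X l.reverse = (wordProd X l)⁻¹ := by
      intro l
      induction l with
      | nil => simp [wordProd]
      | cons i l ih =>
        have h1 : wordProd X (i :: l).reverse = wordProd X l.reverse * s X i := by
          simp [wordProd]
        have h2 : wordProd X (i :: l) = s X i * wordProd X l := by simp [wordProd]
        rw [h1, h2, ih, mul_inv_rev, inv_eq_of_mul_eq_one_left (s_mul_self X i)]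
    rw [key, hl]; rfl

theorem exists_reducedWord (X : CType) (w : Weyl X) : ∃ l, IsReducedWord X w l := by
  classical
  have h : ∃ n, ∃ l : List ℕ, wordProd X l = w ∧ l.length = n := by
    obtain ⟨l, hl⟩ := exists_word X w
    exact ⟨_, l, hl, rfl⟩
  obtain ⟨l, hl, hn⟩ := Nat.find_spec h
  exact ⟨l, hl, fun l' hl' => hn ▸ Nat.find_min' h ⟨l', hl', rfl⟩⟩

/-- A reduced word of `w`. -/
noncomputable def reducedWord (X : CType) (w : Weyl X) : List ℕ := (exists_reducedWord X w).choose

/-- The length `ℓ(w)`. -/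
noncomputable def len (X : CType) (w : Weyl X) : ℕ := (reducedWord X w).length

/-! ### The action of the Weyl group on functions of `x`, `a`, `b` -/

/-- The value of `s_i^{(a)}` at each variable. For `i ≥ 1` it exchanges `a_i` and `a_{i+1}`. In types
`B`, `C`, `s_0^{(a)}` maps `a_1` to `ā_1` and `f(x)` to `f(a_1, x)`, that is `x_1 ↦ a_1` and
`x_{k+1} ↦ x_k`. In type `D`, `s_{1̂}^{(a)}` maps `a_1` to `ā_2`, `a_2` to `ā_1` and `f(x)` to
`f(a_1, a_2, x)`. -/
noncomputable def sVar : CType → ℕ → Var → Ser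
  | _, (i + 1), .a k => av (Equiv.swap i (i + 1) k)
  | _, (_ + 1), .x k => xv k
  | .B, 0, .a 0 => bar β (av 0)
  | .C, 0, .a 0 => bar β (av 0)
  | .B, 0, .x 0 => av 0
  | .C, 0, .x 0 => av 0
  | .B, 0, .x (k + 1) => xv k
  | .C, 0, .x (k + 1) => xv k
  | .D, 0, .a 0 => bar β (av 1)
  | .D, 0, .a 1 => bar β (av 0)
  | .D, 0, .x 0 => av 0
  | .D, 0, .x 1 => av 1
  | .D, 0, .x (k + 2) => xv k
  | _, 0, .a k => av k
  | _, _, .b k => bv k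

/-- The value of the localization at `e` at each variable: `a_i = b̄_i` and `x_i = 0`. -/
noncomputable def locVar : Var → Ser
  | .x _ => 0
  | .a k => bar β (bv k)
  | .b k => bv k

/-- A family of power series, each divisible by a variable, may be substituted if each variable is
used only finitely often. -/
theorem hasSubst_of_dvd (f : Var → Ser) (g : Var → Var)
    (hd : ∀ v, (MvPowerSeries.X (g v) : Ser) ∣ f v)
    (hg : ∀ u, {v | g v = u ∧ f v ≠ 0}.Finite) : MvPowerSeries.HasSubst f where
  const_coeff v := by
    obtain ⟨q, hq⟩ := hd v
    rw [hq, map_mul, MvPowerSeries.constantCoeff_X, zero_mul]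
    exact IsNilpotent.zero
  coeff_zero d := by
    refine Set.Finite.subset (d.support.finite_toSet.biUnion fun u _ => hg u) ?_
    intro v hv
    simp only [Set.mem_iUnion]
    refine ⟨g v, ?_, rfl, fun h => hv (by rw [h, map_zero])⟩
    by_contra h
    exact hv (MvPowerSeries.X_dvd_iff.mp (hd v) d (by simpa using h))

theorem X_dvd_bar (v : Var) : (MvPowerSeries.X v : Ser) ∣ bar β (MvPowerSeries.X v) :=
  (Dvd.intro _ rfl : (MvPowerSeries.X v : Ser) ∣ _).neg_right

/-- The variable that divides the value of `s_i^{(a)}` at a given variable. -/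
def sLead : CType → ℕ → Var → Var
  | _, (i + 1), .a k => .a (Equiv.swap i (i + 1) k)
  | _, (_ + 1), .x k => .x k
  | .B, 0, .a 0 => .a 0
  | .C, 0, .a 0 => .a 0
  | .B, 0, .x 0 => .a 0
  | .C, 0, .x 0 => .a 0
  | .B, 0, .x (k + 1) => .x k
  | .C, 0, .x (k + 1) => .x k
  | .D, 0, .a 0 => .a 1
  | .D, 0, .a 1 => .a 0
  | .D, 0, .x 0 => .a 0
  | .D, 0, .x 1 => .a 1
  | .D, 0, .x (k + 2) => .x k
  | _, 0, .a k => .a k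
  | _, _, .b k => .b k

theorem hasSubst_sVar (X : CType) (i : ℕ) : MvPowerSeries.HasSubst (sVar X i) := by
  refine hasSubst_of_dvd _ (sLead X i) (fun v => ?_) (fun w => ?_)
  · unfold sLead sVar
    split <;> first | exact dvd_rfl | exact X_dvd_bar _
  · let S : Var → Set Var := fun w => match w with
      | .x k => {.x k, .x (k + 1), .x (k + 2)}
      | .a k => {.a k, .a (k + 1), .a (k - 1), .x 0, .x 1}
      | .b k => {.b k}
    have hS : ∀ v, v ∈ S (sLead X i v) := by
      intro v
      unfold sLead
      split <;> simp [S]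
      rw [Equiv.swap_apply_def]
      split_ifs <;> omega
    refine Set.Finite.subset (s := S w) ?_ fun v hv => hv.1 ▸ hS v
    cases w <;> simp [S]

theorem hasSubst_locVar : MvPowerSeries.HasSubst locVar := by
  refine hasSubst_of_dvd _ (fun v => match v with | .x k => .x k | .a k => .b k | .b k => .b k)
    (fun v => ?_) (fun w => ?_)
  · cases v with
    | x k => exact dvd_zero _
    | a k => exact X_dvd_bar _
    | b k => exact dvd_rfl
  · refine Set.Finite.subset (s := match w with
      | .x k => {.x k} | .a k => ∅ | .b k => {.a k, .b k}) ?_ ?_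
    · cases w <;> simp
    · rintro v ⟨rfl, -⟩
      cases v <;> simp

/-- The action of `s_i^{(a)}`. -/
noncomputable def sAct (X : CType) (i : ℕ) : Ser →ₐ[Polynomial ℚ] Ser :=
  MvPowerSeries.substAlgHom (hasSubst_sVar X i)

/-- The localization `F ↦ F|_e`, that is the substitution `a_i = b̄_i`, `x_i = 0`. -/
noncomputable def locE : Ser →ₐ[Polynomial ℚ] Ser :=
  MvPowerSeries.substAlgHom hasSubst_locVar

/-! ### Divided difference operators -/

/-- The element `α_i(a)` of the simple root `α_i`. -/
noncomputable def α : CType → ℕ → Ser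
  | _, (i + 1) => oplus β (av i) (bar β (av (i + 1)))
  | .B, 0 => bar β (av 0)
  | .C, 0 => oplus β (bar β (av 0)) (bar β (av 0))
  | .D, 0 => oplus β (bar β (av 0)) (bar β (av 1))

/-- `q = (f - (1 + β α_i(a)) s_i^{(a)} f) / α_i(a)`. -/
def IsPi (X : CType) (i : ℕ) (f q : Ser) : Prop :=
  α X i * q = f - (1 + β • α X i) * sAct X i f

open Classical in
/-- The divided difference operator `π_i^{(a)}` (`0` where the division is not exact). -/
noncomputable def piOp (X : CType) (i : ℕ) (f : Ser) : Ser :=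
  if h : ∃ q, IsPi X i f q then h.choose else 0

/-- The divided difference operator `ψ_i^{(a)} = π_i^{(a)} + β`. -/
noncomputable def psiOp (X : CType) (i : ℕ) (f : Ser) : Ser := piOp X i f + β • f

/-- `ψ_{i_1}^{(a)} ⋯ ψ_{i_l}^{(a)} f`. -/
noncomputable def psiWord (X : CType) (l : List ℕ) (f : Ser) : Ser := l.foldr (psiOp X) f

/-- `ψ_v^{(a)} = ψ_{i_1}^{(a)} ⋯ ψ_{i_l}^{(a)}`, where `v = s_{i_1} ⋯ s_{i_l}` is a reduced
expression. -/
noncomputable def psi (X : CType) (v : Weyl X) (f : Ser) : Ser := psiWord X (reducedWord X v) f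

/-! ### The idCoxeter algebra

Over the ambient ring, `Id_β(W)` is the free module with basis `(u_w)` and the multiplication given
by `u_w u_i = u_{w s_i}` if `ℓ(w s_i) > ℓ(w)` and `u_w u_i = β u_w` otherwise. It acts faithfully on
itself by right multiplication, and its elements are identified with the corresponding operators;
`z` is recovered from its operator as `u_e z`. -/

/-- Right multiplication by `u_i` on the free module with basis `(u_w)`. -/
noncomputable def rightMul (X : CType) (i : ℕ) : (Weyl X →₀ Ser) →ₗ[Ser] (Weyl X →₀ Ser) :=
  Finsupp.linearCombination Ser fun w =>
    if len X w < len X (w * s X i) then Finsupp.single (w * s X i) 1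
    else Finsupp.single w (MvPowerSeries.C β)

/-- The algebra of right operators on the free module with basis `(u_w)`; the opposite makes
products of right operators read from left to right. -/
abbrev IdAlg (X : CType) : Type := (Module.End Ser (Weyl X →₀ Ser))ᵐᵒᵖ

/-- The generator `u_i`. -/
noncomputable def u (X : CType) (i : ℕ) : IdAlg X := MulOpposite.op (rightMul X i)

/-- The coefficient of `u_w` in `z`. -/
noncomputable def coeffU (X : CType) (z : IdAlg X) (w : Weyl X) : Ser :=
  (MulOpposite.unop z (Finsupp.single 1 1)) w

/-- `h_i(y) = 1 + y u_i`. -/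
noncomputable def h (X : CType) (i : ℕ) (y : Ser) : IdAlg X := 1 + y • u X i

/-- `A_i^{(n)}(y) = h_{n-1}(y) h_{n-2}(y) ⋯ h_i(y)`. -/
noncomputable def A (X : CType) (n i : ℕ) (y : Ser) : IdAlg X :=
  ((List.range' i (n - i)).reverse.map fun k => h X k y).prod

/-- `A_i^{(n)}(ȳ)⁻¹ = h_i(y) h_{i+1}(y) ⋯ h_{n-1}(y)`. -/
noncomputable def Arev (X : CType) (n i : ℕ) (y : Ser) : IdAlg X :=
  ((List.range' i (n - i)).map fun k => h X k y).prod

/-- `F_n^X(y)`, namely `A_1^{(n)}(y) h_0(y) A_1^{(n)}(ȳ)⁻¹` in type `B`,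
`A_1^{(n)}(y) h_0(y)² A_1^{(n)}(ȳ)⁻¹` in type `C` and
`A_2^{(n)}(y) h_{1̂}(y) h_1(y) A_2^{(n)}(ȳ)⁻¹` in type `D`. -/
noncomputable def F1 (X : CType) (n : ℕ) (y : Ser) : IdAlg X :=
  match X with
  | .B => A .B n 1 y * h .B 0 y * Arev .B n 1 y
  | .C => A .C n 1 y * h .C 0 y ^ 2 * Arev .C n 1 y
  | .D => A .D n 2 y * (h .D 0 y * h .D 1 y) * Arev .D n 2 y

/-- `F_n^X(x_1, …, x_n) = F_n^X(x_1) ⋯ F_n^X(x_n)`. -/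
noncomputable def FF (X : CType) (n : ℕ) : IdAlg X :=
  ((List.range n).map fun k => F1 X n (xv k)).prod

/-- `G_{A_{n-1}}(y_1, …, y_{n-1}) = A_1^{(n)}(y_1) A_2^{(n)}(y_2) ⋯ A_{n-1}^{(n)}(y_{n-1})`. -/
noncomputable def GA (X : CType) (n : ℕ) (y : ℕ → Ser) : IdAlg X :=
  ((List.range (n - 1)).map fun k => A X n (k + 1) (y k)).prod

theorem rightMul_single (X : CType) (i : ℕ) (w : Weyl X) (c : Ser) :
    rightMul X i (Finsupp.single w c) =
      if len X w < len X (w * s X i) then Finsupp.single (w * s X i) c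
      else Finsupp.single w (MvPowerSeries.C β * c) := by
  rw [rightMul, Finsupp.linearCombination_single]
  split_ifs <;> simp [mul_comm]

theorem u_mul_self (X : CType) (i : ℕ) :
    u X i * u X i = (MvPowerSeries.C β : Ser) • u X i := by
  apply MulOpposite.unop_injective
  refine Finsupp.lhom_ext fun w c => ?_
  change rightMul X i (rightMul X i _) = (MvPowerSeries.C β : Ser) • rightMul X i _
  rw [rightMul_single]
  have hw : w * s X i * s X i = w := by rw [mul_assoc, s_mul_self, mul_one]
  split_ifs with hl
  · rw [rightMul_single, hw, if_neg (not_lt.mpr hl.le), Finsupp.smul_single, smul_eq_mul]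
  · rw [rightMul_single, if_neg hl, Finsupp.smul_single, smul_eq_mul]

theorem one_add_smul_mul {R M : Type*} [CommRing R] [Ring M] [Algebra R M] {c : R} {m : M}
    (hm : m * m = c • m) (y z : R) :
    (1 + y • m) * (1 + z • m) = 1 + (y + z + c * y * z) • m := by
  have hu : (y • m) * (z • m) = (c * y * z) • m := by
    rw [smul_mul_smul_comm, hm, smul_smul, show y * z * c = c * y * z by ring]
  rw [mul_add, mul_one, add_mul, one_mul, hu, add_smul, add_smul]
  abel

theorem h_mul_h (X : CType) (i : ℕ) (y z : Ser) : h X i y * h X i z = h X i (oplus β y z) := by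
  have := one_add_smul_mul (R := Ser) (M := IdAlg X) (u_mul_self X i) y z
  unfold h oplus
  exact this

theorem bar_constantCoeff (y : Ser) (hy : MvPowerSeries.constantCoeff y = 0) :
    MvPowerSeries.constantCoeff (bar β y) = 0 := by
  simp [bar, hy]

theorem isUnit_h (X : CType) (i : ℕ) (y : Ser) (hy : MvPowerSeries.constantCoeff y = 0) :
    IsUnit (h X i y) := by
  have h0 : h X i 0 = 1 := by simp [h]
  have hc : oplus β (bar β y) y = oplus β y (bar β y) := by unfold oplus; ring
  exact ⟨⟨h X i y, h X i (bar β y), by rw [h_mul_h, oplus_bar _ _ hy, h0],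
    by rw [h_mul_h, hc, oplus_bar _ _ hy, h0]⟩, rfl⟩

theorem isUnit_listProd {M : Type*} [Monoid M] (l : List M) (hl : ∀ m ∈ l, IsUnit m) :
    IsUnit l.prod := by
  induction l with
  | nil => simp
  | cons m l ih =>
    rw [List.prod_cons]
    exact (hl m (by simp)).mul (ih fun m' hm' => hl m' (by simp [hm']))

/-- `G_{A_{n-1}}(y)` is invertible, so that its inverse below is a genuine one. -/
theorem isUnit_GA (X : CType) (n : ℕ) (y : ℕ → Ser)
    (hy : ∀ k, MvPowerSeries.constantCoeff (y k) = 0) : IsUnit (GA X n y) := by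
  refine isUnit_listProd _ fun m hm => ?_
  obtain ⟨k, -, rfl⟩ := List.mem_map.mp hm
  refine isUnit_listProd _ fun m' hm' => ?_
  obtain ⟨j, -, rfl⟩ := List.mem_map.mp hm'
  exact isUnit_h X j _ (hy k)

/-! ### Double Grothendieck polynomials -/

/-- `G_n^X(a, b; x) = G_{A_{n-1}}(b̄_1, …, b̄_{n-1})⁻¹ F_n^X(x) G_{A_{n-1}}(a_1, …, a_{n-1})`. -/
noncomputable def GG (X : CType) (n : ℕ) : IdAlg X :=
  Ring.inverse (GA X n fun k => bar β (bv k)) * FF X n * GA X n av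

/-- `𝒢_{n,w}^X(a, b; x)`, the coefficient of `u_w` in `G_n^X(a, b; x)`. -/
noncomputable def grothN (X : CType) (n : ℕ) (w : Weyl X) : Ser := coeffU X (GG X n) w

/-- The double Grothendieck polynomial `𝒢_w^X(a, b; x)`, the coefficient of `u_w` in
`G_A(b̄)⁻¹ F_∞^X(x) G_A(a) = lim_n G_n^X(a, b; x)`. -/
noncomputable def groth (X : CType) (w : Weyl X) : Ser := formalLim fun n => grothN X n w

end DoubleGroth

open DoubleGroth

/-! The series that are symmetric, stable and supersymmetric in x form a ring `dom` on which the
substitutions s_i^{(a)} act as a representation of the Weyl group. The two sides of a braid relation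
put variables in front of x that differ only in their order or by cancelling pairs t, t̄, and such
series do not see the difference. On the zero locus of the root α_i the substitution s_i is trivial
on `dom`. Hence α_i divides f − s_i f (`α_dvd`), and s_i f = f + ᾱ_i ψ_i f (`sAct_eq`). Expanding
the braid relations of the s_i in this form and cancelling the roots gives the braid relations of
the ψ_i (`psi_braid`). With the exchange property they yield the independence of the reduced word
(`psiWord_eq_of_reduced`).

The formula comes from two equal recursions along a word w. Let f|_w be the value of w f at e.
Appending a letter i replaces f by f + ᾱ_i ψ_i f, and ψ_v ψ_i follows the multiplication rule of the
idCoxeter algebra (`pairing_psiOp`). So f|_w is the sum of the ψ_v(f)|_e, weighted by the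
coefficients of a product of factors h_i. On the other side, the Yang–Baxter relations show that the
F(y) commute and that reflecting the arguments of G_A(b̄)⁻¹ F(z) G_A(y) multiplies it on the right
by the same h_i (`FU_mul_GU`, `GFG_step`). Therefore f|_w = Σ_v ψ_v(f)|_e 𝒢_v|_w
(`ev_wPt_eq_pairing`).

These values determine f, because f involves only finitely many a and b. A long word takes n of the
x to b̄_{n+1}, …, b̄_{2n} in some order, the other x to 0, and a_j to b̄_{2n+j}
(`exists_word_localize`). For large n these b occur neither in f nor in the coefficients ψ_v(f)|_e
that matter in a given degree. They are thus free, and replacing them by x̄ and ā (`backPt`)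
recovers f with the remaining x set to 0 (`coeff_eq_sum_grothN`).

The sum is formal because 𝒢_v has order at least ℓ(v) and only finitely many v of bounded length
have ψ_v f ≠ 0. The limit over n exists because the coefficient of u_v does not see h_i for large i,
and F(0) = 1. -/

namespace DoubleGroth

/-! ### The formal group law on power series without constant term -/

section FormalGroup

variable {σ R : Type*} [CommRing R] {b : R} {x y : MvPowerSeries σ R}

theorem bar_spec (hx : MvPowerSeries.constantCoeff x = 0) :
    x + bar b x + MvPowerSeries.C b * x * bar b x = 0 := oplus_bar b x hx

theorem isUnit_one_add (hx : MvPowerSeries.constantCoeff x = 0) :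
    IsUnit (1 + MvPowerSeries.C b * x) := by
  rw [MvPowerSeries.isUnit_iff_constantCoeff]
  simp [hx]

/-- Cancellation of the unit 1 + βx. The identities for the formal inverse below are reduced to this
uniqueness. -/
theorem bar_unique (hx : MvPowerSeries.constantCoeff x = 0)
    (h : x + y + MvPowerSeries.C b * x * y = 0) : bar b x = y := by
  refine (isUnit_one_add (b := b) hx).mul_left_cancel ?_
  linear_combination bar_spec (b := b) hx - h

theorem constantCoeff_bar (hx : MvPowerSeries.constantCoeff x = 0) :
    MvPowerSeries.constantCoeff (bar b x) = 0 := by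
  simp [bar, hx]

theorem constantCoeff_oplus (hx : MvPowerSeries.constantCoeff x = 0)
    (hy : MvPowerSeries.constantCoeff y = 0) :
    MvPowerSeries.constantCoeff (oplus b x y) = 0 := by
  simp [oplus, hx, hy]

theorem bar_bar (hx : MvPowerSeries.constantCoeff x = 0) : bar b (bar b x) = x :=
  bar_unique (constantCoeff_bar hx) (by linear_combination bar_spec (b := b) hx)

theorem bar_zero : bar b (0 : MvPowerSeries σ R) = 0 := by simp [bar]

theorem bar_oplus (hx : MvPowerSeries.constantCoeff x = 0)
    (hy : MvPowerSeries.constantCoeff y = 0) :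
    bar b (oplus b x y) = oplus b (bar b x) (bar b y) := by
  refine bar_unique (constantCoeff_oplus hx hy) ?_
  have h1 := bar_spec (b := b) hx
  have h2 := bar_spec (b := b) hy
  unfold oplus
  linear_combination (1 + MvPowerSeries.C b * y) * (1 + MvPowerSeries.C b * bar b y) * h1 + h2

theorem oplus_comm (x y : MvPowerSeries σ R) : oplus b x y = oplus b y x := by
  unfold oplus; ring

theorem oplus_assoc (x y z : MvPowerSeries σ R) :
    oplus b (oplus b x y) z = oplus b x (oplus b y z) := by
  unfold oplus; ring

theorem oplus_zero (x : MvPowerSeries σ R) : oplus b x 0 = x := by simp [oplus]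

theorem zero_oplus (x : MvPowerSeries σ R) : oplus b 0 x = x := by simp [oplus]

theorem bar_oplus_self (hx : MvPowerSeries.constantCoeff x = 0) : oplus b (bar b x) x = 0 := by
  rw [oplus_comm, oplus_bar b x hx]

/-- The formal inverse is determined by an algebraic equation, so any ring homomorphism respects it
and no continuity is needed. -/
theorem map_bar_of {τ S F : Type*} [CommRing S] [FunLike F (MvPowerSeries σ R) (MvPowerSeries τ S)]
    [RingHomClass F (MvPowerSeries σ R) (MvPowerSeries τ S)] (φ : F) {c : S}
    (hφ : φ (MvPowerSeries.C b) = MvPowerSeries.C c) (hx : MvPowerSeries.constantCoeff x = 0)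
    (hx' : MvPowerSeries.constantCoeff (φ x) = 0) : φ (bar b x) = bar c (φ x) := by
  refine (bar_unique hx' ?_).symm
  rw [← hφ, ← map_mul, ← map_mul, ← map_add, ← map_add, bar_spec hx, map_zero]

end FormalGroup

/-! ### Points and evaluation -/

/-- A point: a family of power series that can be substituted for the variables. -/
@[ext]
structure Pt where
  /-- the value at each variable -/
  val : Var → Ser
  hasSubst : MvPowerSeries.HasSubst val

namespace Pt

/-- Evaluation at a point. -/
noncomputable def ev (q : Pt) : Ser →ₐ[Polynomial ℚ] Ser := MvPowerSeries.substAlgHom q.hasSubst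

@[simp]
theorem ev_X (q : Pt) (v : Var) : q.ev (MvPowerSeries.X v) = q.val v := by
  rw [ev, MvPowerSeries.substAlgHom_X]

@[simp] theorem ev_xv (q : Pt) (k : ℕ) : q.ev (xv k) = q.val (.x k) := q.ev_X _
@[simp] theorem ev_av (q : Pt) (k : ℕ) : q.ev (av k) = q.val (.a k) := q.ev_X _
@[simp] theorem ev_bv (q : Pt) (k : ℕ) : q.ev (bv k) = q.val (.b k) := q.ev_X _

@[simp]
theorem ev_C (q : Pt) (c : Polynomial ℚ) : q.ev (MvPowerSeries.C c) = MvPowerSeries.C c :=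
  q.ev.commutes c

theorem constantCoeff_val (q : Pt) (v : Var) : MvPowerSeries.constantCoeff (q.val v) = 0 :=
  (q.hasSubst.const_coeff v).eq_zero

theorem constantCoeff_ev (q : Pt) {f : Ser} (hf : MvPowerSeries.constantCoeff f = 0) :
    MvPowerSeries.constantCoeff (q.ev f) = 0 := by
  rw [ev, MvPowerSeries.substAlgHom_apply]
  exact MvPowerSeries.constantCoeff_subst_eq_zero q.hasSubst q.constantCoeff_val hf

theorem ev_bar (q : Pt) {f : Ser} (hf : MvPowerSeries.constantCoeff f = 0) :
    q.ev (bar β f) = bar β (q.ev f) :=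
  map_bar_of q.ev (q.ev_C β) hf (q.constantCoeff_ev hf)

theorem ev_oplus (q : Pt) (f g : Ser) :
    q.ev (oplus β f g) = oplus β (q.ev f) (q.ev g) := by
  simp [oplus]

/-- The point with `(q.comp r).ev f = q.ev (r.ev f)`. -/
noncomputable def comp (q r : Pt) : Pt where
  val v := q.ev (r.val v)
  hasSubst := by
    have := MvPowerSeries.HasSubst.comp r.hasSubst q.hasSubst
    simpa [ev, MvPowerSeries.substAlgHom_apply] using this

theorem ev_ev (q r : Pt) (f : Ser) : q.ev (r.ev f) = (q.comp r).ev f := by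
  simp only [ev, MvPowerSeries.substAlgHom_apply]
  rw [MvPowerSeries.subst_comp_subst_apply r.hasSubst q.hasSubst]
  congr 1
  funext v
  simp [comp, ev]

@[simp] theorem comp_val (q r : Pt) (v : Var) : (q.comp r).val v = q.ev (r.val v) := rfl

/-- The identical point. -/
noncomputable def one : Pt := ⟨MvPowerSeries.X, MvPowerSeries.HasSubst.X⟩

@[simp] theorem one_x (k : ℕ) : one.val (.x k) = xv k := rfl
@[simp] theorem one_a (k : ℕ) : one.val (.a k) = av k := rfl
@[simp] theorem one_b (k : ℕ) : one.val (.b k) = bv k := rfl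

@[simp]
theorem ev_one (f : Ser) : one.ev f = f := by
  rw [ev, MvPowerSeries.substAlgHom_apply]
  exact congrFun MvPowerSeries.subst_self f

theorem one_comp (q : Pt) : one.comp q = q := by ext1; funext v; simp

theorem comp_one (q : Pt) : q.comp one = q := by ext1; funext v; simp [one]

theorem comp_assoc (p q r : Pt) : (p.comp q).comp r = p.comp (q.comp r) := by
  ext1; funext v; simp [ev_ev]

theorem ext' {p q : Pt} (hx : ∀ k, p.val (.x k) = q.val (.x k))
    (ha : ∀ k, p.val (.a k) = q.val (.a k)) (hb : ∀ k, p.val (.b k) = q.val (.b k)) : p = q := by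
  ext1; funext v
  cases v with
  | x k => exact hx k
  | a k => exact ha k
  | b k => exact hb k

/-- Two points that agree up to an injective relabelling on all but finitely many variables. -/
theorem hasSubst_of_finite {f : Var → Ser} (q : Pt) (e : Var → Var) (T : Set Var) (hT : T.Finite)
    (hf : ∀ v, MvPowerSeries.constantCoeff (f v) = 0)
    (he : ∀ v w, v ∉ T → w ∉ T → e v = e w → v = w)
    (h : ∀ v, v ∉ T → f v = q.val (e v)) : MvPowerSeries.HasSubst f where
  const_coeff v := by rw [hf v]; exact IsNilpotent.zero
  coeff_zero d := by
    have h1 : ({v | v ∉ T ∧ MvPowerSeries.coeff d (f v) ≠ 0}).Finite := by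
      refine Set.Finite.of_finite_image (f := e) ((q.hasSubst.coeff_zero d).subset ?_) ?_
      · rintro _ ⟨v, ⟨hv, hv'⟩, rfl⟩
        simpa [← h v hv] using hv'
      · intro v hv w hw hvw
        exact he v w hv.1 hw.1 hvw
    refine (hT.union h1).subset fun v hv => ?_
    by_cases hvT : v ∈ T
    · exact Or.inl hvT
    · exact Or.inr ⟨hvT, hv⟩

/-- The point with `x₁ = y`, and `x_{k+1}` evaluated as `x_k` at `q`. -/
noncomputable def cons (y : Ser) (hy : MvPowerSeries.constantCoeff y = 0) (q : Pt) : Pt where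
  val
    | .x 0 => y
    | .x (k + 1) => q.val (.x k)
    | .a k => q.val (.a k)
    | .b k => q.val (.b k)
  hasSubst := by
    refine hasSubst_of_finite q
      (fun v => match v with | .x k => .x (k - 1) | .a k => .a k | .b k => .b k) {.x 0}
      (Set.finite_singleton _) ?_ ?_ ?_
    · rintro ((_ | k) | k | k) <;> first | exact hy | exact q.constantCoeff_val _
    · rintro ((_ | k) | k | k) ((_ | l) | l | l) <;> simp
    · rintro ((_ | k) | k | k) <;> simp

section

variable (y : Ser) (hy : MvPowerSeries.constantCoeff y = 0) (q : Pt) (k : ℕ)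

@[simp] theorem cons_x_zero : (cons y hy q).val (.x 0) = y := rfl
@[simp] theorem cons_x_succ : (cons y hy q).val (.x (k + 1)) = q.val (.x k) := rfl
@[simp] theorem cons_a : (cons y hy q).val (.a k) = q.val (.a k) := rfl
@[simp] theorem cons_b : (cons y hy q).val (.b k) = q.val (.b k) := rfl

theorem comp_cons (p : Pt) :
    p.comp (cons y hy q) = cons (p.ev y) (p.constantCoeff_ev hy) (p.comp q) :=
  ext' (by rintro (_ | k) <;> rfl) (fun _ => rfl) fun _ => rfl

end

/-- Exchange of the values at `x_{k+1}` and `x_{k+2}`. -/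
noncomputable def swapX (k : ℕ) (q : Pt) : Pt where
  val
    | .x j => q.val (.x (Equiv.swap k (k + 1) j))
    | .a j => q.val (.a j)
    | .b j => q.val (.b j)
  hasSubst := by
    refine hasSubst_of_finite q
      (fun v => match v with | .x j => .x (Equiv.swap k (k + 1) j) | .a j => .a j | .b j => .b j) ∅
      Set.finite_empty ?_ ?_ ?_
    · rintro (_ | _ | _) <;> exact q.constantCoeff_val _
    · rintro (_ | _ | _) (_ | _ | _) <;> simp
    · rintro (_ | _ | _) <;> simp

@[simp] theorem swapX_x (k : ℕ) (q : Pt) (j : ℕ) :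
    (swapX k q).val (.x j) = q.val (.x (Equiv.swap k (k + 1) j)) := rfl
@[simp] theorem swapX_a (k : ℕ) (q : Pt) (j : ℕ) : (swapX k q).val (.a j) = q.val (.a j) := rfl
@[simp] theorem swapX_b (k : ℕ) (q : Pt) (j : ℕ) : (swapX k q).val (.b j) = q.val (.b j) := rfl

theorem swapX_comp (k : ℕ) (p q : Pt) : p.comp (swapX k q) = swapX k (p.comp q) :=
  ext' (fun _ => rfl) (fun _ => rfl) fun _ => rfl

/-- The values at `x_{k+2}` as values at `x_{k+1}`. -/
noncomputable def tail (q : Pt) : Pt where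
  val
    | .x j => q.val (.x (j + 1))
    | .a j => q.val (.a j)
    | .b j => q.val (.b j)
  hasSubst := by
    refine hasSubst_of_finite q
      (fun v => match v with | .x j => .x (j + 1) | .a j => .a j | .b j => .b j) ∅
      Set.finite_empty ?_ ?_ ?_
    · rintro (_ | _ | _) <;> exact q.constantCoeff_val _
    · rintro (_ | _ | _) (_ | _ | _) <;> simp
    · rintro (_ | _ | _) <;> simp

@[simp] theorem tail_x (q : Pt) (j : ℕ) : (tail q).val (.x j) = q.val (.x (j + 1)) := rfl
@[simp] theorem tail_a (q : Pt) (j : ℕ) : (tail q).val (.a j) = q.val (.a j) := rfl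
@[simp] theorem tail_b (q : Pt) (j : ℕ) : (tail q).val (.b j) = q.val (.b j) := rfl

open Classical in
/-- The identical point with `0` in place of the variables outside `S`. -/
noncomputable def kill (S : Set Var) : Pt where
  val v := if v ∈ S then MvPowerSeries.X v else 0
  hasSubst := by
    refine ⟨fun v => ?_, fun d => ((one.hasSubst.coeff_zero d).subset fun v hv => ?_)⟩
    · split_ifs <;> simp
    · by_contra h
      simp only [Set.mem_ofPred_eq, not_not, one] at h hv
      split_ifs at hv with h'
      · exact hv h
      · simp at hv

theorem kill_mem {S : Set Var} {v : Var} (hv : v ∈ S) : (kill S).val v = MvPowerSeries.X v := by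
  simp [kill, hv]

theorem kill_notMem {S : Set Var} {v : Var} (hv : v ∉ S) : (kill S).val v = 0 := by
  simp [kill, hv]

theorem coeff_kill (S : Set Var) (f : Ser) (d : Var →₀ ℕ) (hd : ∀ v ∈ d.support, v ∈ S) :
    MvPowerSeries.coeff d ((kill S).ev f) = MvPowerSeries.coeff d f := by
  rw [ev, MvPowerSeries.substAlgHom_apply, MvPowerSeries.coeff_subst (kill S).hasSubst,
    finsum_eq_single _ d]
  · have : (d.prod fun s e => (kill S).val s ^ e) = MvPowerSeries.monomial d 1 := by
      rw [MvPowerSeries.monomial_one_eq]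
      exact Finset.prod_congr rfl fun v hv => by simp only [kill_mem (hd v hv)]
    rw [this]
    simp
  · intro e he
    by_cases h : ∀ v ∈ e.support, v ∈ S
    · have : (e.prod fun s e => (kill S).val s ^ e) = MvPowerSeries.monomial e 1 := by
        rw [MvPowerSeries.monomial_one_eq]
        exact Finset.prod_congr rfl fun v hv => by simp only [kill_mem (h v hv)]
      rw [this, MvPowerSeries.coeff_monomial_ne he.symm, smul_zero]
    · push Not at h
      obtain ⟨v, hv, hv'⟩ := h
      have : (e.prod fun s e => (kill S).val s ^ e) = 0 := by
        refine Finset.prod_eq_zero hv ?_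
        simp only [kill_notMem hv']
        exact zero_pow (by simpa using hv)
      rw [this, map_zero, smul_zero]

end Pt

open Pt

@[simp] theorem constantCoeff_xv (k : ℕ) : MvPowerSeries.constantCoeff (xv k) = 0 :=
  MvPowerSeries.constantCoeff_X _
@[simp] theorem constantCoeff_av (k : ℕ) : MvPowerSeries.constantCoeff (av k) = 0 :=
  MvPowerSeries.constantCoeff_X _
@[simp] theorem constantCoeff_bv (k : ℕ) : MvPowerSeries.constantCoeff (bv k) = 0 :=
  MvPowerSeries.constantCoeff_X _

/-! ### Symmetric, stable and supersymmetric power series -/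

/-- The power series that are symmetric, stable and `β`-supersymmetric in `x`. -/
noncomputable def dom : Subalgebra (Polynomial ℚ) Ser where
  carrier := {f | (∀ k, (swapX k one).ev f = f) ∧ (cons 0 (map_zero _) one).ev f = f ∧
    (cons (xv 0) (constantCoeff_xv 0)
      (cons (bar β (xv 0)) (constantCoeff_bar (constantCoeff_xv 0)) (tail one))).ev f =
      (tail one).ev f}
  mul_mem' := fun {f g} hf hg => ⟨fun k => by rw [map_mul, hf.1, hg.1],
    by rw [map_mul, hf.2.1, hg.2.1], by rw [map_mul, hf.2.2, hg.2.2, map_mul]⟩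
  add_mem' := fun {f g} hf hg => ⟨fun k => by rw [map_add, hf.1, hg.1],
    by rw [map_add, hf.2.1, hg.2.1], by rw [map_add, hf.2.2, hg.2.2, map_add]⟩
  algebraMap_mem' r := ⟨fun k => by rw [AlgHom.commutes], by rw [AlgHom.commutes],
    by rw [AlgHom.commutes, AlgHom.commutes]⟩

theorem swapX_cons (k : ℕ) (y : Ser) (hy : MvPowerSeries.constantCoeff y = 0) (q : Pt) :
    swapX (k + 1) (cons y hy q) = cons y hy (swapX k q) := by
  refine ext' ?_ (fun _ => rfl) fun _ => rfl
  rintro (_ | j)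
  · have : Equiv.swap (k + 1) (k + 1 + 1) 0 = 0 :=
      Equiv.swap_apply_of_ne_of_ne (by omega) (by omega)
    simp [this]
  · have : Equiv.swap (k + 1) (k + 1 + 1) (j + 1) = Equiv.swap k (k + 1) j + 1 := by
      simp only [Equiv.swap_apply_def]
      split_ifs <;> omega
    simp [this]

theorem swapX_cons_cons {y z : Ser} (hy : MvPowerSeries.constantCoeff y = 0)
    (hz : MvPowerSeries.constantCoeff z = 0) (q : Pt) :
    swapX 0 (cons z hz (cons y hy q)) = cons y hy (cons z hz q) := by
  refine ext' (fun k => ?_) (fun _ => rfl) fun _ => rfl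
  match k with
  | 0 => rw [swapX_x, Equiv.swap_apply_left]; rfl
  | 1 => rw [swapX_x, Equiv.swap_apply_right]; rfl
  | k + 2 =>
    have : Equiv.swap 0 (0 + 1) (k + 1 + 1) = k + 1 + 1 :=
      Equiv.swap_apply_of_ne_of_ne (by omega) (by omega)
    rw [swapX_x, this]; rfl
/-- Iteration of `cons`. -/
noncomputable def conses (l : List {y : Ser // MvPowerSeries.constantCoeff y = 0}) (q : Pt) : Pt :=
  l.foldr (fun y q => cons y.1 y.2 q) q

theorem conses_cons (y : {y : Ser // MvPowerSeries.constantCoeff y = 0})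
    (l : List {y : Ser // MvPowerSeries.constantCoeff y = 0}) (q : Pt) :
    conses (y :: l) q = cons y.1 y.2 (conses l q) := rfl

theorem conses_append (l l' : List {y : Ser // MvPowerSeries.constantCoeff y = 0}) (q : Pt) :
    conses (l ++ l') q = conses l (conses l' q) := List.foldr_append

section dom

variable {f : Ser} (hf : f ∈ dom)

include hf

theorem ev_swapX (k : ℕ) (q : Pt) : (swapX k q).ev f = q.ev f := by
  conv_rhs => rw [← hf.1 k, ev_ev, swapX_comp, comp_one]

theorem ev_cons_zero (q : Pt) : (cons 0 (map_zero _) q).ev f = q.ev f := by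
  conv_rhs => rw [← hf.2.1, ev_ev, comp_cons, comp_one]
  simp only [map_zero]

/-- The condition in `dom` concerns the generic pair x_1, x̄_1. Evaluating it at the point `cons y
hy q`, whose tail is q, gives the cancellation of an arbitrary pair. -/
theorem ev_cons_bar {y z : Ser} (hy : MvPowerSeries.constantCoeff y = 0)
    (hz : MvPowerSeries.constantCoeff z = 0) (h : z = bar β y) (q : Pt) :
    (cons y hy (cons z hz q)).ev f = q.ev f := by
  subst h
  have h1 := congrArg (cons y hy q).ev hf.2.2
  rw [ev_ev, ev_ev, comp_cons, comp_cons] at h1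
  have h2 : (cons y hy q).comp (tail one) = q :=
    ext' (fun _ => by simp) (fun _ => by simp) fun _ => by simp
  have h3 : cons y hy (cons (bar β y) hz q) = cons ((cons y hy q).ev (xv 0))
      ((cons y hy q).constantCoeff_ev (constantCoeff_xv 0)) (cons ((cons y hy q).ev (bar β (xv 0)))
      ((cons y hy q).constantCoeff_ev (constantCoeff_bar (constantCoeff_xv 0))) q) := by
    refine ext' (fun k => ?_) (fun _ => rfl) fun _ => rfl
    match k with
    | 0 => simp
    | 1 => simp [ev_bar]
    | k + 2 => rfl
  rw [h2] at h1
  rw [h3]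
  exact h1

theorem ev_conses_perm {l l' : List {y : Ser // MvPowerSeries.constantCoeff y = 0}}
    (h : l.Perm l') (q : Pt) : (conses l q).ev f = (conses l' q).ev f := by
  -- A transposition of two list entries behind a prefix is the exchange of the x at position
  -- `pre.length`; the prefix has to be carried through the induction.
  suffices ∀ pre, (conses (pre ++ l) q).ev f = (conses (pre ++ l') q).ev f from this []
  induction h with
  | nil => exact fun _ => rfl
  | cons x h ih =>
    intro pre
    simpa using ih (pre ++ [x])
  | swap x y l =>
    intro pre
    rw [← ev_swapX hf pre.length]
    congr 2
    induction pre with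
    | nil => exact swapX_cons_cons x.2 y.2 _
    | cons z pre ih =>
      simp only [List.cons_append, List.length_cons, conses_cons]
      rw [swapX_cons, ih]
  | trans h1 h2 ih1 ih2 => exact fun pre => (ih1 pre).trans (ih2 pre)

end dom

theorem mem_dom {f : Ser} (h1 : ∀ k q, (swapX k q).ev f = q.ev f)
    (h2 : ∀ q, (cons 0 (map_zero _) q).ev f = q.ev f)
    (h3 : ∀ y hy q, (cons y hy (cons (bar β y) (constantCoeff_bar hy) q)).ev f = q.ev f) :
    f ∈ dom :=
  ⟨fun k => by rw [h1, ev_one], by rw [h2, ev_one], h3 _ _ _⟩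

/-! ### The points that define the operators -/

/-- The point of the operator `s_i^{(a)}`. -/
noncomputable def sPt (X : CType) (i : ℕ) : Pt := ⟨sVar X i, hasSubst_sVar X i⟩

/-- The point of the localization. -/
noncomputable def locPt : Pt := ⟨locVar, hasSubst_locVar⟩

theorem sAct_eq_ev (X : CType) (i : ℕ) (f : Ser) : sAct X i f = (sPt X i).ev f := rfl

theorem locE_eq_ev (f : Ser) : locE f = locPt.ev f := rfl

theorem ev_sVar_a (X : CType) (i k : ℕ) {p q : Pt} (h : ∀ k, p.val (.a k) = q.val (.a k)) :
    p.ev (sVar X i (.a k)) = q.ev (sVar X i (.a k)) := by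
  unfold sVar
  split <;> simp_all [ev_bar]

theorem ev_α (X : CType) (i : ℕ) {p q : Pt} (h : ∀ k, p.val (.a k) = q.val (.a k)) :
    p.ev (α X i) = q.ev (α X i) := by
  unfold α
  split <;> simp_all [ev_bar, ev_oplus]

theorem constantCoeff_α (X : CType) (i : ℕ) : MvPowerSeries.constantCoeff (α X i) = 0 := by
  unfold α
  split <;> simp [constantCoeff_bar, constantCoeff_oplus]

theorem α_mem_dom (X : CType) (i : ℕ) : α X i ∈ dom :=
  mem_dom (fun _ _ => ev_α X i fun _ => rfl) (fun _ => ev_α X i fun _ => rfl)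
    fun _ _ _ => ev_α X i fun _ => rfl

theorem sVar_a_of_le (X : CType) (i k : ℕ) (hk : i + 2 ≤ k) : sVar X i (.a k) = av k := by
  match X, i, k, hk with
  | X, i + 1, k, hk =>
    have : Equiv.swap i (i + 1) k = k := Equiv.swap_apply_of_ne_of_ne (by omega) (by omega)
    cases X <;> simp [sVar, this]
  | .B, 0, k + 2, _ => rfl
  | .C, 0, k + 2, _ => rfl
  | .D, 0, k + 2, _ => rfl

/-- The action of `s_i^{(a)}` on the variables `a` only. -/
noncomputable def aPt (X : CType) (i : ℕ) : Pt where
  val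
    | .x k => xv k
    | .a k => sVar X i (.a k)
    | .b k => bv k
  hasSubst := by
    refine hasSubst_of_finite one (fun v => v) (Set.range fun k : Fin (i + 2) => Var.a k)
      (Set.finite_range _) ?_ ?_ ?_
    · rintro (k | k | k)
      · exact constantCoeff_xv k
      · exact (sPt X i).constantCoeff_val (.a k)
      · exact constantCoeff_bv k
    · exact fun _ _ _ _ h => h
    · rintro (k | k | k) hk
      · rfl
      · have hk' : i + 2 ≤ k := by
          by_contra hlt
          exact hk ⟨⟨k, by omega⟩, rfl⟩
        exact sVar_a_of_le X i k hk'
      · rfl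

@[simp] theorem aPt_x (X : CType) (i k : ℕ) : (aPt X i).val (.x k) = xv k := rfl
@[simp] theorem aPt_a (X : CType) (i k : ℕ) : (aPt X i).val (.a k) = sVar X i (.a k) := rfl
@[simp] theorem aPt_b (X : CType) (i k : ℕ) : (aPt X i).val (.b k) = bv k := rfl

theorem sPt_succ (X : CType) (i : ℕ) : sPt X (i + 1) = aPt X (i + 1) :=
  ext' (fun _ => by cases X <;> rfl) (fun _ => rfl) fun _ => by cases X <;> rfl

theorem sPt_zero_B : sPt .B 0 = cons (av 0) (constantCoeff_av 0) (aPt .B 0) :=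
  ext' (by rintro (_ | k) <;> rfl) (fun _ => rfl) fun _ => rfl

theorem sPt_zero_C : sPt .C 0 = cons (av 0) (constantCoeff_av 0) (aPt .C 0) :=
  ext' (by rintro (_ | k) <;> rfl) (fun _ => rfl) fun _ => rfl

theorem sPt_zero_D : sPt .D 0 = cons (av 0) (constantCoeff_av 0)
    (cons (av 1) (constantCoeff_av 1) (aPt .D 0)) :=
  ext' (by rintro (_ | _ | k) <;> rfl) (fun _ => rfl) fun _ => rfl

theorem swapX_comp_aPt (k : ℕ) (q : Pt) (X : CType) (i : ℕ) :
    (swapX k q).comp (aPt X i) = swapX k (q.comp (aPt X i)) :=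
  ext' (fun _ => by simp) (fun _ => ev_sVar_a X i _ fun _ => rfl) fun _ => by simp

theorem cons_comp_aPt (y : Ser) (hy : MvPowerSeries.constantCoeff y = 0) (q : Pt) (X : CType)
    (i : ℕ) : (cons y hy q).comp (aPt X i) = cons y hy (q.comp (aPt X i)) :=
  ext' (by rintro (_ | k) <;> simp) (fun _ => ev_sVar_a X i _ fun _ => rfl) fun _ => by simp

theorem swapX_conses (k : ℕ) (l : List {y : Ser // MvPowerSeries.constantCoeff y = 0}) (q : Pt) :
    swapX (k + l.length) (conses l q) = conses l (swapX k q) := by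
  induction l with
  | nil => rfl
  | cons y l ih => rw [conses_cons, List.length_cons, ← add_assoc, swapX_cons, ih]; rfl

/-- A list of variables as evaluated at a point. -/
noncomputable def evList (p : Pt) (l : List {y : Ser // MvPowerSeries.constantCoeff y = 0}) :
    List {y : Ser // MvPowerSeries.constantCoeff y = 0} :=
  l.map fun y => ⟨p.ev y.1, p.constantCoeff_ev y.2⟩

theorem comp_conses (p q : Pt) (l : List {y : Ser // MvPowerSeries.constantCoeff y = 0}) :
    p.comp (conses l q) = conses (evList p l) (p.comp q) := by
  induction l with
  | nil => rfl
  | cons y l ih => rw [conses_cons, comp_cons, ih]; rfl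

theorem evList_congr {p q : Pt} {l : List {y : Ser // MvPowerSeries.constantCoeff y = 0}}
    (h : ∀ y ∈ l, p.ev y.1 = q.ev y.1) : evList p l = evList q l :=
  List.map_congr_left fun y hy => Subtype.ext (h y hy)

/-- The variables `a` that `s_i^{(a)}` puts in front of the variables `x`. -/
noncomputable def preList : CType → ℕ → List {y : Ser // MvPowerSeries.constantCoeff y = 0}
  | .B, 0 => [⟨av 0, constantCoeff_av 0⟩]
  | .C, 0 => [⟨av 0, constantCoeff_av 0⟩]
  | .D, 0 => [⟨av 0, constantCoeff_av 0⟩, ⟨av 1, constantCoeff_av 1⟩]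
  | _, _ + 1 => []

/-- Separates the effect of s_i on a from the variables inserted in front of x, so that symmetry and
cancellation in x can be moved past the latter. -/
theorem sPt_eq (X : CType) (i : ℕ) : sPt X i = conses (preList X i) (aPt X i) := by
  cases i with
  | zero =>
    cases X with
    | B => exact sPt_zero_B
    | C => exact sPt_zero_C
    | D => exact sPt_zero_D
  | succ i => cases X <;> exact sPt_succ _ i

theorem evList_preList (X : CType) (i : ℕ) {p q : Pt} (h : ∀ k, p.val (.a k) = q.val (.a k)) :
    evList p (preList X i) = evList q (preList X i) := by
  refine evList_congr fun y hy => ?_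
  unfold preList at hy
  split at hy
  · simp_all
  · simp_all
  · simp only [List.mem_cons, List.not_mem_nil, or_false] at hy
    rcases hy with rfl | rfl <;> simp [h]
  · simp at hy

/-- The inserted variables depend on a only. An exchange, a zero or a cancelling pair among the x
therefore reappears behind them. The exchange acts further down the list; the zero and the pair are
brought to the front by symmetry. -/
theorem sAct_mem_dom (X : CType) (i : ℕ) {f : Ser} (hf : f ∈ dom) : sAct X i f ∈ dom := by
  rw [sAct_eq_ev, sPt_eq]
  refine mem_dom (fun k q => ?_) (fun q => ?_) fun y hy q => ?_
  · rw [ev_ev, ev_ev, comp_conses, comp_conses, evList_preList X i (p := swapX k q) (q := q)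
      fun _ => rfl, swapX_comp_aPt, ← swapX_conses, ev_swapX hf]
  · rw [ev_ev, ev_ev, comp_conses, comp_conses, evList_preList X i (p := cons _ _ q) (q := q)
      fun _ => rfl, cons_comp_aPt]
    have h := ev_conses_perm hf (List.perm_append_comm (l₁ := evList q (preList X i))
      (l₂ := [⟨0, map_zero _⟩])) (q.comp (aPt X i))
    rw [conses_append, conses_append] at h
    exact h.trans (ev_cons_zero hf _)
  · rw [ev_ev, ev_ev, comp_conses, comp_conses, evList_preList X i
      (p := cons y hy (cons _ _ q)) (q := q) fun _ => rfl, cons_comp_aPt, cons_comp_aPt]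
    have h := ev_conses_perm hf (List.perm_append_comm (l₁ := evList q (preList X i))
      (l₂ := [⟨y, hy⟩, ⟨bar β y, constantCoeff_bar hy⟩])) (q.comp (aPt X i))
    rw [conses_append, conses_append] at h
    exact h.trans (ev_cons_bar hf hy (constantCoeff_bar hy) rfl _)

/-- `dom` is saturated with respect to the elements that only involve the variables `a`. -/
theorem mem_dom_of_mul {f g : Ser} (hf : f ≠ 0)
    (ha : ∀ p q : Pt, (∀ k, p.val (.a k) = q.val (.a k)) → p.ev f = q.ev f) (h : f * g ∈ dom) :
    g ∈ dom := by
  have h1 : ∀ p : Pt, (∀ k, p.val (.a k) = one.val (.a k)) → p.ev f = f := fun p hp => by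
    rw [ha p one hp, ev_one]
  obtain ⟨ha, hb, hc⟩ := h
  refine ⟨fun k => ?_, ?_, ?_⟩
  · have := ha k
    rw [map_mul, h1 (swapX k one) fun _ => rfl] at this
    exact mul_left_cancel₀ hf this
  · rw [map_mul, h1 (cons _ _ one) fun _ => rfl] at hb
    exact mul_left_cancel₀ hf hb
  · rw [map_mul, map_mul, h1 (cons _ _ (cons _ _ (tail one))) fun _ => rfl,
      h1 (tail one) fun _ => rfl] at hc
    exact mul_left_cancel₀ hf hc

/-! ### Divisibility by roots -/

open Classical in
/-- The point with `p` in place of the variable `v`. -/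
noncomputable def repl (v : Var) (p : Ser) (hp : MvPowerSeries.constantCoeff p = 0) : Pt where
  val := Function.update one.val v p
  hasSubst := by
    refine hasSubst_of_finite one (fun v => v) {v} (Set.finite_singleton v) (fun w => ?_)
      (fun _ _ _ _ h => h) fun w hw => Function.update_of_ne hw _ _
    by_cases h : w = v
    · subst h; simpa using hp
    · rw [Function.update_of_ne h]; exact one.constantCoeff_val w

theorem repl_self (v : Var) (p : Ser) (hp : MvPowerSeries.constantCoeff p = 0) :
    (repl v p hp).val v = p := by
  simp [repl]

theorem repl_of_ne {v w : Var} (h : w ≠ v) (p : Ser) (hp : MvPowerSeries.constantCoeff p = 0) :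
    (repl v p hp).val w = MvPowerSeries.X w := by
  simp [repl, h, one]

/-- The power series `p` does not involve the variable `v`. -/
def FreeOf (v : Var) (p : Ser) : Prop :=
  ∀ q q' : Pt, (∀ w, w ≠ v → q.val w = q'.val w) → q.ev p = q'.ev p

/-- The remainder theorem. The shift v ↦ v + p turns the divisor into the variable v itself, where
the claim is visible on coefficients; v ↦ v − p shifts back. Both shifts fix p because p is free of
v. -/
theorem dvd_sub_ev {v : Var} {p : Ser} (hp : MvPowerSeries.constantCoeff p = 0)
    (hv : FreeOf v p) (g : Ser) :
    (MvPowerSeries.X v - p : Ser) ∣ g - (repl v p hp).ev g := by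
  have hc : MvPowerSeries.constantCoeff (MvPowerSeries.X v + p : Ser) = 0 := by simp [hp]
  have hc' : MvPowerSeries.constantCoeff (MvPowerSeries.X v - p : Ser) = 0 := by simp [hp]
  have hfix : ∀ r (hr : MvPowerSeries.constantCoeff r = 0), (repl v r hr).ev p = p := by
    intro r hr
    rw [hv (repl v r hr) one fun w hw => repl_of_ne hw _ _, ev_one]
  set K : Pt := repl v 0 (map_zero _) with hK
  set φ := repl v (MvPowerSeries.X v + p) hc with hφ
  set φ' := repl v (MvPowerSeries.X v - p) hc' with hφ'
  have h1 : (MvPowerSeries.X v : Ser) ∣ φ.ev g - K.ev (φ.ev g) := by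
    have hKk : K = kill {w | w ≠ v} := by
      ext1; funext w
      by_cases h : w = v
      · subst h; rw [hK, repl_self, kill_notMem (by simp)]
      · rw [hK, repl_of_ne h, kill_mem (by simpa using h)]
    rw [MvPowerSeries.X_dvd_iff]
    intro d hd
    rw [map_sub, hKk, coeff_kill, sub_self]
    intro w hw hwv
    simp only [Finsupp.mem_support_iff] at hw
    exact hw (hwv ▸ hd)
  have h2 := map_dvd φ'.ev h1
  have e1 : φ'.comp φ = one := by
    ext1; funext w
    by_cases h : w = v
    · subst h
      rw [comp_val, hφ, repl_self, map_add, hfix, ev_X, hφ', repl_self]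
      simp [one]
    · rw [comp_val, hφ, repl_of_ne h, ev_X, hφ', repl_of_ne h]; rfl
  have e2 : φ'.comp (K.comp φ) = repl v p hp := by
    ext1; funext w
    by_cases h : w = v
    · subst h
      rw [comp_val, comp_val, hφ, repl_self, map_add, hfix, ev_X, hK, repl_self, zero_add, hfix,
        repl_self]
    · rw [comp_val, comp_val, hφ, repl_of_ne h, ev_X, hK, repl_of_ne h, ev_X, hφ', repl_of_ne h,
        repl_of_ne h]
  rw [ev_X, map_sub, ev_ev, ev_ev, ev_ev, comp_assoc, e1, ev_one, e2, hφ', repl_self] at h2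
  exact h2

/-- If the variable v were equal to a series free of v, setting v = 0 would not change it. -/
theorem X_sub_ne_zero {v : Var} {p : Ser} (hv : FreeOf v p) : (MvPowerSeries.X v - p : Ser) ≠ 0 := by
  intro h
  have h1 := hv (repl v 0 (map_zero _)) one fun w hw => repl_of_ne hw _ _
  rw [← sub_eq_zero.mp h, ev_X, ev_X, repl_self] at h1
  have := congrArg (MvPowerSeries.coeff (Finsupp.single v 1)) h1
  simp [one] at this

theorem freeOf_av {i j : ℕ} (h : i ≠ j) : FreeOf (.a i) (av j) := fun q q' hq => by
  rw [ev_av, ev_av, hq]; simpa using h.symm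

theorem freeOf_bar {v : Var} {p : Ser} (hp : MvPowerSeries.constantCoeff p = 0) (h : FreeOf v p) :
    FreeOf v (bar β p) := fun q q' hq => by
  rw [ev_bar _ hp, ev_bar _ hp, h q q' hq]

/-- On the zero locus of a root the reflection fixes all values of a and b. What it puts in front of
x is nothing for i ≥ 1, a zero in types B and C, and the cancelling pair ā_2, a_2 in type D. A unit
factor makes the root linear in one variable, as `dvd_sub_ev` requires. -/
theorem root_data (X : CType) (i : ℕ) : ∃ (v : Var) (p : Ser) (hp : MvPowerSeries.constantCoeff p = 0)
    (w : Ser), IsUnit w ∧ α X i * w = MvPowerSeries.X v - p ∧ FreeOf v p ∧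
      ∀ f ∈ dom, (repl v p hp).ev (sAct X i f) = (repl v p hp).ev f := by
  cases i with
  | succ i =>
    refine ⟨.a i, av (i + 1), constantCoeff_av _, 1 + MvPowerSeries.C β * av (i + 1),
      isUnit_one_add (constantCoeff_av _), ?_, freeOf_av (by omega), fun f _ => ?_⟩
    · have h : α X (i + 1) = oplus β (av i) (bar β (av (i + 1))) := by cases X <;> rfl
      rw [h]
      have := bar_spec (b := β) (constantCoeff_av (i + 1))
      unfold oplus
      change _ = av i - _
      linear_combination (1 + MvPowerSeries.C β * av i) * this
    · rw [sAct_eq_ev, ev_ev, sPt_succ]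
      congr 2
      refine ext' (fun k => by simp) (fun k => ?_) fun k => by simp
      have h : sVar X (i + 1) (.a k) = av (Equiv.swap i (i + 1) k) := by cases X <;> rfl
      have h1 : ∀ hp, (repl (.a i) (av (i + 1)) hp).val (.a (i + 1)) = av (i + 1) := fun hp =>
        repl_of_ne (by simp) _ _
      rw [comp_val, aPt_a, h, ev_av, Equiv.swap_apply_def]
      split_ifs with h2 h3
      · rw [h2, repl_self, h1]
      · rw [h3, repl_self, h1]
      · rfl
  | zero =>
    have hs : ∀ X, sPt X 0 = cons (av 0) (constantCoeff_av 0) (aPt X 0) →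
        sVar X 0 (.a 0) = bar β (av 0) → (∀ k, sVar X 0 (.a (k + 1)) = av (k + 1)) →
        ∀ f ∈ dom, (repl (.a 0) 0 (map_zero _)).ev (sAct X 0 f) =
          (repl (.a 0) 0 (map_zero _)).ev f := by
      intro X hX h0 h1 f hf
      rw [sAct_eq_ev, ev_ev, hX, comp_cons]
      have h2 := ev_cons_zero hf ((repl (.a 0) 0 (map_zero _)).comp (aPt X 0))
      have h3 : (repl (.a 0) 0 (map_zero _)).ev (av 0) = 0 := by rw [ev_av, repl_self]
      simp only [h3]
      rw [h2]
      congr 2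
      refine ext' (fun k => by simp) (fun k => ?_) fun k => by simp
      cases k with
      | zero => rw [comp_val, aPt_a, h0, ev_bar _ (constantCoeff_av 0), h3, repl_self, bar_zero]
      | succ k => rw [comp_val, aPt_a, h1, ev_av]
    have hb := bar_spec (b := β) (constantCoeff_av 0)
    have hf0 : ∀ v, FreeOf v 0 := fun v q q' _ => by simp
    cases X with
    | B =>
      refine ⟨.a 0, 0, map_zero _, -(1 + MvPowerSeries.C β * av 0),
        (isUnit_one_add (constantCoeff_av 0)).neg, ?_, hf0 _,
        hs _ sPt_zero_B rfl fun _ => rfl⟩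
      change bar β (av 0) * _ = av 0 - 0
      linear_combination - hb
    | C =>
      -- The root of type C is ā_1(2 + βā_1). The second factor is a unit only because 2 is
      -- invertible, which is where rational coefficients are needed.
      have h2 : IsUnit (2 + MvPowerSeries.C β * bar β (av 0)) := by
        rw [MvPowerSeries.isUnit_iff_constantCoeff]
        have : MvPowerSeries.constantCoeff (2 + MvPowerSeries.C β * bar β (av 0)) =
            Polynomial.C (2 : ℚ) := by
          simp only [map_add, map_mul, constantCoeff_bar (constantCoeff_av 0), mul_zero, add_zero]
          exact map_ofNat _ 2
        rw [this, Polynomial.isUnit_C]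
        exact isUnit_iff_ne_zero.mpr two_ne_zero
      obtain ⟨w, hw⟩ := h2.exists_right_inv
      refine ⟨.a 0, 0, map_zero _, -(1 + MvPowerSeries.C β * av 0) * w,
        (isUnit_one_add (constantCoeff_av 0)).neg.mul (IsUnit.of_mul_eq_one_right _ hw), ?_, hf0 _,
        hs _ sPt_zero_C rfl fun _ => rfl⟩
      change oplus β (bar β (av 0)) (bar β (av 0)) * _ = av 0 - 0
      unfold oplus
      linear_combination - hb - (1 + MvPowerSeries.C β * av 0) * bar β (av 0) * hw
    | D =>
      have hb1 := bar_spec (b := β) (constantCoeff_av 1)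
      have hc1 : MvPowerSeries.constantCoeff (bar β (av 1)) = 0 :=
        constantCoeff_bar (constantCoeff_av 1)
      refine ⟨.a 0, bar β (av 1), hc1, -(1 + MvPowerSeries.C β * av 0),
        (isUnit_one_add (constantCoeff_av 0)).neg, ?_,
        freeOf_bar (constantCoeff_av 1) (freeOf_av (by omega)), fun f hf => ?_⟩
      · change oplus β (bar β (av 0)) (bar β (av 1)) * _ = av 0 - bar β (av 1)
        unfold oplus
        linear_combination - (1 + MvPowerSeries.C β * bar β (av 1)) * hb
      · rw [sAct_eq_ev, ev_ev, sPt_zero_D, comp_cons, comp_cons]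
        have h0 : (repl (.a 0) (bar β (av 1)) hc1).ev (av 0) = bar β (av 1) := by
          rw [ev_av, repl_self]
        have h1 : (repl (.a 0) (bar β (av 1)) hc1).ev (av 1) = av 1 := by
          rw [ev_av, repl_of_ne (by simp)]; rfl
        simp only [h0, h1]
        rw [ev_cons_bar hf _ _ (bar_bar (constantCoeff_av 1)).symm]
        congr 2
        refine ext' (fun k => by simp) (fun k => ?_) fun k => by simp
        rw [comp_val, aPt_a]
        match k with
        | 0 =>
          change (repl _ _ _).ev (bar β (av 1)) = _
          rw [ev_bar _ (constantCoeff_av 1), h1, repl_self]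
        | 1 =>
          change (repl _ _ _).ev (bar β (av 0)) = _
          rw [ev_bar _ (constantCoeff_av 0), h0, bar_bar (constantCoeff_av 1),
            repl_of_ne (by simp)]; rfl
        | k + 2 => change (repl _ _ _).ev (av (k + 2)) = _; rw [ev_av]

theorem α_ne_zero (X : CType) (i : ℕ) : α X i ≠ 0 := by
  obtain ⟨v, p, hp, w, -, h, hv, -⟩ := root_data X i
  intro h0
  rw [h0, zero_mul] at h
  exact X_sub_ne_zero hv h.symm

theorem α_dvd (X : CType) (i : ℕ) {f : Ser} (hf : f ∈ dom) : α X i ∣ f - sAct X i f := by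
  obtain ⟨v, p, hp, w, -, h, hv, hs⟩ := root_data X i
  have h1 := dvd_sub_ev hp hv (f - sAct X i f)
  rw [map_sub, hs f hf, sub_self, sub_zero] at h1
  exact (Dvd.intro _ h).trans h1

/-! ### The operators `π_i` and `ψ_i` -/

theorem isPi_piOp (X : CType) (i : ℕ) {f : Ser} (hf : f ∈ dom) : IsPi X i f (piOp X i f) := by
  have h : ∃ q, IsPi X i f q := by
    obtain ⟨q, hq⟩ := α_dvd X i hf
    -- Since f − (1 + βα) s f = (f − s f) − βα s f, the quotient is that of f − s f minus β s f.
    refine ⟨q - MvPowerSeries.C β * sAct X i f, ?_⟩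
    rw [IsPi, MvPowerSeries.smul_eq_C_mul]
    linear_combination - hq
  rw [piOp, dif_pos h]
  exact h.choose_spec

theorem α_mul_psiOp (X : CType) (i : ℕ) {f : Ser} (hf : f ∈ dom) :
    α X i * psiOp X i f = (1 + MvPowerSeries.C β * α X i) * (f - sAct X i f) := by
  have h := isPi_piOp X i hf
  rw [IsPi, MvPowerSeries.smul_eq_C_mul] at h
  rw [psiOp, MvPowerSeries.smul_eq_C_mul]
  linear_combination h

/-- The action of a simple reflection in terms of `ψ_i`. -/
theorem sAct_eq (X : CType) (i : ℕ) {f : Ser} (hf : f ∈ dom) :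
    sAct X i f = f + bar β (α X i) * psiOp X i f := by
  refine (isUnit_one_add (b := β) (constantCoeff_α X i)).mul_left_cancel ?_
  linear_combination α_mul_psiOp X i hf - psiOp X i f * bar_spec (b := β) (constantCoeff_α X i)

theorem bar_ne_zero {f : Ser} (hf : MvPowerSeries.constantCoeff f = 0) (h : f ≠ 0) :
    bar β f ≠ 0 := by
  intro h0
  rw [← bar_bar (b := β) hf, h0, bar_zero] at h
  exact h rfl

/-- `ψ_i f` is the only solution of `s_i f = f + ᾱ_i ψ_i f`. -/
theorem psiOp_unique (X : CType) (i : ℕ) {f g : Ser} (hf : f ∈ dom)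
    (h : sAct X i f = f + bar β (α X i) * g) : psiOp X i f = g := by
  refine mul_left_cancel₀ (bar_ne_zero (constantCoeff_α X i) (α_ne_zero X i)) ?_
  linear_combination h - sAct_eq X i hf

/-- The multiple of ψ_i f by the root lies in `dom`, and the root can be cancelled because it
involves only the variables a. -/
theorem psiOp_mem_dom (X : CType) (i : ℕ) {f : Ser} (hf : f ∈ dom) : psiOp X i f ∈ dom := by
  refine mem_dom_of_mul (α_ne_zero X i) (fun p q h => ev_α X i h) ?_
  rw [α_mul_psiOp X i hf]
  exact mul_mem (add_mem (one_mem _) (mul_mem (Subalgebra.algebraMap_mem _ β) (α_mem_dom X i)))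
    (sub_mem hf (sAct_mem_dom X i hf))

theorem psiWord_mem_dom (X : CType) (l : List ℕ) {f : Ser} (hf : f ∈ dom) :
    psiWord X l f ∈ dom := by
  induction l with
  | nil => exact hf
  | cons i l ih => exact psiOp_mem_dom X i ih

theorem psiOp_mul (X : CType) (i : ℕ) {c f : Ser} (hc : c ∈ dom) (hc' : sAct X i c = c)
    (hf : f ∈ dom) : psiOp X i (c * f) = c * psiOp X i f := by
  refine psiOp_unique X i (mul_mem hc hf) ?_
  rw [map_mul, sAct_eq X i hf, hc']
  ring

theorem C_mem_dom (c : Polynomial ℚ) : (MvPowerSeries.C c : Ser) ∈ dom :=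
  Subalgebra.algebraMap_mem _ c

theorem psiOp_C_mul (X : CType) (i : ℕ) (c : Polynomial ℚ) {f : Ser} (hf : f ∈ dom) :
    psiOp X i (MvPowerSeries.C c * f) = MvPowerSeries.C c * psiOp X i f :=
  psiOp_mul X i (C_mem_dom c) ((sPt X i).ev_C c) hf

theorem psiWord_C_mul (X : CType) (l : List ℕ) (c : Polynomial ℚ) {f : Ser} (hf : f ∈ dom) :
    psiWord X l (MvPowerSeries.C c * f) = MvPowerSeries.C c * psiWord X l f := by
  induction l with
  | nil => rfl
  | cons i l ih =>
    change psiOp X i (psiWord X l _) = _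
    rw [ih, psiOp_C_mul X i c (psiWord_mem_dom X l hf)]
    rfl

theorem psiOp_zero (X : CType) (i : ℕ) : psiOp X i 0 = 0 :=
  psiOp_unique X i (zero_mem _) (by simp)

theorem psiOp_eq_zero (X : CType) (i : ℕ) {f : Ser} (hf : f ∈ dom) (h : sAct X i f = f) :
    psiOp X i f = 0 :=
  psiOp_unique X i hf (by simp [h])

/-! ### Rank two relations -/

/-- The point of `s_{i_1}^{(a)} ⋯ s_{i_l}^{(a)}`. -/
noncomputable def wPt (X : CType) (l : List ℕ) : Pt := l.foldr (fun i q => (sPt X i).comp q) one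

theorem wPt_nil (X : CType) : wPt X [] = one := rfl
theorem wPt_cons (X : CType) (i : ℕ) (l : List ℕ) : wPt X (i :: l) = (sPt X i).comp (wPt X l) := rfl

theorem ev_wPt_cons (X : CType) (i : ℕ) (l : List ℕ) (f : Ser) :
    (wPt X (i :: l)).ev f = sAct X i ((wPt X l).ev f) := by
  rw [wPt_cons, ← ev_ev]; rfl

theorem sPt_succ_x (X : CType) (i k : ℕ) : (sPt X (i + 1)).val (.x k) = xv k := by cases X <;> rfl
theorem sPt_succ_a (X : CType) (i k : ℕ) :
    (sPt X (i + 1)).val (.a k) = av (Equiv.swap i (i + 1) k) := by cases X <;> rfl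
theorem sPt_b (X : CType) (i k : ℕ) : (sPt X i).val (.b k) = bv k := by
  cases X <;> cases i <;> rfl

theorem wPt_succ_x (X : CType) (l : List ℕ) (k : ℕ) :
    (wPt X (l.map (· + 1))).val (.x k) = xv k := by
  induction l with
  | nil => rfl
  | cons i l ih => rw [List.map_cons, wPt_cons, comp_val, ih, ev_xv, sPt_succ_x]

theorem wPt_b (X : CType) (l : List ℕ) (k : ℕ) : (wPt X l).val (.b k) = bv k := by
  induction l with
  | nil => rfl
  | cons i l ih => rw [wPt_cons, comp_val, ih, ev_bv, sPt_b]

theorem wPt_succ_a (X : CType) (l : List ℕ) (k : ℕ) :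
    (wPt X (l.map (· + 1))).val (.a k) = av ((l.map fun i => Equiv.swap i (i + 1)).prod k) := by
  induction l with
  | nil => rfl
  | cons i l ih =>
    rw [List.map_cons, wPt_cons, comp_val, ih, ev_av, sPt_succ_a, List.map_cons, List.prod_cons,
      Equiv.Perm.mul_apply]

theorem wPt_succ_eq (X : CType) {l l' : List ℕ}
    (h : (l.map fun i => Equiv.swap i (i + 1)).prod = (l'.map fun i => Equiv.swap i (i + 1)).prod) :
    wPt X (l.map (· + 1)) = wPt X (l'.map (· + 1)) :=
  ext' (fun k => by rw [wPt_succ_x, wPt_succ_x]) (fun k => by rw [wPt_succ_a, wPt_succ_a, h])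
    fun k => by rw [wPt_b, wPt_b]

theorem swap_of_lt {i k : ℕ} (h : k < i) : Equiv.swap i (i + 1) k = k :=
  Equiv.swap_apply_of_ne_of_ne (by omega) (by omega)

theorem swap_of_gt {i k : ℕ} (h : i + 1 < k) : Equiv.swap i (i + 1) k = k :=
  Equiv.swap_apply_of_ne_of_ne (by omega) (by omega)

theorem sPt_zero_x_B (k : ℕ) : (sPt .B 0).val (.x (k + 1)) = xv k := rfl
theorem sPt_zero_x_C (k : ℕ) : (sPt .C 0).val (.x (k + 1)) = xv k := rfl
theorem sPt_zero_x_D (k : ℕ) : (sPt .D 0).val (.x (k + 2)) = xv k := rfl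
theorem sPt_zero_x_zero (X : CType) : (sPt X 0).val (.x 0) = av 0 := by cases X <;> rfl
theorem sPt_zero_x_one_D : (sPt .D 0).val (.x 1) = av 1 := rfl
theorem sPt_zero_a_B : (sPt .B 0).val (.a 0) = bar β (av 0) := rfl
theorem sPt_zero_a_C : (sPt .C 0).val (.a 0) = bar β (av 0) := rfl
theorem sPt_zero_a_zero_D : (sPt .D 0).val (.a 0) = bar β (av 1) := rfl
theorem sPt_zero_a_one_D : (sPt .D 0).val (.a 1) = bar β (av 0) := rfl
theorem sPt_zero_a_succ_B (k : ℕ) : (sPt .B 0).val (.a (k + 1)) = av (k + 1) := rfl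
theorem sPt_zero_a_succ_C (k : ℕ) : (sPt .C 0).val (.a (k + 1)) = av (k + 1) := rfl
theorem sPt_zero_a_succ_D (k : ℕ) : (sPt .D 0).val (.a (k + 2)) = av (k + 2) := rfl

/-- Both words put a_1 and a_2 in front of x, but in opposite orders. The relation holds only up to
an exchange of x_1 and x_2. -/
theorem wPt_B_01 : wPt .B [0, 1, 0, 1] = swapX 0 (wPt .B [1, 0, 1, 0]) := by
  refine ext' (fun k => ?_) (fun k => ?_) fun k => by rw [swapX_b, wPt_b, wPt_b]
  all_goals
    rcases k with _ | _ | k <;>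
    simp [wPt, sPt_zero_x_B, sPt_zero_x_zero, sPt_zero_a_B, sPt_zero_a_succ_B, ev_bar, swap_of_gt, sPt_succ_x .B 0, sPt_succ_a .B 0, sPt_zero_a_succ_B 0]

theorem wPt_D_01 : wPt .D [0, 1] = swapX 0 (wPt .D [1, 0]) := by
  refine ext' (fun k => ?_) (fun k => ?_) fun k => by rw [swapX_b, wPt_b, wPt_b]
  all_goals
    rcases k with _ | _ | k <;>
    simp [wPt, sPt_zero_x_D, sPt_zero_x_zero, sPt_zero_x_one_D, sPt_zero_a_zero_D, sPt_zero_a_one_D,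
      sPt_zero_a_succ_D, ev_bar, swap_of_gt, sPt_succ_x .D 0,
      sPt_succ_a .D 0]

/-- The word s_{1̂} s_2 s_{1̂} inserts four variables, among them the cancelling pair ā_2, a_2,
while s_2 s_{1̂} s_2 inserts only a_1 and a_3; the two tails drop these. The braid relation thus
needs supersymmetry. -/
theorem wPt_D_02 : wPt .D [0, 2, 0] = conses [⟨bar β (av 1), constantCoeff_bar (constantCoeff_av 1)⟩,
    ⟨av 2, constantCoeff_av 2⟩, ⟨av 0, constantCoeff_av 0⟩, ⟨av 1, constantCoeff_av 1⟩]
      (tail (tail (wPt .D [2, 0, 2]))) := by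
  refine ext' (fun k => ?_) (fun k => ?_) fun k => by
    simp only [conses, List.foldr, cons_b, tail_b, wPt_b]
  all_goals
    rcases k with _ | _ | _ | _ | k <;>
    simp [wPt, sPt_zero_x_D, sPt_zero_x_zero, sPt_zero_x_one_D, sPt_zero_a_zero_D, sPt_zero_a_one_D,
      sPt_zero_a_succ_D, ev_bar, swap_of_gt, sPt_succ_x .D 1,
      sPt_succ_a .D 1, conses, sPt_zero_a_succ_D 0, sPt_zero_a_succ_D 1, swap_of_lt, bar_bar]

/-- The square of s_0 leaves the pair ā_1, a_1 in front of x, so s_0 is an involution only on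
supersymmetric series. -/
theorem wPt_invol_B : wPt .B [0, 0] = conses [⟨bar β (av 0), constantCoeff_bar (constantCoeff_av 0)⟩,
    ⟨av 0, constantCoeff_av 0⟩] one := by
  refine ext' (fun k => ?_) (fun k => ?_) fun k => by simp [conses, wPt_b]
  all_goals
    rcases k with _ | _ | k <;>
    simp [wPt, sPt_zero_x_B, sPt_zero_x_zero, sPt_zero_a_B, sPt_zero_a_succ_B, ev_bar, conses,
      sPt_zero_a_succ_B 0, sPt_zero_x_B 0, bar_bar]

theorem wPt_invol_D : wPt .D [0, 0] = conses [⟨bar β (av 1), constantCoeff_bar (constantCoeff_av 1)⟩,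
    ⟨bar β (av 0), constantCoeff_bar (constantCoeff_av 0)⟩,
    ⟨av 0, constantCoeff_av 0⟩, ⟨av 1, constantCoeff_av 1⟩] one := by
  refine ext' (fun k => ?_) (fun k => ?_) fun k => by simp [conses, wPt_b]
  all_goals
    rcases k with _ | _ | _ | _ | k <;>
    simp [wPt, sPt_zero_x_D, sPt_zero_x_zero, sPt_zero_x_one_D, sPt_zero_a_zero_D, sPt_zero_a_one_D,
      sPt_zero_a_succ_D, ev_bar, conses, sPt_zero_a_succ_D 0, sPt_zero_a_succ_D 1, sPt_zero_x_D 0,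
      sPt_zero_x_D 1, bar_bar]

theorem wPt_comm_B (j : ℕ) : wPt .B [0, j + 2] = wPt .B [j + 2, 0] := by
  refine ext' (fun k => ?_) (fun k => ?_) fun k => by rw [wPt_b, wPt_b]
  · rcases k with _ | k <;>
    simp [wPt, sPt_zero_x_B, sPt_zero_x_zero, sPt_succ_x .B (j + 1), sPt_succ_a .B (j + 1),
      swap_of_lt]
  · rcases k with _ | k
    · simp [wPt, sPt_zero_a_B, sPt_succ_a .B (j + 1), ev_bar, swap_of_lt]
    · have : ∃ k', Equiv.swap (j + 1) (j + 1 + 1) (k + 1) = k' + 1 :=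
        Nat.exists_eq_succ_of_ne_zero fun h => by
          have := (Equiv.swap (j + 1) (j + 1 + 1)).injective (h.trans (swap_of_lt (i := j + 1)
            (Nat.succ_pos j)).symm)
          omega
      obtain ⟨k', hk'⟩ := this
      simp [wPt, sPt_zero_a_succ_B, sPt_succ_a .B (j + 1), hk']

/-- Types B and C share their substitutions; only the root α_0 differs. -/
theorem sPt_C (i : ℕ) : sPt .C i = sPt .B i := by
  refine ext' (fun k => ?_) (fun k => ?_) fun k => by rw [sPt_b, sPt_b]
  · rcases i with _ | i
    · rcases k with _ | k <;> rfl
    · rw [sPt_succ_x, sPt_succ_x]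
  · rcases i with _ | i
    · rcases k with _ | k <;> rfl
    · rw [sPt_succ_a, sPt_succ_a]

theorem wPt_C (l : List ℕ) : wPt .C l = wPt .B l := by
  induction l with
  | nil => rw [wPt_nil, wPt_nil]
  | cons i l ih => rw [wPt_cons, wPt_cons, ih, sPt_C]

theorem wPt_comm_D (j : ℕ) : wPt .D [0, j + 3] = wPt .D [j + 3, 0] := by
  refine ext' (fun k => ?_) (fun k => ?_) fun k => by rw [wPt_b, wPt_b]
  · rcases k with _ | _ | k <;>
    simp [wPt, sPt_zero_x_D, sPt_zero_x_zero, sPt_zero_x_one_D, sPt_succ_x .D (j + 2),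
      sPt_succ_a .D (j + 2), swap_of_lt]
  · rcases k with _ | _ | k
    · simp [wPt, sPt_zero_a_zero_D, sPt_succ_a .D (j + 2), ev_bar, swap_of_lt]
    · simp [wPt, sPt_zero_a_one_D, sPt_succ_a .D (j + 2), ev_bar, swap_of_lt]
    · have : ∃ k', Equiv.swap (j + 2) (j + 2 + 1) (k + 2) = k' + 2 := by
        rw [Equiv.swap_apply_def]
        split_ifs
        · exact ⟨j + 1, rfl⟩
        · exact ⟨j, rfl⟩
        · exact ⟨k, rfl⟩
      obtain ⟨k', hk'⟩ := this
      simp [wPt, sPt_zero_a_succ_D, sPt_succ_a .D (j + 2), hk']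

/-- `BraidRel X i j m` says that `i < j`, and that `s_i s_j` has order `m`. -/
inductive BraidRel : CType → ℕ → ℕ → ℕ → Prop
  | comm (X : CType) (i j : ℕ) (h : i + 2 ≤ j) : BraidRel X (i + 1) (j + 1) 2
  | braid (X : CType) (i : ℕ) : BraidRel X (i + 1) (i + 2) 3
  | comm_B (j : ℕ) : BraidRel .B 0 (j + 2) 2
  | comm_C (j : ℕ) : BraidRel .C 0 (j + 2) 2
  | braid_B : BraidRel .B 0 1 4
  | braid_C : BraidRel .C 0 1 4
  | comm_D (j : ℕ) : BraidRel .D 0 (j + 3) 2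
  | comm_D_one : BraidRel .D 0 1 2
  | braid_D : BraidRel .D 0 2 3

theorem exists_braidRel (X : CType) {i j : ℕ} (h : i < j) : ∃ m, BraidRel X i j m := by
  rcases i with _ | i
  · rcases X
    · rcases j with _ | _ | j
      · omega
      · exact ⟨_, .braid_B⟩
      · exact ⟨_, .comm_B j⟩
    · rcases j with _ | _ | j
      · omega
      · exact ⟨_, .braid_C⟩
      · exact ⟨_, .comm_C j⟩
    · rcases j with _ | _ | _ | j
      · omega
      · exact ⟨_, .comm_D_one⟩
      · exact ⟨_, .braid_D⟩
      · exact ⟨_, .comm_D j⟩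
  · rcases j with _ | j
    · omega
    · by_cases hj : j = i + 1
      · subst hj; exact ⟨_, .braid X i⟩
      · exact ⟨_, .comm X i j (by omega)⟩

/-- The alternating word `i, j, i, …` of length `m`. -/
def altWord (i j : ℕ) : ℕ → List ℕ
  | 0 => []
  | m + 1 => i :: altWord j i m

theorem ev_conses_cancel {f : Ser} (hf : f ∈ dom)
    {l l' : List {y : Ser // MvPowerSeries.constantCoeff y = 0}}
    {y z : {y : Ser // MvPowerSeries.constantCoeff y = 0}} (h : l.Perm (y :: z :: l'))
    (hz : z.1 = bar β y.1) (q : Pt) : (conses l q).ev f = (conses l' q).ev f := by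
  rw [ev_conses_perm hf h]
  exact ev_cons_bar hf y.2 z.2 hz _

theorem perm_four {α : Type*} (a b c d : α) : [a, b, c, d].Perm [a, d, b, c] :=
  .cons _ (List.perm_append_comm (l₁ := [b, c]) (l₂ := [d]))

theorem sAct_sAct (X : CType) (i : ℕ) {f : Ser} (hf : f ∈ dom) : sAct X i (sAct X i f) = f := by
  suffices (wPt X [i, i]).ev f = f by
    rw [ev_wPt_cons, ev_wPt_cons, wPt_nil, ev_one] at this
    exact this
  rcases i with _ | i
  · rcases X
    · rw [wPt_invol_B, ev_conses_cancel hf (.refl _) (bar_bar (constantCoeff_av 0)).symm]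
      exact ev_one f
    · rw [wPt_C, wPt_invol_B, ev_conses_cancel hf (.refl _) (bar_bar (constantCoeff_av 0)).symm]
      exact ev_one f
    · rw [wPt_invol_D, ev_conses_cancel hf (perm_four _ _ _ _) (bar_bar (constantCoeff_av 1)).symm,
        ev_conses_cancel hf (.refl _) (bar_bar (constantCoeff_av 0)).symm]
      exact ev_one f
  · have := wPt_succ_eq X (l := [i, i]) (l' := []) (by simp)
    simp only [List.map_cons, List.map_nil] at this
    rw [this, wPt_nil, ev_one]

theorem swap_comm_of_le {i j : ℕ} (h : i + 2 ≤ j) :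
    Equiv.swap i (i + 1) * Equiv.swap j (j + 1) = Equiv.swap j (j + 1) * Equiv.swap i (i + 1) := by
  ext k
  simp only [Equiv.Perm.mul_apply, Equiv.swap_apply_def]
  split_ifs <;> omega

theorem swap_braid (i : ℕ) :
    Equiv.swap i (i + 1) * (Equiv.swap (i + 1) (i + 2) * Equiv.swap i (i + 1)) =
      Equiv.swap (i + 1) (i + 2) * (Equiv.swap i (i + 1) * Equiv.swap (i + 1) (i + 2)) := by
  ext k
  simp only [Equiv.Perm.mul_apply, Equiv.swap_apply_def]
  split_ifs <;> omega

theorem BraidRel.ev_wPt {X : CType} {i j m : ℕ} (h : BraidRel X i j m) {f : Ser} (hf : f ∈ dom) :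
    (wPt X (altWord i j m)).ev f = (wPt X (altWord j i m)).ev f := by
  cases h with
  | comm X i j h =>
    have := wPt_succ_eq X (l := [i, j]) (l' := [j, i]) (by simpa using swap_comm_of_le h)
    exact congrArg (fun p => p.ev f) this
  | braid X i =>
    have := wPt_succ_eq X (l := [i, i + 1, i]) (l' := [i + 1, i, i + 1])
      (by simpa using swap_braid i)
    exact congrArg (fun p => p.ev f) this
  | comm_B j => exact congrArg (fun p => p.ev f) (wPt_comm_B j)
  | comm_C j => rw [wPt_C, wPt_C]; exact congrArg (fun p => p.ev f) (wPt_comm_B j)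
  | braid_B =>
    change (wPt .B [0, 1, 0, 1]).ev f = _
    rw [wPt_B_01, ev_swapX hf]; rfl
  | braid_C =>
    rw [wPt_C, wPt_C]
    change (wPt .B [0, 1, 0, 1]).ev f = _
    rw [wPt_B_01, ev_swapX hf]; rfl
  | comm_D j => exact congrArg (fun p => p.ev f) (wPt_comm_D j)
  | comm_D_one =>
    change (wPt .D [0, 1]).ev f = _
    rw [wPt_D_01, ev_swapX hf]; rfl
  | braid_D =>
    change (wPt .D [0, 2, 0]).ev f = _
    rw [wPt_D_02, ev_conses_cancel hf ((perm_four _ _ _ _).trans (.cons _ (.cons _ (.swap _ _ _))))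
      (bar_bar (constantCoeff_av 1)).symm]
    rw [show altWord 2 0 3 = [2, 0, 2] from rfl]
    refine congrArg (fun p => p.ev f) (ext' (fun k => ?_) (fun k => ?_) fun k => ?_)
    · rcases k with _ | _ | k
      · simp [conses, wPt, sPt_zero_x_zero, sPt_succ_x .D 1, sPt_succ_a .D 1, swap_of_lt]
      · simp [conses, wPt, sPt_zero_x_one_D, sPt_succ_x .D 1, sPt_succ_a .D 1]
      · simp only [conses, List.foldr, cons_x_succ, tail_x]
    · simp only [conses, List.foldr, cons_a, tail_a]
    · simp only [conses, List.foldr, cons_b, tail_b]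

/-! ### Relations between the operators `ψ_i` -/

/-- The parameter of the factor that belongs to a simple reflection. -/
noncomputable def cf (X : CType) (i : ℕ) : Ser := bar β (α X i)

theorem constantCoeff_cf (X : CType) (i : ℕ) : MvPowerSeries.constantCoeff (cf X i) = 0 :=
  constantCoeff_bar (constantCoeff_α X i)

theorem cf_ne_zero (X : CType) (i : ℕ) : cf X i ≠ 0 :=
  bar_ne_zero (constantCoeff_α X i) (α_ne_zero X i)

theorem cf_succ (X : CType) (i : ℕ) : cf X (i + 1) = oplus β (bar β (av i)) (av (i + 1)) := by
  have h : α X (i + 1) = oplus β (av i) (bar β (av (i + 1))) := by cases X <;> rfl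
  rw [cf, h, bar_oplus (constantCoeff_av i) (constantCoeff_bar (constantCoeff_av _)),
    bar_bar (constantCoeff_av _)]

theorem cf_zero_B : cf .B 0 = av 0 := bar_bar (constantCoeff_av 0)

theorem cf_zero_C : cf .C 0 = oplus β (av 0) (av 0) := by
  change bar β (oplus β (bar β (av 0)) (bar β (av 0))) = _
  rw [bar_oplus (constantCoeff_bar (constantCoeff_av 0)) (constantCoeff_bar (constantCoeff_av 0)),
    bar_bar (constantCoeff_av 0)]

theorem cf_zero_D : cf .D 0 = oplus β (av 0) (av 1) := by
  change bar β (oplus β (bar β (av 0)) (bar β (av 1))) = _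
  rw [bar_oplus (constantCoeff_bar (constantCoeff_av 0)) (constantCoeff_bar (constantCoeff_av 1)),
    bar_bar (constantCoeff_av 0), bar_bar (constantCoeff_av 1)]

theorem sAct_C (X : CType) (i : ℕ) (c : Polynomial ℚ) :
    sAct X i (MvPowerSeries.C c) = MvPowerSeries.C c := (sPt X i).ev_C c

theorem sAct_av_succ (X : CType) (i k : ℕ) :
    sAct X (i + 1) (av k) = av (Equiv.swap i (i + 1) k) := by
  rw [sAct_eq_ev, ev_av, sPt_succ_a]

theorem sAct_bar (X : CType) (i : ℕ) {f : Ser} (hf : MvPowerSeries.constantCoeff f = 0) :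
    sAct X i (bar β f) = bar β (sAct X i f) := (sPt X i).ev_bar hf

theorem sAct_oplus (X : CType) (i : ℕ) (f g : Ser) :
    sAct X i (oplus β f g) = oplus β (sAct X i f) (sAct X i g) := (sPt X i).ev_oplus f g

theorem sAct_zero_av_B (k : ℕ) : sAct .B 0 (av (k + 1)) = av (k + 1) := by
  rw [sAct_eq_ev, ev_av, sPt_zero_a_succ_B]
theorem sAct_zero_av_C (k : ℕ) : sAct .C 0 (av (k + 1)) = av (k + 1) := by
  rw [sAct_eq_ev, ev_av, sPt_zero_a_succ_C]
theorem sAct_zero_av_D (k : ℕ) : sAct .D 0 (av (k + 2)) = av (k + 2) := by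
  rw [sAct_eq_ev, ev_av, sPt_zero_a_succ_D]
theorem sAct_zero_av_zero_B : sAct .B 0 (av 0) = bar β (av 0) := by
  rw [sAct_eq_ev, ev_av, sPt_zero_a_B]
theorem sAct_zero_av_zero_C : sAct .C 0 (av 0) = bar β (av 0) := by
  rw [sAct_eq_ev, ev_av, sPt_zero_a_C]
theorem sAct_zero_av_zero_D : sAct .D 0 (av 0) = bar β (av 1) := by
  rw [sAct_eq_ev, ev_av, sPt_zero_a_zero_D]
theorem sAct_zero_av_one_D : sAct .D 0 (av 1) = bar β (av 0) := by
  rw [sAct_eq_ev, ev_av, sPt_zero_a_one_D]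

theorem sAct_cf (X : CType) (i : ℕ) : sAct X i (cf X i) = α X i := by
  rcases i with _ | i
  · rcases X
    · rw [cf_zero_B, sAct_zero_av_zero_B]; rfl
    · rw [cf_zero_C, sAct_oplus, sAct_zero_av_zero_C]; rfl
    · rw [cf_zero_D, sAct_oplus, sAct_zero_av_zero_D, sAct_zero_av_one_D, oplus_comm]; rfl
  · have h : α X (i + 1) = oplus β (av i) (bar β (av (i + 1))) := by cases X <;> rfl
    rw [cf_succ, h, sAct_oplus, sAct_bar _ _ (constantCoeff_av i), sAct_av_succ, sAct_av_succ,
      Equiv.swap_apply_left, Equiv.swap_apply_right, oplus_comm]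

theorem sAct_eq' (X : CType) (i : ℕ) {f : Ser} (hf : f ∈ dom) :
    sAct X i f = f + cf X i * psiOp X i f := sAct_eq X i hf

/-- Expand s_i s_i f = f by s_i = 1 + ᾱ_i ψ_i, with s_i ᾱ_i = α_i, and cancel α_i ᾱ_i. -/
theorem psiOp_psiOp (X : CType) (i : ℕ) {f : Ser} (hf : f ∈ dom) :
    psiOp X i (psiOp X i f) = MvPowerSeries.C β * psiOp X i f := by
  have h1 := sAct_sAct X i hf
  have h2 := psiOp_mem_dom X i hf
  rw [sAct_eq' X i hf, map_add, map_mul, sAct_eq' X i hf, sAct_eq' X i h2, sAct_cf] at h1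
  have h3 : α X i + cf X i + MvPowerSeries.C β * α X i * cf X i = 0 :=
    bar_spec (constantCoeff_α X i)
  refine mul_left_cancel₀ (mul_ne_zero (α_ne_zero X i) (cf_ne_zero X i)) ?_
  linear_combination h1 - psiOp X i f * h3

/-- The positive roots of a rank two system of type `A₁ × A₁`, `A₂` or `B₂`. -/
theorem BraidRel.two {X : CType} {i j : ℕ} (h : BraidRel X i j 2) :
    sAct X i (cf X j) = cf X j ∧ sAct X j (cf X i) = cf X i := by
  cases h with
  | comm X i j h =>
    constructor
    · rw [cf_succ, sAct_oplus, sAct_bar _ _ (constantCoeff_av j), sAct_av_succ, sAct_av_succ,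
        swap_of_gt (by omega), swap_of_gt (by omega)]
    · rw [cf_succ, sAct_oplus, sAct_bar _ _ (constantCoeff_av i), sAct_av_succ, sAct_av_succ,
        swap_of_lt (by omega), swap_of_lt (by omega)]
  | comm_B j =>
    constructor
    · rw [cf_succ, sAct_oplus, sAct_bar _ _ (constantCoeff_av (j + 1)), sAct_zero_av_B,
        sAct_zero_av_B]
    · rw [cf_zero_B, sAct_av_succ, swap_of_lt (by omega)]
  | comm_C j =>
    constructor
    · rw [cf_succ, sAct_oplus, sAct_bar _ _ (constantCoeff_av (j + 1)), sAct_zero_av_C,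
        sAct_zero_av_C]
    · rw [cf_zero_C, sAct_oplus, sAct_av_succ, swap_of_lt (by omega)]
  | comm_D j =>
    constructor
    · rw [cf_succ, sAct_oplus, sAct_bar _ _ (constantCoeff_av (j + 2)), sAct_zero_av_D,
        sAct_zero_av_D (j + 1)]
    · rw [cf_zero_D, sAct_oplus, sAct_av_succ, sAct_av_succ, swap_of_lt (by omega),
        swap_of_lt (by omega)]
  | comm_D_one =>
    constructor
    · rw [cf_succ, sAct_oplus, sAct_bar _ _ (constantCoeff_av 0), sAct_zero_av_zero_D,
        sAct_zero_av_one_D, bar_bar (constantCoeff_av 1), oplus_comm]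
    · rw [cf_zero_D, sAct_oplus, sAct_av_succ, sAct_av_succ, Equiv.swap_apply_left,
        Equiv.swap_apply_right, oplus_comm]

theorem oplus_bar_cancel {x : Ser} (y : Ser) (hx : MvPowerSeries.constantCoeff x = 0) :
    oplus β (bar β x) (oplus β x y) = y := by
  rw [← oplus_assoc, bar_oplus_self hx, zero_oplus]

theorem BraidRel.three {X : CType} {i j : ℕ} (h : BraidRel X i j 3) :
    sAct X i (cf X j) = oplus β (cf X i) (cf X j) ∧
      sAct X j (cf X i) = oplus β (cf X i) (cf X j) := by
  -- Roots are formal sums and differences of the a; the sum of two simple roots cancels the middle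
  -- parameter y.
  have key : ∀ x y z : Ser, MvPowerSeries.constantCoeff y = 0 →
      oplus β x z = oplus β (oplus β x y) (oplus β (bar β y) z) := by
    intro x y z hy
    rw [oplus_assoc, oplus_comm y, oplus_comm (bar β y), oplus_assoc, bar_oplus_self hy, oplus_zero]
  cases h with
  | braid X i =>
    have h1 := constantCoeff_av (i + 1)
    constructor
    · rw [cf_succ, cf_succ, sAct_oplus, sAct_bar _ _ h1, sAct_av_succ, sAct_av_succ,
        Equiv.swap_apply_right, swap_of_gt (by omega)]
      exact key _ _ _ h1
    · rw [cf_succ, cf_succ, sAct_oplus, sAct_bar _ _ (constantCoeff_av i), sAct_av_succ,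
        sAct_av_succ, Equiv.swap_apply_left, swap_of_lt (by omega)]
      exact key _ _ _ h1
  | braid_D =>
    have h1 := constantCoeff_av 1
    constructor
    · rw [cf_succ, cf_zero_D, sAct_oplus, sAct_bar _ _ h1, sAct_zero_av_one_D, sAct_zero_av_D 0,
        bar_bar (constantCoeff_av 0)]
      exact key _ _ _ h1
    · rw [cf_succ, cf_zero_D, sAct_oplus, sAct_av_succ,
        sAct_av_succ, Equiv.swap_apply_left, swap_of_lt (by omega)]
      exact key _ _ _ h1

/-- The relation between the four positive roots of a system of type `B₂`. -/
theorem four_identity {R : Type*} [CommRing R] {b x y x' t : R} (h : x + x' + b * x * x' = 0)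
    (ht : t = x' + y + b * x' * y) :
    x * (x + y + b * x * y) + x * t + y * t + b * x * t * ((x + y + b * x * y) + y) =
      (x + y + b * x * y) * y := by
  subst ht
  linear_combination (x + y + b * x * y) * (1 + b * y) * h

/-- The analogue of `four_identity` for type C, where x and y are replaced by their formal doubles
in the places of the roots conjugate to α_0. Both supply the hypothesis of `yangBaxter_four`. -/
theorem four_identity' {R : Type*} [CommRing R] {b x y x' t : R} (h : x + x' + b * x * x' = 0)
    (ht : t = x' + y + b * x' * y) :
    (x + x + b * x * x) * (x + y + b * x * y) + (x + x + b * x * x) * t + (y + y + b * y * y) * t +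
      b * (x + x + b * x * x) * t * ((x + y + b * x * y) + (y + y + b * y * y)) =
      (x + y + b * x * y) * (y + y + b * y * y) := by
  subst ht
  linear_combination (x + y + b * x * y) * (2 + b * (x + y)) * (1 + b * y) * h

theorem BraidRel.four {X : CType} {i j : ℕ} (h : BraidRel X i j 4) :
    ∃ q r, sAct X i (cf X j) = q ∧ sAct X j (cf X i) = r ∧ sAct X i r = r ∧ sAct X j q = q ∧
      cf X i * q + cf X i * cf X j + r * cf X j +
        MvPowerSeries.C β * cf X i * cf X j * (q + r) = q * r := by
  have h0 := constantCoeff_av 0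
  have hb := bar_spec (b := β) h0
  have hs1 : ∀ X, sAct X 1 (av 0) = av 1 := fun X => by
    rw [sAct_av_succ, Equiv.swap_apply_left]
  have hs1' : ∀ X, sAct X 1 (av 1) = av 0 := fun X => by
    rw [sAct_av_succ, Equiv.swap_apply_right]
  cases h with
  | braid_B =>
    refine ⟨oplus β (av 0) (av 1), av 1, ?_, ?_, ?_, ?_, ?_⟩
    · rw [cf_succ, sAct_oplus, sAct_bar _ _ h0, sAct_zero_av_zero_B, sAct_zero_av_B, bar_bar h0]
    · rw [cf_zero_B, hs1]
    · exact sAct_zero_av_B 0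
    · rw [sAct_oplus, hs1, hs1', oplus_comm]
    · rw [cf_zero_B]
      exact four_identity hb (cf_succ .B 0)
  | braid_C =>
    refine ⟨oplus β (av 0) (av 1), oplus β (av 1) (av 1), ?_, ?_, ?_, ?_, ?_⟩
    · rw [cf_succ, sAct_oplus, sAct_bar _ _ h0, sAct_zero_av_zero_C, sAct_zero_av_C, bar_bar h0]
    · rw [cf_zero_C, sAct_oplus, hs1]
    · rw [sAct_oplus, sAct_zero_av_C 0]
    · rw [sAct_oplus, hs1, hs1', oplus_comm]
    · rw [cf_zero_C]
      exact four_identity' hb (cf_succ .C 0)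

theorem cf_mem_dom (X : CType) (i : ℕ) : cf X i ∈ dom := by
  have h : ∀ p q : Pt, (∀ k, p.val (.a k) = q.val (.a k)) → p.ev (cf X i) = q.ev (cf X i) :=
    fun p q h => by rw [cf, ev_bar _ (constantCoeff_α X i), ev_bar _ (constantCoeff_α X i), ev_α X i h]
  exact mem_dom (fun _ _ => h _ _ fun _ => rfl) (fun _ => h _ _ fun _ => rfl)
    fun _ _ _ => h _ _ fun _ => rfl

/-- Write each reflection in its braid relation as s = 1 + ᾱψ and expand. The known images of the
roots make all lower terms agree. The two top terms carry the product of the positive roots of the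
rank two system, which is nonzero and can be cancelled. -/
theorem psi_braid {X : CType} {i j m : ℕ} (h : BraidRel X i j m) {f : Ser} (hf : f ∈ dom) :
    psiWord X (altWord i j m) f = psiWord X (altWord j i m) f := by
  have hs := h.ev_wPt hf
  have hd : ∀ l, psiWord X l f ∈ dom := fun l => psiWord_mem_dom X l hf
  have hm : m = 2 ∨ m = 3 ∨ m = 4 := by cases h <;> simp
  have hi := hd [i]
  have hj := hd [j]
  have hij := hd [i, j]
  have hji := hd [j, i]
  have hiji := hd [i, j, i]
  have hjij := hd [j, i, j]
  have bi : sAct X i (cf X i) = bar β (cf X i) := by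
    rw [sAct_cf, cf, bar_bar (constantCoeff_α X i)]
  have bj : sAct X j (cf X j) = bar β (cf X j) := by
    rw [sAct_cf, cf, bar_bar (constantCoeff_α X j)]
  have ci := cf_ne_zero X i
  have cj := cf_ne_zero X j
  rcases hm with rfl | rfl | rfl
  · obtain ⟨e1, e2⟩ := h.two
    simp only [altWord, ev_wPt_cons, wPt_nil, ev_one] at hs
    simp only [psiWord, List.foldr, altWord] at *
    simp only [sAct_eq' X i hf, sAct_eq' X j hf, map_add, map_mul, sAct_eq' X i hj, sAct_eq' X j hi,
      e1, e2] at hs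
    refine mul_left_cancel₀ (mul_ne_zero ci cj) ?_
    linear_combination hs
  · obtain ⟨e1, e2⟩ := h.three
    have e3 : sAct X i (sAct X j (cf X i)) = cf X j := by
      rw [e2, sAct_oplus, e1, bi, oplus_bar_cancel _ (constantCoeff_cf X i)]
    have e4 : sAct X j (sAct X i (cf X j)) = cf X i := by
      rw [e1, sAct_oplus, e2, bj, oplus_comm, oplus_comm (cf X i),
        oplus_bar_cancel _ (constantCoeff_cf X j)]
    rw [e1] at e4
    rw [e2] at e3
    have hq : oplus β (cf X i) (cf X j) ≠ 0 := by
      intro h0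
      rw [h0, map_zero] at e3
      exact cj e3.symm
    simp only [altWord, ev_wPt_cons, wPt_nil, ev_one] at hs
    simp only [psiWord, List.foldr, altWord] at *
    simp only [sAct_eq' X i hf, sAct_eq' X j hf, map_add, map_mul, sAct_eq' X i hj, sAct_eq' X j hi,
      sAct_eq' X i hji, sAct_eq' X j hij, sAct_eq' X i hi, sAct_eq' X j hj, e1, e2, e3, e4,
      psiOp_psiOp X i hf, psiOp_psiOp X j hf] at hs
    refine mul_left_cancel₀ (mul_ne_zero (mul_ne_zero ci cj) hq) ?_
    unfold oplus at hs ⊢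
    linear_combination hs
  · obtain ⟨q, r, e1, e2, e3, e4, e5⟩ := h.four
    have e6 : sAct X i q = cf X j := by rw [← e1, sAct_sAct X i (cf_mem_dom X j)]
    have e7 : sAct X j r = cf X i := by rw [← e2, sAct_sAct X j (cf_mem_dom X i)]
    have hq : q ≠ 0 := by
      rintro rfl
      rw [map_zero] at e6
      exact cj e6.symm
    have hr : r ≠ 0 := by
      rintro rfl
      rw [map_zero] at e7
      exact ci e7.symm
    simp only [altWord, ev_wPt_cons, wPt_nil, ev_one] at hs
    simp only [psiWord, List.foldr, altWord] at *
    simp only [sAct_eq' X i hf, sAct_eq' X j hf, map_add, map_mul, sAct_eq' X i hj, sAct_eq' X j hi,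
      sAct_eq' X i hji, sAct_eq' X j hij, sAct_eq' X i hi, sAct_eq' X j hj, e1, e2, e3, e4, e6, e7,
      sAct_eq' X i hij, sAct_eq' X j hji, sAct_eq' X i hjij, sAct_eq' X j hiji,
      psiOp_psiOp X i hf, psiOp_psiOp X j hf, psiOp_psiOp X i hj, psiOp_psiOp X j hi,
      sAct_C] at hs
    refine mul_left_cancel₀ (mul_ne_zero (mul_ne_zero ci cj) (mul_ne_zero hq hr)) ?_
    -- The coefficients of ψ_i ψ_j and ψ_j ψ_i on the two sides differ by the relation between the
    -- four positive roots.
    linear_combination hs + (psiOp X j (psiOp X i f) - psiOp X i (psiOp X j f)) * e5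

/-! ### Combinatorics of the Weyl groups -/

/-- The reflection that exchanges `p` and `q`, and `-p` and `-q`. -/
def refl (p q : ℤ) : Equiv.Perm ℤ :=
  if p + q = 0 then Equiv.swap p q else Equiv.swap p q * Equiv.swap (-p) (-q)

/-- A positive root, as a pair of values; a signed permutation makes it negative if it reverses the
order of the pair. -/
def rootPair : CType → ℕ → ℤ × ℤ
  | _, (i + 1) => ((i : ℤ) + 1, (i : ℤ) + 2)
  | .B, 0 => (-1, 1)
  | .C, 0 => (-1, 1)
  | .D, 0 => (-1, 2)

theorem simplePerm_eq_refl (X : CType) (i : ℕ) :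
    simplePerm X i = refl (rootPair X i).1 (rootPair X i).2 := by
  rcases i with _ | i
  · rcases X
    · simp [simplePerm, rootPair, refl, Equiv.swap_comm]
    · simp [simplePerm, rootPair, refl, Equiv.swap_comm]
    · ext z
      simp only [simplePerm, rootPair, refl, Equiv.Perm.mul_apply, Equiv.swap_apply_def]
      split_ifs <;> simp_all [Equiv.swap_apply_def]
  · have h : (i : ℤ) + 1 + (i + 2) ≠ 0 := by omega
    have h' : rootPair X (i + 1) = ((i : ℤ) + 1, (i : ℤ) + 2) := by cases X <;> rfl
    have h'' : simplePerm X (i + 1) = Equiv.swap ((i : ℤ) + 1) (i + 2) *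
        Equiv.swap (-((i : ℤ) + 1)) (-((i : ℤ) + 2)) := by cases X <;> rfl
    rw [h', h'', refl, if_neg h]

theorem refl_conj {w : Equiv.Perm ℤ} (hw : ∀ k, w (-k) = -w k) (p q : ℤ) :
    w * refl p q = refl (w p) (w q) * w := by
  have h : ∀ a b : ℤ, w * Equiv.swap a b = Equiv.swap (w a) (w b) * w := fun a b => by
    ext z; simp [Equiv.swap_apply_def]; split_ifs <;> simp_all
  have h0 : w p + w q = 0 ↔ p + q = 0 := by
    rw [← neg_eq_iff_add_eq_zero, ← neg_eq_iff_add_eq_zero, ← hw, w.injective.eq_iff]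
  unfold refl
  simp only [h0]
  split_ifs
  · exact h p q
  · rw [← mul_assoc, h, mul_assoc, h, hw, hw, mul_assoc]

theorem refl_neg {p q : ℤ} (hp : p ≠ 0) (hq : q ≠ 0) : refl (-q) (-p) = refl p q := by
  unfold refl
  have : -q + -p = 0 ↔ p + q = 0 := by omega
  simp only [this, neg_neg]
  split_ifs with h
  · have : q = -p := by omega
    subst this
    simp
  · ext z
    simp only [Equiv.Perm.mul_apply, Equiv.swap_apply_def]
    split_ifs <;> omega

theorem refl_apply {p q : ℤ} (hp : p ≠ 0) (hq : q ≠ 0) (z : ℤ) : refl p q z =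
    if z = p then q else if z = q then p else if z = -p then -q else if z = -q then -p else z := by
  unfold refl
  split_ifs with h <;> simp only [Equiv.Perm.mul_apply, Equiv.swap_apply_def] <;> split_ifs <;>
    omega

theorem rootPair_lt (X : CType) (i : ℕ) : (rootPair X i).1 < (rootPair X i).2 := by
  rcases i with _ | i <;> rcases X <;> simp [rootPair]

theorem rootPair_fst_ne (X : CType) (i : ℕ) : (rootPair X i).1 ≠ 0 := by
  rcases i with _ | i <;> rcases X <;> simp [rootPair] <;> omega

theorem rootPair_snd_ne (X : CType) (i : ℕ) : (rootPair X i).2 ≠ 0 := by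
  rcases i with _ | i <;> rcases X <;> simp [rootPair] <;> omega

theorem simplePerm_apply (X : CType) (i : ℕ) (z : ℤ) : simplePerm X i z =
    if z = (rootPair X i).1 then (rootPair X i).2 else if z = (rootPair X i).2 then (rootPair X i).1
    else if z = -(rootPair X i).1 then -(rootPair X i).2
    else if z = -(rootPair X i).2 then -(rootPair X i).1 else z := by
  rw [simplePerm_eq_refl, refl_apply (rootPair_fst_ne X i) (rootPair_snd_ne X i)]

theorem simplePerm_neg (X : CType) (i : ℕ) (z : ℤ) : simplePerm X i (-z) = -simplePerm X i z := by
  have h1 := rootPair_fst_ne X i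
  have h2 := rootPair_snd_ne X i
  have h3 := rootPair_lt X i
  rw [simplePerm_apply, simplePerm_apply]
  split_ifs <;> omega

section

variable {X : CType}

theorem wordProd_nil : wordProd X [] = 1 := rfl
theorem wordProd_cons (i : ℕ) (l : List ℕ) : wordProd X (i :: l) = s X i * wordProd X l := rfl

theorem wordProd_append (l l' : List ℕ) :
    wordProd X (l ++ l') = wordProd X l * wordProd X l' := by
  simp [wordProd]

theorem wordProd_concat (l : List ℕ) (i : ℕ) : wordProd X (l ++ [i]) = wordProd X l * s X i := by
  simp [wordProd]

theorem mul_s_mul_s (w : Weyl X) (i : ℕ) : w * s X i * s X i = w := by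
  rw [mul_assoc, s_mul_self, mul_one]

theorem mul_s_apply (w : Weyl X) (i : ℕ) (z : ℤ) : (w * s X i).1 z = w.1 (simplePerm X i z) := rfl

theorem s_mul_apply (w : Weyl X) (i : ℕ) (z : ℤ) : (s X i * w).1 z = simplePerm X i (w.1 z) := rfl

theorem weyl_induction {P : Weyl X → Prop} (one : P 1) (mul : ∀ i w, P w → P (s X i * w))
    (w : Weyl X) : P w := by
  obtain ⟨l, rfl⟩ := exists_word X w
  induction l with
  | nil => exact one
  | cons i l ih => exact mul i _ ih

theorem weyl_neg (w : Weyl X) (k : ℤ) : w.1 (-k) = -w.1 k := by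
  induction w using weyl_induction with
  | one => rfl
  | mul i w ih => rw [s_mul_apply, s_mul_apply, ih, simplePerm_neg]

theorem weyl_ne_zero (w : Weyl X) {k : ℤ} (hk : k ≠ 0) : w.1 k ≠ 0 := by
  have h0 : w.1 0 = 0 := by
    have := weyl_neg w 0
    rw [neg_zero] at this
    omega
  intro h
  exact hk (w.1.injective (h.trans h0.symm))

theorem weyl_add_ne_zero (w : Weyl X) {k l : ℤ} (h : k + l ≠ 0) : w.1 k + w.1 l ≠ 0 := by
  intro h'
  have : w.1 k = w.1 (-l) := by rw [weyl_neg]; omega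
  have := w.1.injective this
  omega

/-- `s_i` is a right descent of `w`. -/
def Desc (w : Weyl X) (i : ℕ) : Prop := w.1 (rootPair X i).2 < w.1 (rootPair X i).1

theorem not_desc_iff (w : Weyl X) (i : ℕ) :
    ¬ Desc w i ↔ w.1 (rootPair X i).1 < w.1 (rootPair X i).2 := by
  have h : w.1 (rootPair X i).1 ≠ w.1 (rootPair X i).2 := fun h =>
    (rootPair_lt X i).ne (w.1.injective h)
  unfold Desc
  omega

theorem desc_mul_s (w : Weyl X) (i : ℕ) : Desc (w * s X i) i ↔ ¬ Desc w i := by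
  have h1 := rootPair_lt X i
  have e1 : simplePerm X i (rootPair X i).1 = (rootPair X i).2 := by rw [simplePerm_apply, if_pos rfl]
  have e2 : simplePerm X i (rootPair X i).2 = (rootPair X i).1 := by
    rw [simplePerm_apply, if_neg h1.ne', if_pos rfl]
  rw [not_desc_iff, Desc, mul_s_apply, mul_s_apply, e1, e2]

/-- A simple reflection reverses the order of the pair of its own root only. -/
theorem eq_rootPair_of_lt (i : ℕ) {p q : ℤ} (hp : p ≠ 0) (hq : q ≠ 0)
    (hD : X = .D → p + q ≠ 0) (h : p < q) (h' : simplePerm X i q < simplePerm X i p) :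
    (p = (rootPair X i).1 ∧ q = (rootPair X i).2) ∨
      (p = -(rootPair X i).2 ∧ q = -(rootPair X i).1) := by
  rw [simplePerm_apply, simplePerm_apply] at h'
  rcases i with _ | i
  · rcases X
    · simp only [rootPair] at h' ⊢
      split_ifs at h' <;> omega
    · simp only [rootPair] at h' ⊢
      split_ifs at h' <;> omega
    · have := hD rfl
      simp only [rootPair] at h' ⊢
      split_ifs at h' <;> omega
  · have : rootPair X (i + 1) = ((i : ℤ) + 1, (i : ℤ) + 2) := by cases X <;> rfl
    simp only [this] at h' ⊢
    split_ifs at h' <;> omega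

theorem rootPair_D_add (i : ℕ) : (rootPair .D i).1 + (rootPair .D i).2 ≠ 0 := by
  rcases i with _ | i <;> simp [rootPair] <;> omega

/-- The exchange property. -/
theorem exchange (l : List ℕ) (i : ℕ) (h : Desc (wordProd X l) i) :
    ∃ l' : List ℕ, l'.length + 1 = l.length ∧ wordProd X l' = wordProd X l * s X i := by
  induction l with
  | nil =>
    have := rootPair_lt X i
    exact absurd h (not_lt.mpr this.le)
  | cons k l ih =>
    by_cases hd : Desc (wordProd X l) i
    · obtain ⟨l', h1, h2⟩ := ih hd
      exact ⟨k :: l', by simp [h1], by rw [wordProd_cons, wordProd_cons, h2, mul_assoc]⟩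
    · refine ⟨l, rfl, ?_⟩
      set u := wordProd X l with hu
      rw [not_desc_iff] at hd
      rw [wordProd_cons] at h
      -- If s_k makes i a descent of s_k u but i is none of u, then s_k reverses the image under u
      -- of the pair of i. This image is then the pair of k up to sign, so s_k u = u s_i, and the
      -- letter k can be deleted.
      have h1 := eq_rootPair_of_lt k (weyl_ne_zero u (rootPair_fst_ne X i))
        (weyl_ne_zero u (rootPair_snd_ne X i))
        (fun hX => weyl_add_ne_zero u (by subst hX; exact rootPair_D_add i)) hd h
      have h2 : refl (u.1 (rootPair X i).1) (u.1 (rootPair X i).2) = simplePerm X k := by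
        rw [simplePerm_eq_refl]
        rcases h1 with ⟨e1, e2⟩ | ⟨e1, e2⟩
        · rw [e1, e2]
        · rw [e1, e2, refl_neg (rootPair_fst_ne X k) (rootPair_snd_ne X k)]
      have h3 : u * s X i = s X k * u := by
        apply Subtype.ext
        change u.1 * simplePerm X i = simplePerm X k * u.1
        rw [simplePerm_eq_refl X i, refl_conj (weyl_neg u), h2]
      rw [wordProd_cons, mul_assoc, h3, ← mul_assoc, s_mul_self, one_mul]

theorem wordProd_reducedWord (w : Weyl X) : wordProd X (reducedWord X w) = w :=
  (exists_reducedWord X w).choose_spec.1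

theorem isReducedWord_reducedWord (w : Weyl X) : IsReducedWord X w (reducedWord X w) :=
  (exists_reducedWord X w).choose_spec

theorem len_le (l : List ℕ) : len X (wordProd X l) ≤ l.length :=
  (isReducedWord_reducedWord (wordProd X l)).2 l rfl

theorem isReducedWord_iff (w : Weyl X) (l : List ℕ) :
    IsReducedWord X w l ↔ wordProd X l = w ∧ l.length = len X w := by
  constructor
  · rintro ⟨rfl, h⟩
    exact ⟨rfl, le_antisymm (h _ (wordProd_reducedWord _)) (len_le l)⟩
  · rintro ⟨rfl, h⟩
    exact ⟨rfl, fun l' hl' => by rw [h, ← hl']; exact len_le l'⟩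

theorem len_mul_s_le (w : Weyl X) (i : ℕ) : len X (w * s X i) ≤ len X w + 1 := by
  have := len_le (X := X) (reducedWord X w ++ [i])
  rwa [wordProd_concat, wordProd_reducedWord, List.length_append] at this

theorem len_of_desc {w : Weyl X} {i : ℕ} (h : Desc w i) : len X w = len X (w * s X i) + 1 := by
  obtain ⟨l', h1, h2⟩ := exchange (reducedWord X w) i (by rwa [wordProd_reducedWord])
  have h3 := len_le (X := X) l'
  rw [h2, wordProd_reducedWord] at h3
  have h4 := len_mul_s_le (w * s X i) i
  rw [mul_s_mul_s] at h4
  have : (reducedWord X w).length = len X w := rfl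
  omega

theorem len_of_not_desc {w : Weyl X} {i : ℕ} (h : ¬ Desc w i) :
    len X (w * s X i) = len X w + 1 := by
  have := len_of_desc ((desc_mul_s w i).mpr h)
  rwa [mul_s_mul_s] at this

/-- Translates the length condition in the idCoxeter algebra into an inequality between two values
of w, so that its relations become finite case checks. -/
theorem len_lt_iff (w : Weyl X) (i : ℕ) : len X w < len X (w * s X i) ↔ ¬ Desc w i := by
  by_cases h : Desc w i
  · have := len_of_desc h
    simp only [h, not_true, iff_false]
    omega
  · have := len_of_not_desc h
    simp only [h, not_false_eq_true, iff_true]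
    omega

theorem IsReducedWord.concat {w : Weyl X} {l : List ℕ} (hl : IsReducedWord X w l) {i : ℕ}
    (h : ¬ Desc w i) : IsReducedWord X (w * s X i) (l ++ [i]) := by
  rw [isReducedWord_iff] at hl ⊢
  rw [wordProd_concat, hl.1, List.length_append, hl.2, len_of_not_desc h]
  exact ⟨rfl, rfl⟩

/-! ### Parabolic subgroups -/

/-- `w` fixes all integers greater than `m`. -/
def FixGT (m : ℕ) (w : Weyl X) : Prop := ∀ k : ℤ, m < k → w.1 k = k

theorem simplePerm_of_gt {i m : ℕ} (hm : 2 ≤ m) (hi : i < m) {k : ℤ} (hk : m < k) :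
    simplePerm X i k = k := by
  rw [simplePerm_apply]
  rcases i with _ | i
  · rcases X <;> simp only [rootPair] <;> split_ifs <;> omega
  · have : rootPair X (i + 1) = ((i : ℤ) + 1, (i : ℤ) + 2) := by cases X <;> rfl
    simp only [this]
    split_ifs <;> omega

theorem fixGT_mul_s_iff {i m : ℕ} (hm : 2 ≤ m) (hi : i < m) (w : Weyl X) :
    FixGT m (w * s X i) ↔ FixGT m w := by
  refine forall₂_congr fun k hk => ?_
  rw [mul_s_apply, simplePerm_of_gt hm hi hk]

theorem not_desc_of_fixGT {i m : ℕ} (hm : 2 ≤ m) (hi : m ≤ i) {w : Weyl X} (hw : FixGT m w) :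
    ¬ Desc w i ∧ ¬ FixGT m (w * s X i) := by
  obtain ⟨i, rfl⟩ : ∃ j, i = j + 1 := ⟨i - 1, by omega⟩
  have hr : rootPair X (i + 1) = ((i : ℤ) + 1, (i : ℤ) + 2) := by cases X <;> rfl
  have h2 : w.1 ((i : ℤ) + 2) = i + 2 := hw _ (by omega)
  -- A value of at least i + 2 would exceed m and be fixed by w, against injectivity.
  have h1 : w.1 ((i : ℤ) + 1) < i + 2 := by
    by_contra hlt
    have := w.1.injective (hw (w.1 ((i : ℤ) + 1)) (by omega))
    omega
  constructor
  · unfold Desc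
    simp only [hr, h2]
    omega
  · intro h
    have h3 := h ((i : ℤ) + 2) (by omega)
    rw [mul_s_apply, simplePerm_apply, hr, if_neg (by simp), if_pos rfl] at h3
    simp only at h3
    omega

theorem exists_fixGT (w : Weyl X) : ∃ m, 2 ≤ m ∧ FixGT m w := by
  induction w using weyl_induction with
  | one => exact ⟨2, le_rfl, fun k _ => rfl⟩
  | mul i w ih =>
    obtain ⟨m, hm, h⟩ := ih
    refine ⟨max m (i + 1), by omega, fun k hk => ?_⟩
    rw [s_mul_apply, h k (by omega), simplePerm_of_gt (m := max m (i + 1)) (by omega) (by omega) hk]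

end

/-! ### Rank two parabolic subgroups -/

section

variable {X : CType}

theorem rootPair_succ (X : CType) (i : ℕ) : rootPair X (i + 1) = ((i : ℤ) + 1, (i : ℤ) + 2) := by
  cases X <;> rfl

theorem simplePerm_fst (X : CType) (i : ℕ) :
    simplePerm X i (rootPair X i).1 = (rootPair X i).2 := by
  rw [simplePerm_apply, if_pos rfl]

theorem simplePerm_snd (X : CType) (i : ℕ) :
    simplePerm X i (rootPair X i).2 = (rootPair X i).1 := by
  rw [simplePerm_apply, if_neg (rootPair_lt X i).ne', if_pos rfl]

theorem simplePerm_succ_of_ne (X : CType) (i : ℕ) {z : ℤ} (h1 : z ≠ i + 1) (h2 : z ≠ i + 2)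
    (h3 : z ≠ -(i + 1)) (h4 : z ≠ -(i + 2)) : simplePerm X (i + 1) z = z := by
  rw [simplePerm_apply, rootPair_succ, if_neg h1, if_neg h2, if_neg h3, if_neg h4]

/-- Each of the two reflections fixes the pair (p, q) of the other or sends it to (−q, −p), which
represents the same root. -/
theorem BraidRel.desc_two {i j : ℕ} (h : BraidRel X i j 2) (w : Weyl X) :
    (Desc (w * s X i) j ↔ Desc w j) ∧ (Desc (w * s X j) i ↔ Desc w i) := by
  have key : ∀ a b : ℕ,
      (simplePerm X a (rootPair X b).1 = (rootPair X b).1 ∧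
        simplePerm X a (rootPair X b).2 = (rootPair X b).2) ∨
      (simplePerm X a (rootPair X b).1 = -(rootPair X b).2 ∧
        simplePerm X a (rootPair X b).2 = -(rootPair X b).1) →
      (Desc (w * s X a) b ↔ Desc w b) := by
    rintro a b (⟨h1, h2⟩ | ⟨h1, h2⟩)
    · rw [Desc, mul_s_apply, mul_s_apply, h1, h2, Desc]
    · rw [Desc, mul_s_apply, mul_s_apply, h1, h2, weyl_neg, weyl_neg, neg_lt_neg_iff, Desc]
  refine ⟨key i j ?_, key j i ?_⟩
  all_goals
    simp only [simplePerm_apply]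
    cases h <;> simp only [rootPair] <;> split_ifs <;> omega

/-- The two roots are pairs (a, b) and (b, c), and the reflections permute a, b, c. All descents are
thus comparisons between the images p, q, r of these three integers under w. -/
theorem BraidRel.desc_three {i j : ℕ} (h : BraidRel X i j 3) (w : Weyl X) : ∃ p q r : ℤ,
    p ≠ q ∧ q ≠ r ∧ p ≠ r ∧ (Desc w i ↔ q < p) ∧ (Desc w j ↔ r < q) ∧
    (Desc (w * s X i) j ↔ r < p) ∧ (Desc (w * s X j) i ↔ r < p) ∧
    (Desc (w * s X i * s X j) i ↔ r < q) ∧ (Desc (w * s X j * s X i) j ↔ q < p) := by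
  have key : ∀ a b c : ℤ, a ≠ b → b ≠ c → a ≠ c → rootPair X i = (a, b) → rootPair X j = (b, c) →
      simplePerm X i c = c → simplePerm X j a = a → ∃ p q r : ℤ,
    p ≠ q ∧ q ≠ r ∧ p ≠ r ∧ (Desc w i ↔ q < p) ∧ (Desc w j ↔ r < q) ∧
    (Desc (w * s X i) j ↔ r < p) ∧ (Desc (w * s X j) i ↔ r < p) ∧
    (Desc (w * s X i * s X j) i ↔ r < q) ∧ (Desc (w * s X j * s X i) j ↔ q < p) := by
    intro a b c hab hbc hac hi hj h1 h2
    have e1 := simplePerm_fst X i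
    have e2 := simplePerm_snd X i
    have e3 := simplePerm_fst X j
    have e4 := simplePerm_snd X j
    rw [hi] at e1 e2
    rw [hj] at e3 e4
    simp only at e1 e2 e3 e4
    refine ⟨w.1 a, w.1 b, w.1 c, w.1.injective.ne hab, w.1.injective.ne hbc, w.1.injective.ne hac,
      ?_, ?_, ?_, ?_, ?_, ?_⟩ <;>
    simp only [Desc, hi, hj, mul_s_apply, e1, e2, e3, e4, h1, h2]
  cases h with
  | braid X i =>
    refine key (i + 1) (i + 2) (i + 3) (by omega) (by omega) (by omega) (rootPair_succ X i) ?_ ?_ ?_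
    · rw [rootPair_succ]; push_cast; ring_nf
    · exact simplePerm_succ_of_ne X i (by omega) (by omega) (by omega) (by omega)
    · exact simplePerm_succ_of_ne X (i + 1) (by omega) (by omega) (by omega) (by omega)
  | braid_D =>
    refine key (-1) 2 3 (by omega) (by omega) (by omega) rfl rfl ?_ ?_ <;>
    simp [simplePerm_apply, rootPair]

/-- The signed permutations of 1 and 2 reduce all descents to sign conditions on p = w(1) and q =
w(2), on their difference and on their sum. -/
theorem BraidRel.desc_four {i j : ℕ} (h : BraidRel X i j 4) (w : Weyl X) : ∃ p q : ℤ,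
    p ≠ 0 ∧ q ≠ 0 ∧ p ≠ q ∧ p + q ≠ 0 ∧ (Desc w i ↔ p < 0) ∧ (Desc w j ↔ q < p) ∧
    (Desc (w * s X i) j ↔ p + q < 0) ∧ (Desc (w * s X j) i ↔ q < 0) ∧
    (Desc (w * s X i * s X j) i ↔ q < 0) ∧ (Desc (w * s X j * s X i) j ↔ p + q < 0) ∧
    (Desc (w * s X i * s X j * s X i) j ↔ q < p) ∧
    (Desc (w * s X j * s X i * s X j) i ↔ p < 0) := by
  have hp := weyl_ne_zero w (k := 1) (by omega)
  have hq := weyl_ne_zero w (k := 2) (by omega)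
  have hpq : w.1 1 ≠ w.1 2 := w.1.injective.ne (by omega)
  have hpq' := weyl_add_ne_zero w (k := 1) (l := 2) (by omega)
  have n1 : w.1 (-1) = - w.1 1 := weyl_neg w 1
  have n2 : w.1 (-2) = - w.1 2 := weyl_neg w 2
  refine ⟨w.1 1, w.1 2, hp, hq, hpq, hpq', ?_⟩
  cases h <;>
  · refine ⟨?_, ?_, ?_, ?_, ?_, ?_, ?_, ?_⟩ <;>
    simp only [Desc, mul_s_apply] <;> simp [simplePerm_apply, rootPair, n1, n2] <;> omega

/-- By `refl_conj`, s_i s_j s_i is the reflection in the image under s_i of the root of j. For m = 2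
this image is the root of j itself; for m = 3 it is also the image under s_j of the root of i; for m
= 4 it is fixed by s_j up to sign, so that s_j commutes with the reflection. -/
theorem wordProd_altWord {i j m : ℕ} (h : BraidRel X i j m) :
    wordProd X (altWord i j m) = wordProd X (altWord j i m) := by
  have hc : ∀ a b : ℕ, simplePerm X a * simplePerm X b =
      refl (simplePerm X a (rootPair X b).1) (simplePerm X a (rootPair X b).2) * simplePerm X a :=
    fun a b => by
      rw [simplePerm_eq_refl X b, refl_conj (simplePerm_neg X a)]
  have hs : ∀ a, simplePerm X a * simplePerm X a = 1 := fun a =>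
    congrArg Subtype.val (s_mul_self X a)
  have two : ∀ p q : ℤ, p ≠ 0 → q ≠ 0 → rootPair X j = (p, q) →
      ((simplePerm X i p = p ∧ simplePerm X i q = q) ∨
        (simplePerm X i p = -q ∧ simplePerm X i q = -p)) →
      wordProd X (altWord i j 2) = wordProd X (altWord j i 2) := by
    intro p q hp hq hj h
    apply Subtype.ext
    change simplePerm X i * (simplePerm X j * 1) = simplePerm X j * (simplePerm X i * 1)
    rw [mul_one, mul_one, hc, hj]
    rcases h with ⟨h1, h2⟩ | ⟨h1, h2⟩
    · simp only [h1, h2, simplePerm_eq_refl X j, hj]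
    · simp only [h1, h2, simplePerm_eq_refl X j, hj, refl_neg hp hq]
  have three : ∀ a b c : ℤ, rootPair X i = (a, b) → rootPair X j = (b, c) →
      simplePerm X i c = c → simplePerm X j a = a →
      wordProd X (altWord i j 3) = wordProd X (altWord j i 3) := by
    intro a b c hi hj h1 h2
    have e1 := simplePerm_snd X i
    have e2 := simplePerm_fst X j
    rw [hi] at e1
    rw [hj] at e2
    simp only at e1 e2
    apply Subtype.ext
    change simplePerm X i * (simplePerm X j * (simplePerm X i * 1)) =
      simplePerm X j * (simplePerm X i * (simplePerm X j * 1))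
    rw [mul_one, mul_one, ← mul_assoc, ← mul_assoc, hc i j, hc j i, mul_assoc, mul_assoc, hs, hs,
      hi, hj]
    simp only [e1, e2, h1, h2]
  have four : ∀ p q : ℤ, p ≠ 0 → q ≠ 0 → simplePerm X i (rootPair X j).1 = p →
      simplePerm X i (rootPair X j).2 = q →
      ((simplePerm X j p = p ∧ simplePerm X j q = q) ∨
        (simplePerm X j p = -q ∧ simplePerm X j q = -p)) →
      wordProd X (altWord i j 4) = wordProd X (altWord j i 4) := by
    intro p q hp hq hp' hq' h
    have h1 : simplePerm X i * simplePerm X j * simplePerm X i = refl p q := by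
      rw [hc, mul_assoc, hs, mul_one, hp', hq']
    have h2 : simplePerm X j * refl p q = refl p q * simplePerm X j := by
      rw [refl_conj (simplePerm_neg X j)]
      rcases h with ⟨h1, h2⟩ | ⟨h1, h2⟩
      · rw [h1, h2]
      · rw [h1, h2, refl_neg hp hq]
    apply Subtype.ext
    change simplePerm X i * (simplePerm X j * (simplePerm X i * (simplePerm X j * 1))) =
      simplePerm X j * (simplePerm X i * (simplePerm X j * (simplePerm X i * 1)))
    rw [← h1] at h2
    simp only [mul_assoc, mul_one] at h2 ⊢
    exact h2.symm
  cases h with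
  | comm X i j h =>
    refine two (j + 1) (j + 2) (by omega) (by omega) (rootPair_succ X j) (Or.inl ⟨?_, ?_⟩) <;>
    exact simplePerm_succ_of_ne X i (by omega) (by omega) (by omega) (by omega)
  | braid X i =>
    refine three (i + 1) (i + 2) (i + 3) (rootPair_succ X i) ?_ ?_ ?_
    · rw [rootPair_succ]; push_cast; ring_nf
    · exact simplePerm_succ_of_ne X i (by omega) (by omega) (by omega) (by omega)
    · exact simplePerm_succ_of_ne X (i + 1) (by omega) (by omega) (by omega) (by omega)
  | comm_B j =>
    refine two (j + 2) (j + 3) (by omega) (by omega) ?_ (Or.inl ⟨?_, ?_⟩)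
    · rw [rootPair_succ]; push_cast; ring_nf
    all_goals rw [simplePerm_apply]; simp only [rootPair]; split_ifs <;> omega
  | comm_C j =>
    refine two (j + 2) (j + 3) (by omega) (by omega) ?_ (Or.inl ⟨?_, ?_⟩)
    · rw [rootPair_succ]; push_cast; ring_nf
    all_goals rw [simplePerm_apply]; simp only [rootPair]; split_ifs <;> omega
  | comm_D j =>
    refine two (j + 3) (j + 4) (by omega) (by omega) ?_ (Or.inl ⟨?_, ?_⟩)
    · rw [rootPair_succ]; push_cast; ring_nf
    all_goals rw [simplePerm_apply]; simp only [rootPair]; split_ifs <;> omega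
  | comm_D_one =>
    refine two 1 2 (by omega) (by omega) rfl (Or.inr ⟨?_, ?_⟩) <;>
    simp [simplePerm_apply, rootPair]
  | braid_D =>
    refine three (-1) 2 3 rfl rfl ?_ ?_ <;> simp [simplePerm_apply, rootPair]
  | braid_B =>
    refine four (-1) 2 (by omega) (by omega) ?_ ?_ (Or.inr ⟨?_, ?_⟩) <;>
    simp [simplePerm_apply, rootPair]
  | braid_C =>
    refine four (-1) 2 (by omega) (by omega) ?_ ?_ (Or.inr ⟨?_, ?_⟩) <;>
    simp [simplePerm_apply, rootPair]

theorem altWord_length (i j m : ℕ) : (altWord i j m).length = m := by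
  induction m generalizing i j with
  | zero => rfl
  | succ m ih => rw [altWord, List.length_cons, ih]

theorem BraidRel.le {i j m : ℕ} (h : BraidRel X i j m) : m = 2 ∨ m = 3 ∨ m = 4 := by
  cases h <;> simp

/-- An element with two right descents has a right factor of rank two. -/
theorem BraidRel.exists_factor {i j m : ℕ} (h : BraidRel X i j m) {w : Weyl X} (hi : Desc w i)
    (hj : Desc w j) : ∃ v : Weyl X, v * wordProd X (altWord i j m) = w ∧ len X v + m = len X w := by
  have e1 := len_of_desc hi
  have e2 := len_of_desc hj
  have hc : ∀ k (u : Weyl X), s X k * (s X k * u) = u := fun k u => by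
    rw [← mul_assoc, s_mul_self, one_mul]
  rcases h.le with rfl | rfl | rfl
  · obtain ⟨d1, d2⟩ := h.desc_two w
    have e3 := len_of_desc (d2.mpr hi)
    refine ⟨w * s X j * s X i, ?_, by omega⟩
    simp [altWord, wordProd, mul_assoc, s_mul_self, hc]
  · obtain ⟨p, q, r, -, -, -, d1, d2, d3, d4, d5, d6⟩ := h.desc_three w
    have h1 := d1.mp hi
    have h2 := d2.mp hj
    have e3 := len_of_desc (d3.mpr (h2.trans h1))
    have e4 := len_of_desc (d5.mpr h2)
    refine ⟨w * s X i * s X j * s X i, ?_, by omega⟩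
    simp [altWord, wordProd, mul_assoc, s_mul_self, hc]
  · obtain ⟨p, q, -, -, -, -, d1, d2, -, d4, -, d6, -, d8⟩ := h.desc_four w
    have h1 := d1.mp hi
    have h2 := d2.mp hj
    have e3 := len_of_desc (d4.mpr (by omega))
    have e4 := len_of_desc (d6.mpr (by omega))
    have e5 := len_of_desc (d8.mpr h1)
    refine ⟨w * s X j * s X i * s X j * s X i, ?_, by omega⟩
    simp [altWord, wordProd, mul_assoc, s_mul_self, hc]

theorem psiWord_append (l l' : List ℕ) (f : Ser) :
    psiWord X (l ++ l') f = psiWord X l (psiWord X l' f) := List.foldr_append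

/-- The operators `ψ_{i_1} ⋯ ψ_{i_l}` only depend on the product of a reduced word. -/
theorem psiWord_eq_of_reduced {v : Weyl X} {l l' : List ℕ} (hl : IsReducedWord X v l)
    (hl' : IsReducedWord X v l') {f : Ser} (hf : f ∈ dom) : psiWord X l f = psiWord X l' f := by
  obtain ⟨n, hn⟩ : ∃ n, n = l.length := ⟨_, rfl⟩
  induction n using Nat.strong_induction_on generalizing v l l' f with
  | _ n ih =>
    have h1 := (isReducedWord_iff v l).mp hl
    have h2 := (isReducedWord_iff v l').mp hl'
    rcases List.eq_nil_or_concat l with rfl | ⟨l₀, i, rfl⟩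
    · have : l' = [] := List.eq_nil_of_length_eq_zero (by rw [h2.2, ← h1.2]; rfl)
      rw [this]
    rcases List.eq_nil_or_concat l' with rfl | ⟨l₀', j, rfl⟩
    · have : (l₀.concat i).length = 0 := by rw [h1.2, ← h2.2]; rfl
      simp at this
    simp only [List.concat_eq_append, wordProd_concat, List.length_append, List.length_cons,
      List.length_nil, zero_add] at *
    have key : ∀ (l : List ℕ) (i : ℕ), wordProd X l * s X i = v → l.length + 1 = len X v →
        Desc v i ∧ IsReducedWord X (v * s X i) l := by
      intro l i h1 h2
      have e : v * s X i = wordProd X l := by rw [← h1, mul_s_mul_s]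
      have hd : Desc v i := by
        by_contra hd
        have := len_of_not_desc hd
        have h3 := len_le (X := X) l
        rw [← e] at h3
        omega
      refine ⟨hd, (isReducedWord_iff _ _).mpr ⟨e.symm, ?_⟩⟩
      have := len_of_desc hd
      omega
    obtain ⟨di, ri⟩ := key _ _ h1.1 h1.2
    obtain ⟨dj, rj⟩ := key _ _ h2.1 h2.2
    have hlen := h1.2
    have hlen' := h2.2
    -- Two descents a and b of v give reduced words of v that end in either alternating word; such
    -- words link words with different last letters.
    have main : ∀ (a b m : ℕ), BraidRel X a b m → Desc v a → Desc v b →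
        ∃ r : List ℕ, IsReducedWord X v (r ++ altWord a b m) ∧
          IsReducedWord X v (r ++ altWord b a m) := by
      intro a b m hab da db
      obtain ⟨u, hu1, hu2⟩ := hab.exists_factor da db
      refine ⟨reducedWord X u, ?_, ?_⟩
      · rw [isReducedWord_iff, wordProd_append, wordProd_reducedWord, List.length_append,
          altWord_length]
        exact ⟨hu1, hu2⟩
      · rw [isReducedWord_iff, wordProd_append, wordProd_reducedWord, List.length_append,
          altWord_length, ← wordProd_altWord hab]
        exact ⟨hu1, hu2⟩
    -- With a common last letter k, the induction hypothesis applies to the shorter words and to ψ_k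
    -- f.
    have same : ∀ (t t' : List ℕ) (k : ℕ), IsReducedWord X v (t ++ [k]) →
        IsReducedWord X v (t' ++ [k]) → psiWord X (t ++ [k]) f = psiWord X (t' ++ [k]) f := by
      intro t t' k ht ht'
      rw [isReducedWord_iff, wordProd_concat, List.length_append] at ht ht'
      rw [psiWord_append, psiWord_append]
      refine ih t.length ?_ (key t k ht.1 ht.2).2 (key t' k ht'.1 ht'.2).2
        (psiWord_mem_dom X [k] hf) rfl
      have := ht.2
      simp only [List.length_cons, List.length_nil] at this
      omega
    have lt : ∀ (t t' : List ℕ) (a b : ℕ), a < b → Desc v a → Desc v b →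
        IsReducedWord X v (t ++ [a]) → IsReducedWord X v (t' ++ [b]) →
        psiWord X (t ++ [a]) f = psiWord X (t' ++ [b]) f := by
      intro t t' a b hab da db ht ht'
      obtain ⟨m, hm⟩ := exists_braidRel X hab
      obtain ⟨r, hr, hr'⟩ := main a b m hm da db
      have hb := psi_braid hm hf
      have hb' : psiWord X (r ++ altWord a b m) f = psiWord X (r ++ altWord b a m) f := by
        rw [psiWord_append, psiWord_append, hb]
      -- The parity of m decides which of the two alternating words ends in a and which in b.
      rcases hm.le with rfl | rfl | rfl
      · have e1 : r ++ altWord a b 2 = (r ++ [a]) ++ [b] := by simp [altWord]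
        have e2 : r ++ altWord b a 2 = (r ++ [b]) ++ [a] := by simp [altWord]
        rw [e1] at hr hb'
        rw [e2] at hr' hb'
        rw [same _ _ _ ht hr', ← hb', same _ _ _ hr ht']
      · have e1 : r ++ altWord a b 3 = (r ++ [a, b]) ++ [a] := by simp [altWord]
        have e2 : r ++ altWord b a 3 = (r ++ [b, a]) ++ [b] := by simp [altWord]
        rw [e1] at hr hb'
        rw [e2] at hr' hb'
        rw [same _ _ _ ht hr, hb', same _ _ _ hr' ht']
      · have e1 : r ++ altWord a b 4 = (r ++ [a, b, a]) ++ [b] := by simp [altWord]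
        have e2 : r ++ altWord b a 4 = (r ++ [b, a, b]) ++ [a] := by simp [altWord]
        rw [e1] at hr hb'
        rw [e2] at hr' hb'
        rw [same _ _ _ ht hr', ← hb', same _ _ _ hr ht']
    rcases lt_trichotomy i j with hij | rfl | hij
    · exact lt _ _ _ _ hij di dj hl hl'
    · exact same _ _ _ hl hl'
    · exact (lt _ _ _ _ hij dj di hl' hl).symm

theorem psi_eq_psiWord {v : Weyl X} {l : List ℕ} (hl : IsReducedWord X v l) {f : Ser}
    (hf : f ∈ dom) : psiWord X l f = psi X v f :=
  psiWord_eq_of_reduced hl (isReducedWord_reducedWord v) hf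

theorem psi_one (f : Ser) : psi X 1 f = f := by
  have h := len_le (X := X) []
  have : reducedWord X (1 : Weyl X) = [] := List.eq_nil_of_length_eq_zero (Nat.le_zero.mp h)
  rw [psi, this]; rfl

theorem psi_psiOp_of_not_desc {v : Weyl X} {i : ℕ} (h : ¬ Desc v i) {f : Ser} (hf : f ∈ dom) :
    psi X v (psiOp X i f) = psi X (v * s X i) f := by
  rw [← psi_eq_psiWord ((isReducedWord_reducedWord v).concat h) hf, psiWord_append]
  rfl

/-- Split off the last letter of v and use ψ_i ψ_i = βψ_i. Together with the case of no descent,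
this is the rule for u_v u_i. -/
theorem psi_psiOp_of_desc {v : Weyl X} {i : ℕ} (h : Desc v i) {f : Ser} (hf : f ∈ dom) :
    psi X v (psiOp X i f) = MvPowerSeries.C β * psi X v f := by
  have h' : ¬ Desc (v * s X i) i := fun h' => (desc_mul_s v i).mp h' h
  have h1 := psi_psiOp_of_not_desc h' hf
  have h2 := psi_psiOp_of_not_desc h' (psiOp_mem_dom X i hf)
  rw [mul_s_mul_s] at h1 h2
  rw [← h2, psiOp_psiOp X i hf, ← h1]
  exact psiWord_C_mul X _ β (psiOp_mem_dom X i hf)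

end

/-! ### Relations in the idCoxeter algebra -/

section

variable {X : CType}

open Classical in
theorem rightMul_single_desc (i : ℕ) (w : Weyl X) (c : Ser) :
    rightMul X i (Finsupp.single w c) =
      if Desc w i then Finsupp.single w (MvPowerSeries.C β * c)
      else Finsupp.single (w * s X i) c := by
  rw [rightMul_single]
  simp only [len_lt_iff]
  split_ifs <;> rfl

theorem rightMul_two {i j : ℕ} (h : BraidRel X i j 2) (w : Weyl X) (c : Ser) :
    rightMul X j (rightMul X i (Finsupp.single w c)) =
      rightMul X i (rightMul X j (Finsupp.single w c)) := by
  classical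
  obtain ⟨d1, d2⟩ := h.desc_two w
  have hw : w * s X i * s X j = w * s X j * s X i := by
    have := wordProd_altWord h
    simp only [altWord, wordProd_cons, wordProd_nil, mul_one] at this
    rw [mul_assoc, this, mul_assoc]
  by_cases h1 : Desc w i <;> by_cases h2 : Desc w j <;>
  simp [-Finsupp.single_mul, rightMul_single_desc, h1, h2, d1, d2, hw]

/-- A check on basis elements: the order of the three values p, q, r decides every descent, and
contradictory orders are excluded by arithmetic. -/
theorem rightMul_three {i j : ℕ} (h : BraidRel X i j 3) (w : Weyl X) (c : Ser) :
    rightMul X i (rightMul X j (rightMul X i (Finsupp.single w c))) =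
      rightMul X j (rightMul X i (rightMul X j (Finsupp.single w c))) := by
  classical
  obtain ⟨p, q, r, n1, n2, n3, d1, d2, d3, d4, d5, d6⟩ := h.desc_three w
  have hw : w * s X i * s X j * s X i = w * s X j * s X i * s X j := by
    have := wordProd_altWord h
    simp only [altWord, wordProd_cons, wordProd_nil, mul_one] at this
    simp only [mul_assoc, this]
  by_cases h1 : q < p <;> by_cases h2 : r < q <;> by_cases h3 : r < p <;>
  first
  | omega
  | simp [-Finsupp.single_mul, rightMul_single_desc, desc_mul_s, h1, h2, h3, d1, d2, d3, d4, d5,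
      d6, hw]

theorem rightMul_four {i j : ℕ} (h : BraidRel X i j 4) (w : Weyl X) (c : Ser) :
    rightMul X j (rightMul X i (rightMul X j (rightMul X i (Finsupp.single w c)))) =
      rightMul X i (rightMul X j (rightMul X i (rightMul X j (Finsupp.single w c)))) := by
  classical
  obtain ⟨p, q, n1, n2, n3, n4, d1, d2, d3, d4, d5, d6, d7, d8⟩ := h.desc_four w
  have hw : w * s X i * s X j * s X i * s X j = w * s X j * s X i * s X j * s X i := by
    have := wordProd_altWord h
    simp only [altWord, wordProd_cons, wordProd_nil, mul_one] at this
    simp only [mul_assoc, this]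
  by_cases h1 : p < 0 <;> by_cases h2 : q < 0 <;> by_cases h3 : q < p <;> by_cases h4 : p + q < 0 <;>
  first
  | omega
  | simp [-Finsupp.single_mul, rightMul_single_desc, desc_mul_s, h1, h2, h3, h4, d1, d2, d3, d4,
      d5, d6, d7, d8, hw]

theorem u_two {i j : ℕ} (h : BraidRel X i j 2) : u X i * u X j = u X j * u X i := by
  apply MulOpposite.unop_injective
  exact Finsupp.lhom_ext fun w c => rightMul_two h w c

theorem u_three {i j : ℕ} (h : BraidRel X i j 3) :
    u X i * u X j * u X i = u X j * u X i * u X j := by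
  apply MulOpposite.unop_injective
  exact Finsupp.lhom_ext fun w c => rightMul_three h w c

theorem u_four {i j : ℕ} (h : BraidRel X i j 4) :
    u X i * u X j * u X i * u X j = u X j * u X i * u X j * u X i := by
  apply MulOpposite.unop_injective
  exact Finsupp.lhom_ext fun w c => rightMul_four h w c

end

/-! ### The Yang–Baxter relations in rank two -/

section YangBaxter

variable {R M : Type*} [CommRing R] [Ring M] [Algebra R M]

theorem yangBaxter_three {b : R} {u v : M} (hu : u * u = b • u) (hv : v * v = b • v)
    (h : u * v * u = v * u * v) (x y : R) :
    (1 + x • u) * (1 + (x + y + b * x * y) • v) * (1 + y • u) =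
      (1 + y • v) * (1 + (x + y + b * x * y) • u) * (1 + x • v) := by
  set z := x + y + b * x * y with hz
  have e1 : (1 + x • u) * (1 + z • v) * (1 + y • u) = 1 + x • u + z • v + y • u +
      (x * z) • (u * v) + (x * y) • (u * u) + (z * y) • (v * u) + (x * z * y) • (u * v * u) := by
    simp only [mul_add, add_mul, one_mul, mul_one, smul_mul_smul_comm]
    abel
  have e2 : (1 + y • v) * (1 + z • u) * (1 + x • v) = 1 + y • v + z • u + x • v +
      (y * z) • (v * u) + (y * x) • (v * v) + (z * x) • (u * v) + (y * z * x) • (v * u * v) := by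
    simp only [mul_add, add_mul, one_mul, mul_one, smul_mul_smul_comm]
    abel
  rw [e1, e2, hu, hv, h, hz]
  module

/-- After expansion the terms uvu, vuv and the top terms agree. The two sides differ by a multiple
of uv − vu, and `ht` says that its coefficient vanishes. -/
theorem yangBaxter_four {b : R} {u v : M} (hu : u * u = b • u) (hv : v * v = b • v)
    (h : u * v * u * v = v * u * v * u) {p q r t : R}
    (ht : p * q + p * t + r * t + b * p * t * (q + r) = q * r) :
    (1 + p • u) * (1 + q • v) * (1 + r • u) * (1 + t • v) =
      (1 + t • v) * (1 + r • u) * (1 + q • v) * (1 + p • u) := by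
  have e1 : (1 + p • u) * (1 + q • v) * (1 + r • u) * (1 + t • v) =
      1 + p • u + q • v + r • u + t • v + (p * q) • (u * v) + (p * r) • (u * u) +
      (p * t) • (u * v) + (q * r) • (v * u) + (q * t) • (v * v) + (r * t) • (u * v) +
      (p * q * r) • (u * v * u) + (p * q * t) • (u * (v * v)) + (p * r * t) • (u * u * v) +
      (q * r * t) • (v * u * v) + (p * q * r * t) • (u * v * u * v) := by
    simp only [mul_add, add_mul, one_mul, mul_one, smul_mul_smul_comm, mul_assoc]
    abel
  have e2 : (1 + t • v) * (1 + r • u) * (1 + q • v) * (1 + p • u) =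
      1 + t • v + r • u + q • v + p • u + (t * r) • (v * u) + (t * q) • (v * v) +
      (t * p) • (v * u) + (r * q) • (u * v) + (r * p) • (u * u) + (q * p) • (v * u) +
      (t * r * q) • (v * u * v) + (t * r * p) • (v * (u * u)) + (t * q * p) • (v * v * u) +
      (r * q * p) • (u * v * u) + (t * r * q * p) • (v * u * v * u) := by
    simp only [mul_add, add_mul, one_mul, mul_one, smul_mul_smul_comm, mul_assoc]
    abel
  have h1 : (p * q + p * t + r * t + b * p * t * (q + r)) • (u * v - v * u) =
    (q * r) • (u * v - v * u) := by rw [ht]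
  rw [e1, e2, hu, hv, h]
  simp only [mul_smul_comm, smul_mul_assoc]
  rw [← sub_eq_zero]
  rw [← sub_eq_zero] at h1
  rw [← h1]
  module

end YangBaxter

/-! ### The group of parameters -/

/-- The power series without constant term. -/
def Par : Type := {y : Ser // MvPowerSeries.constantCoeff y = 0}

namespace Par

noncomputable instance : Add Par := ⟨fun x y => ⟨oplus β x.1 y.1, constantCoeff_oplus x.2 y.2⟩⟩
noncomputable instance : Neg Par := ⟨fun x => ⟨bar β x.1, constantCoeff_bar x.2⟩⟩
noncomputable instance : Zero Par := ⟨⟨0, map_zero _⟩⟩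

@[simp] theorem coe_add (x y : Par) : (x + y).1 = oplus β x.1 y.1 := rfl
@[simp] theorem coe_neg (x : Par) : (-x).1 = bar β x.1 := rfl

/-- The formal group law. -/
noncomputable instance : AddCommGroup Par :=
  { AddGroup.ofLeftAxioms (fun x y z : Par => Subtype.ext (oplus_assoc x.1 y.1 z.1))
      (fun x => Subtype.ext (zero_oplus x.1)) (fun x => Subtype.ext (bar_oplus_self x.2)) with
    add_comm := fun x y => Subtype.ext (oplus_comm x.1 y.1) }

end Par

/-! ### The factors h_i(y) and A_i(y) as units, and their commutation -/

section Units

variable (X : CType)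

/-- The factor `h_i(y)` as a unit. -/
noncomputable def hU (i : ℕ) (y : Par) : (IdAlg X)ˣ where
  val := h X i y.1
  inv := h X i (bar β y.1)
  val_inv := by rw [h_mul_h, oplus_bar β _ y.2]; simp [h]
  inv_val := by rw [h_mul_h, bar_oplus_self y.2]; simp [h]

@[simp] theorem hU_val (i : ℕ) (y : Par) : (hU X i y : IdAlg X) = h X i y.1 := rfl

theorem hU_add (i : ℕ) (x y : Par) : hU X i (x + y) = hU X i x * hU X i y :=
  Units.ext (h_mul_h X i x.1 y.1).symm

theorem hU_zero (i : ℕ) : hU X i 0 = 1 := by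
  have h := hU_add X i 0 0
  rw [add_zero] at h
  exact left_eq_mul.mp h

theorem hU_neg (i : ℕ) (x : Par) : hU X i (-x) = (hU X i x)⁻¹ :=
  eq_inv_of_mul_eq_one_left (by rw [← hU_add, neg_add_cancel, hU_zero])

theorem hU_comm_self (i : ℕ) (x y : Par) : Commute (hU X i x) (hU X i y) := by
  rw [commute_iff_eq, ← hU_add, ← hU_add, add_comm]

variable {X}

theorem BraidRel.hU_comm {i j : ℕ} (r : BraidRel X i j 2) (x y : Par) :
    Commute (hU X i x) (hU X j y) := by
  apply Units.ext
  have h := u_two r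
  change (1 + x.1 • u X i) * (1 + y.1 • u X j) = (1 + y.1 • u X j) * (1 + x.1 • u X i)
  simp only [mul_add, add_mul, one_mul, mul_one, smul_mul_smul_comm, h, mul_comm x.1]
  abel

theorem BraidRel.hU_braid {i j : ℕ} (r : BraidRel X i j 3) (x y : Par) :
    hU X i x * hU X j (x + y) * hU X i y = hU X j y * hU X i (x + y) * hU X j x :=
  Units.ext <| by
    have := yangBaxter_three (R := Ser) (M := IdAlg X) (u_mul_self X i)
      (u_mul_self X j) (u_three r) x.1 y.1
    simpa only [Units.val_mul, hU_val, h, Par.coe_add, oplus] using this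

theorem hU_comm_of_le {i j : ℕ} (hij : i + 2 ≤ j) (hi : i ≠ 0) (x y : Par) :
    Commute (hU X i x) (hU X j y) := by
  obtain ⟨i, rfl⟩ := Nat.exists_eq_succ_of_ne_zero hi
  obtain ⟨j, rfl⟩ := Nat.exists_eq_succ_of_ne_zero (n := j) (by omega)
  exact BraidRel.hU_comm (.comm X i j (by omega)) x y

/-- The left end of the shift of an index by the Yang–Baxter relation. -/
theorem braid_shift {Γ : Type*} [Group Γ] {f g : Par → Γ} (hg : ∀ x y, g (x + y) = g x * g y)
    (hb : ∀ x y, f x * g (x + y) * f y = g y * f (x + y) * g x) (x y : Par) :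
    g (-y) * f x * g y = g (-x) * f y * g x * f (x - y) := by
  have h1 := hb y (x - y)
  rw [show y + (x - y) = x by abel] at h1
  have h2 : g (-y) = g (-x) * g (x - y) := by rw [← hg, show -x + (x - y) = -y by abel]
  calc g (-y) * f x * g y = g (-x) * (g (x - y) * f x * g y) := by rw [h2]; simp only [mul_assoc]
    _ = g (-x) * (f y * g x * f (x - y)) := by rw [h1]
    _ = _ := by simp only [mul_assoc]

/-- The factor `A_i^{(n)}(y)` as a unit. -/
noncomputable def AU (X : CType) (n i : ℕ) (y : Par) : (IdAlg X)ˣ :=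
  ((List.range' i (n - i)).reverse.map fun k => hU X k y).prod

theorem AU_val (n i : ℕ) (y : Par) : (AU X n i y : IdAlg X) = A X n i y.1 := by
  rw [AU, A, ← Units.coeHom_apply, map_list_prod, List.map_map]
  rfl

theorem AU_succ {n i : ℕ} (hi : i < n) (y : Par) : AU X n i y = AU X n (i + 1) y * hU X i y := by
  have : n - i = n - (i + 1) + 1 := by omega
  rw [AU, AU, this, List.range'_succ, List.reverse_cons, List.map_append, List.prod_append]
  simp

theorem AU_of_le {n i : ℕ} (hi : n ≤ i) (y : Par) : AU X n i y = 1 := by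
  have : n - i = 0 := by omega
  rw [AU, this]; simp

theorem AU_inv_val (n i : ℕ) (y : Par) :
    (((AU X n i (-y))⁻¹ : (IdAlg X)ˣ) : IdAlg X) = Arev X n i y.1 := by
  by_cases hin : n ≤ i
  · have : n - i = 0 := by omega
    rw [AU_of_le hin, Arev, this]; simp
  · obtain ⟨d, hd⟩ : ∃ d, n = i + 1 + d := ⟨n - i - 1, by omega⟩
    induction d generalizing i with
    | zero =>
      have : n - i = 1 := by omega
      rw [AU_succ (by omega), AU_of_le (by omega), Arev, this, one_mul, hU_neg, inv_inv]
      simp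
    | succ d ih =>
      have : n - i = n - (i + 1) + 1 := by omega
      rw [AU_succ (by omega), mul_inv_rev, hU_neg, inv_inv, Units.val_mul,
        ih (i + 1) (by omega) (by omega), Arev, Arev, this, List.range'_succ]
      simp

theorem AU_zero (n i : ℕ) : AU X n i 0 = 1 := by
  simp [AU, hU_zero]

theorem commute_AU {g : (IdAlg X)ˣ} {n i : ℕ} {y : Par}
    (hg : ∀ k, i ≤ k → k < n → Commute g (hU X k y)) : Commute g (AU X n i y) := by
  refine Commute.list_prod_right _ _ fun x hx => ?_
  obtain ⟨k, hk, rfl⟩ := List.mem_map.mp hx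
  rw [List.mem_reverse, List.mem_range'_1] at hk
  exact hg k hk.1 (by omega)

/-- The factor h_{j+1}(x) passes A_{j+3}(y). Completing the latter to A_{j+2}(y) costs h_{j+2}(−y)
and leaves a block in two neighbouring generators. -/
theorem AU_mul_AU {n j : ℕ} (hj : j + 2 < n) (x y : Par) :
    AU X n (j + 1) x * AU X n (j + 1) y = AU X n (j + 2) x * AU X n (j + 2) y *
      (hU X (j + 2) (-y) * hU X (j + 1) x * hU X (j + 2) y * hU X (j + 1) y) := by
  have h1 : AU X n (j + 2) y = AU X n (j + 3) y * hU X (j + 2) y := AU_succ (by omega) y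
  have h2 : AU X n (j + 3) y = AU X n (j + 2) y * hU X (j + 2) (-y) := by
    rw [h1, hU_neg, mul_inv_cancel_right]
  have h3 : Commute (hU X (j + 1) x) (AU X n (j + 3) y) :=
    commute_AU fun k hk _ => hU_comm_of_le hk (by omega) x y
  have h4 (z : Par) : AU X n (j + 1) z = AU X n (j + 2) z * hU X (j + 1) z := AU_succ (by omega) z
  calc AU X n (j + 1) x * AU X n (j + 1) y =
      AU X n (j + 2) x * (hU X (j + 1) x * AU X n (j + 3) y * hU X (j + 2) y * hU X (j + 1) y) := by
        rw [h4, h4, h1]; simp only [mul_assoc]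
    _ = AU X n (j + 2) x * (AU X n (j + 3) y * hU X (j + 1) x * hU X (j + 2) y *
        hU X (j + 1) y) := by rw [h3.eq]
    _ = _ := by rw [h2]; simp only [mul_assoc]

/-- Induction that lowers the first index. In `AU_mul_AU` the leading factors commute by induction.
By `braid_shift`, exchanging x and y in the remaining block costs h_{j+1}(x − y), which turns the
last factor h_{j+1}(y) into h_{j+1}(x). -/
theorem AU_comm {n j : ℕ} (x y : Par) : Commute (AU X n (j + 1) x) (AU X n (j + 1) y) := by
  by_cases hin : n ≤ j + 1
  · rw [AU_of_le hin, AU_of_le hin]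
  obtain ⟨d, hd⟩ : ∃ d, n = j + 2 + d := ⟨n - j - 2, by omega⟩
  induction d generalizing j with
  | zero =>
    rw [AU_succ (by omega), AU_of_le (by omega), AU_succ (by omega), AU_of_le (by omega), one_mul,
      one_mul]
    exact hU_comm_self X (j + 1) x y
  | succ d ih =>
    have h1 : Commute (AU X n (j + 2) x) (AU X n (j + 2) y) := ih (j := j + 1) (by omega) (by omega)
    have h4 := braid_shift (hU_add X (j + 2))
      (BraidRel.hU_braid (.braid X j)) x y
    rw [commute_iff_eq, AU_mul_AU (j := j) (by omega) x y,
      AU_mul_AU (j := j) (by omega) y x, h1.eq, h4,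
      mul_assoc _ (hU X (j + 1) (x - y)), ← hU_add, sub_add_cancel]

end Units

/-! ### Commutation of twisted conjugates -/

section Conj

variable {P Γ : Type*} [AddCommGroup P] [Group Γ]

/-- The inner factors A(−x)⁻¹ and A(y) commute, and A' passes φ. All interaction is collected in a
middle block between outer factors that are symmetric in x and y, so only this block has to be
examined in `conj_comm`. -/
theorem conj_mul_conj {A A' g φ : P → Γ} (hA : ∀ x, A x = A' x * g x)
    (hAA : ∀ x y, Commute (A x) (A y)) (hg : ∀ x y, g (x + y) = g x * g y)
    (hc : ∀ x y, Commute (A' x) (φ y)) (x y : P) :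
    A x * φ x * (A (-x))⁻¹ * (A y * φ y * (A (-y))⁻¹) =
      A x * A y * (g (-y) * φ x * g (x + y) * φ y * g (-x)) * ((A (-x))⁻¹ * (A (-y))⁻¹) := by
  have g0 : g 0 = 1 := by
    have h := hg 0 0
    rw [add_zero] at h
    exact left_eq_mul.mp h
  have gn (z : P) : (g (-z))⁻¹ = g z := by
    rw [inv_eq_iff_mul_eq_one, ← hg, neg_add_cancel, g0]
  have gn' (z : P) : g (-z) = (g z)⁻¹ := by rw [← gn z, inv_inv]
  have h1 : (A (-x))⁻¹ * A y = A' y * g (x + y) * (A' (-x))⁻¹ := by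
    rw [((hAA (-x) y).inv_left).eq, hA y, hA (-x), mul_inv_rev, gn, add_comm, hg]
    simp only [mul_assoc]
  have h2 : A' y = A y * g (-y) := by rw [hA, gn', mul_inv_cancel_right]
  have h3 : (A' (-x))⁻¹ = g (-x) * (A (-x))⁻¹ := by
    rw [hA, mul_inv_rev, mul_inv_cancel_left]
  have h4 : (A' (-x))⁻¹ * φ y = φ y * (A' (-x))⁻¹ := ((hc (-x) y).inv_left).eq
  calc A x * φ x * (A (-x))⁻¹ * (A y * φ y * (A (-y))⁻¹)
      = A x * φ x * ((A (-x))⁻¹ * A y) * φ y * (A (-y))⁻¹ := by simp only [mul_assoc]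
    _ = A x * (φ x * A' y) * g (x + y) * ((A' (-x))⁻¹ * φ y) * (A (-y))⁻¹ := by
        rw [h1]; simp only [mul_assoc]
    _ = A x * A' y * φ x * g (x + y) * φ y * (A' (-x))⁻¹ * (A (-y))⁻¹ := by
        rw [h4, ← (hc y x).eq]; simp only [mul_assoc]
    _ = _ := by rw [h2, h3]; simp only [mul_assoc]

theorem conj_comm {A A' g φ : P → Γ} (hA : ∀ x, A x = A' x * g x)
    (hAA : ∀ x y, Commute (A x) (A y)) (hg : ∀ x y, g (x + y) = g x * g y)
    (hc : ∀ x y, Commute (A' x) (φ y))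
    (hK : ∀ x y, g (-y) * φ x * g (x + y) * φ y * g (-x) =
      g (-x) * φ y * g (x + y) * φ x * g (-y)) (x y : P) :
    Commute (A x * φ x * (A (-x))⁻¹) (A y * φ y * (A (-y))⁻¹) := by
  rw [commute_iff_eq, conj_mul_conj hA hAA hg hc, conj_mul_conj hA hAA hg hc, (hAA x y).eq, hK,
    (((hAA (-x) (-y)).inv_left).inv_right).eq, add_comm y x]

end Conj

/-- The argument of `h_0` in the factor `F(y)`, in types `B` and `C`. -/
def rootArg {P : Type*} [Add P] : CType → P → P
  | .C, y => y + y
  | _, y => y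

/-- The middle factor of `F(y)`. -/
noncomputable def midU (X : CType) (y : Par) : (IdAlg X)ˣ :=
  match X with
  | .D => hU .D 0 y * hU .D 1 y
  | X => hU X 0 (rootArg X y)

/-- The first index of the outer factors of `F(y)`. -/
def midIdx : CType → ℕ
  | .D => 1
  | _ => 0

/-- The factor `F_n(y)` as a unit. -/
noncomputable def FU (X : CType) (n : ℕ) (y : Par) : (IdAlg X)ˣ :=
  AU X n (midIdx X + 1) y * midU X y * (AU X n (midIdx X + 1) (-y))⁻¹

theorem FU_val (X : CType) (n : ℕ) (y : Par) : (FU X n y : IdAlg X) = F1 X n y.1 := by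
  rw [FU, Units.val_mul, Units.val_mul, AU_inv_val, AU_val]
  cases X with
  | B => rfl
  | C => simp only [F1]; rw [sq, h_mul_h]; rfl
  | D => rfl

/-! ### The factors F(y), and reflections acting on the arguments of G_A -/

section

variable {X : CType}

theorem BraidRel.hU_four {x y : Par} (hX : X ≠ .D) :
    hU X 0 (rootArg X x) * hU X 1 (x + y) * hU X 0 (rootArg X y) * hU X 1 (-x + y) =
      hU X 1 (-x + y) * hU X 0 (rootArg X y) * hU X 1 (x + y) * hU X 0 (rootArg X x) := by
  have hb : x.1 + bar β x.1 + MvPowerSeries.C β * x.1 * bar β x.1 = 0 := oplus_bar β _ x.2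
  apply Units.ext
  cases X with
  | B =>
    have := yangBaxter_four (R := Ser) (M := IdAlg .B) (u_mul_self .B 0) (u_mul_self .B 1)
      (u_four .braid_B) (four_identity hb (y := y.1) rfl)
    simpa only [Units.val_mul, hU_val, h, Par.coe_add, oplus, Par.coe_neg, rootArg] using this
  | C =>
    have := yangBaxter_four (R := Ser) (M := IdAlg .C) (u_mul_self .C 0) (u_mul_self .C 1)
      (u_four .braid_C) (four_identity' hb (y := y.1) rfl)
    simpa only [Units.val_mul, hU_val, h, Par.coe_add, oplus, Par.coe_neg, rootArg] using this
  | D => exact absurd rfl hX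

theorem hU_zero_comm {k : ℕ} (hk : midIdx X + 2 ≤ k) (x y : Par) :
    Commute (hU X 0 x) (hU X k y) := by
  cases X with
  | B =>
    obtain ⟨k, rfl⟩ := Nat.exists_eq_add_of_le' hk
    exact BraidRel.hU_comm (.comm_B k) x y
  | C =>
    obtain ⟨k, rfl⟩ := Nat.exists_eq_add_of_le' hk
    exact BraidRel.hU_comm (.comm_C k) x y
  | D =>
    obtain ⟨k, rfl⟩ := Nat.exists_eq_add_of_le' hk
    exact BraidRel.hU_comm (.comm_D k) x y

theorem midU_comm {k : ℕ} (hk : midIdx X + 2 ≤ k) (x y : Par) :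
    Commute (midU X x) (hU X k y) := by
  cases X with
  | B => exact hU_zero_comm hk _ y
  | C => exact hU_zero_comm hk _ y
  | D => exact (hU_zero_comm hk _ y).mul_left (hU_comm_of_le hk one_ne_zero _ _)

/-- In types B and C this is the four-term Yang–Baxter relation with h_1(−y) multiplied on both
sides. In type D the relation between s_1 and s_2 merges the factors h_1 into h_1(x + y), which
commutes with h_{1̂}; the relation between s_{1̂} and s_2 then exchanges x and y. -/
theorem midU_symm (x y : Par) :
    hU X (midIdx X + 1) (-y) * midU X x * hU X (midIdx X + 1) (x + y) * midU X y *
      hU X (midIdx X + 1) (-x) =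
    hU X (midIdx X + 1) (-x) * midU X y * hU X (midIdx X + 1) (x + y) * midU X x *
      hU X (midIdx X + 1) (-y) := by
  have key : ∀ X : CType, X ≠ .D → hU X 1 (-y) * hU X 0 (rootArg X x) * hU X 1 (x + y) *
      hU X 0 (rootArg X y) * hU X 1 (-x) = hU X 1 (-x) * hU X 0 (rootArg X y) * hU X 1 (x + y) *
      hU X 0 (rootArg X x) * hU X 1 (-y) := by
    intro X hX
    have h1 : hU X 1 (-x) = hU X 1 (-x + y) * hU X 1 (-y) := by
      rw [← hU_add, add_neg_cancel_right]
    have h2 : hU X 1 (-x) = hU X 1 (-y) * hU X 1 (-x + y) := by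
      rw [← hU_add]; congr 1; abel
    calc _ = hU X 1 (-y) * (hU X 0 (rootArg X x) * hU X 1 (x + y) * hU X 0 (rootArg X y) *
          hU X 1 (-x + y)) * hU X 1 (-y) := by rw [h1]; simp only [mul_assoc]
      _ = _ := by rw [BraidRel.hU_four hX, h2]; simp only [mul_assoc]
  cases X with
  | B => exact key .B (by simp)
  | C => exact key .C (by simp)
  | D =>
    change hU .D 2 (-y) * (hU .D 0 x * hU .D 1 x) * hU .D 2 (x + y) * (hU .D 0 y * hU .D 1 y) *
      hU .D 2 (-x) = hU .D 2 (-x) * (hU .D 0 y * hU .D 1 y) * hU .D 2 (x + y) *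
      (hU .D 0 x * hU .D 1 x) * hU .D 2 (-y)
    have c01 (a b : Par) : Commute (hU .D 0 a) (hU .D 1 b) := BraidRel.hU_comm .comm_D_one a b
    have key : ∀ x y : Par, hU .D 2 (-y) * (hU .D 0 x * hU .D 1 x) * hU .D 2 (x + y) *
        (hU .D 0 y * hU .D 1 y) * hU .D 2 (-x) = hU .D 2 (-y) * hU .D 0 x * hU .D 2 y *
        hU .D 1 (x + y) * (hU .D 2 x * hU .D 0 y * hU .D 2 (-x)) := by
      intro x y
      have hb := BraidRel.hU_braid (.braid .D 0) x y
      simp only [zero_add] at hb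
      calc _ = hU .D 2 (-y) * hU .D 0 x * (hU .D 1 x * hU .D 2 (x + y) * hU .D 1 y) *
            hU .D 0 y * hU .D 2 (-x) := by
              rw [(c01 y y).eq]; simp only [mul_assoc]
        _ = _ := by rw [hb]; simp only [mul_assoc]
    have b02 := @BraidRel.hU_braid .D 0 2 .braid_D
    have h1 := braid_shift (hU_add .D 2) b02 x y
    have h2 : hU .D 0 (x - y) * (hU .D 2 x * hU .D 0 y * hU .D 2 (-x)) =
        hU .D 2 y * hU .D 0 x * hU .D 2 (-y) := by
      have := b02 (x - y) y
      rw [sub_add_cancel] at this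
      rw [show hU .D 2 (-y) = hU .D 2 (x - y) * hU .D 2 (-x) by rw [← hU_add]; congr 1; abel]
      simp only [← mul_assoc]
      rw [this]
    have k2 := key y x
    rw [add_comm y x] at k2
    rw [key x y, k2, h1, mul_assoc _ (hU .D 0 (x - y)) (hU .D 1 (x + y)), (c01 (x - y) (x + y)).eq,
      ← mul_assoc _ (hU .D 1 (x + y)), mul_assoc _ (hU .D 0 (x - y)), h2]

theorem FU_data (n : ℕ) (hn : 3 ≤ n) :
    (∀ x, AU X n (midIdx X + 1) x = AU X n (midIdx X + 2) x * hU X (midIdx X + 1) x) ∧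
    (∀ x y, Commute (AU X n (midIdx X + 2) x) (midU X y)) := by
  refine ⟨fun x => AU_succ (by cases X <;> simp [midIdx] <;> omega) x, fun x y => ?_⟩
  exact (commute_AU fun k hk _ => midU_comm hk y x).symm

theorem FU_comm {n : ℕ} (hn : 3 ≤ n) (x y : Par) : Commute (FU X n x) (FU X n y) :=
  conj_comm (FU_data n hn).1 AU_comm (hU_add X _) (FU_data n hn).2 midU_symm x y

/-- A tail of the product `G_A(y)`. -/
noncomputable def tailU (X : CType) (n k r : ℕ) (y : ℕ → Par) : (IdAlg X)ˣ :=
  ((List.range' k r).map fun j => AU X n (j + 1) (y j)).prod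

/-- `G_A(y)` as a unit. -/
noncomputable def GU (X : CType) (n : ℕ) (y : ℕ → Par) : (IdAlg X)ˣ := tailU X n 0 (n - 1) y

theorem GU_val (n : ℕ) (y : ℕ → Par) : (GU X n y : IdAlg X) = GA X n fun k => (y k).1 := by
  rw [GU, tailU, GA, ← Units.coeHom_apply, map_list_prod, List.map_map, List.range_eq_range']
  congr 2
  funext k
  exact AU_val n _ _

theorem tailU_succ (n k r : ℕ) (y : ℕ → Par) :
    tailU X n k (r + 1) y = AU X n (k + 1) (y k) * tailU X n (k + 1) r y := by
  simp [tailU, List.range'_succ]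

theorem tailU_add (n k r t : ℕ) (y : ℕ → Par) :
    tailU X n k (r + t) y = tailU X n k r y * tailU X n (k + r) t y := by
  rw [tailU, tailU, tailU, ← List.prod_append, ← List.map_append, List.range'_append_1]

theorem tailU_congr {n k r : ℕ} {y y' : ℕ → Par} (h : ∀ j, k ≤ j → j < k + r → y j = y' j) :
    tailU X n k r y = tailU X n k r y' := by
  refine congrArg List.prod (List.map_congr_left fun j hj => ?_)
  rw [List.mem_range'_1] at hj
  rw [h j hj.1 hj.2]

theorem commute_tailU {g : (IdAlg X)ˣ} {n k r : ℕ} {y : ℕ → Par}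
    (hg : ∀ j, k + 1 ≤ j → ∀ z, Commute g (hU X j z)) : Commute g (tailU X n k r y) := by
  refine Commute.list_prod_right _ _ fun x hx => ?_
  obtain ⟨j, hj, rfl⟩ := List.mem_map.mp hx
  rw [List.mem_range'_1] at hj
  exact commute_AU fun k' hk' _ => hg k' (by omega) _

theorem GU_congr {n : ℕ} {y y' : ℕ → Par} (h : ∀ j, j + 1 < n → y j = y' j) :
    GU X n y = GU X n y' := tailU_congr fun j _ hj => h j (by omega)

/-- Factors beyond the first n − 1 are empty products, so their number may be chosen freely. -/
theorem GU_eq (n r : ℕ) (hr : n ≤ r + 1) (y : ℕ → Par) : GU X n y = tailU X n 0 r y := by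
  obtain ⟨t, rfl⟩ : ∃ t, r = n - 1 + t := ⟨r - (n - 1), by omega⟩
  have h : tailU X n (0 + (n - 1)) t y = 1 := by
    refine List.prod_eq_one fun x hx => ?_
    obtain ⟨j, hj, rfl⟩ := List.mem_map.mp hx
    rw [List.mem_range'_1] at hj
    exact AU_of_le (by omega) _
  rw [GU, tailU_add, h, mul_one]

/-- The action of the simple reflections on sequences of parameters. -/
def parAct {P : Type*} [Neg P] : CType → ℕ → (ℕ → P) → ℕ → P
  | _, i + 1, y => fun j => y (Equiv.swap i (i + 1) j)
  | .D, 0, y => fun j => if j = 0 then -y 1 else if j = 1 then -y 0 else y j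
  | _, 0, y => fun j => if j = 0 then -y 0 else y j

/-- The parameters that a simple reflection adds to the arguments `x`. -/
def parPre {P : Type*} : CType → ℕ → (ℕ → P) → List P
  | _, _ + 1, _ => []
  | .D, 0, y => [y 0, y 1]
  | _, 0, y => [y 0]

/-- The value of a simple root on a sequence of parameters, up to sign. -/
def parRoot {P : Type*} [Add P] [Neg P] : CType → ℕ → (ℕ → P) → P
  | _, i + 1, y => -y i + y (i + 1)
  | .D, 0, y => y 0 + y 1
  | X, 0, y => rootArg X (y 0)

/-- Since A_{i+2} = A_{i+1} h_{i+1}⁻¹ and the A_{i+1} commute, the two sides differ only in the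
trailing factors h_{i+1}. -/
theorem AU_swap {n i : ℕ} (hi : i + 1 < n) (x y : Par) :
    AU X n (i + 1) y * AU X n (i + 2) x =
      AU X n (i + 1) x * AU X n (i + 2) y * hU X (i + 1) (-x + y) := by
  have h (z : Par) : AU X n (i + 2) z = AU X n (i + 1) z * (hU X (i + 1) z)⁻¹ := by
    rw [AU_succ (i := i + 1) hi, mul_inv_cancel_right]
  rw [h, h, ← mul_assoc, (AU_comm y x).eq, add_comm (-x) y, hU_add, hU_neg, ← mul_assoc, ← mul_assoc,
    inv_mul_cancel_right]

theorem GU_swap {n i : ℕ} (hi : i + 1 < n) (y : ℕ → Par) :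
    GU X n (fun j => y (Equiv.swap i (i + 1) j)) = GU X n y * hU X (i + 1) (-y i + y (i + 1)) := by
  rw [GU_eq n (i + (n + 2)) (by omega), GU_eq n (i + (n + 2)) (by omega), tailU_add _ _ i (n + 2),
    tailU_add _ _ i (n + 2), tailU_succ, tailU_succ, tailU_succ, tailU_succ]
  simp only [zero_add, Equiv.swap_apply_left, Equiv.swap_apply_right]
  rw [← mul_assoc (AU X n (i + 1) (y (i + 1))), AU_swap hi,
    tailU_congr (k := 0) (y' := y) fun j _ hj => by
      rw [Equiv.swap_apply_of_ne_of_ne (by omega) (by omega)],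
    tailU_congr (k := i + 1 + 1) (y' := y) fun j hj _ => by
      rw [Equiv.swap_apply_of_ne_of_ne (by omega) (by omega)], mul_assoc _ (hU X _ _),
    (commute_tailU fun j hj z => hU_comm_of_le (by omega) (by omega) _ _).eq]
  simp only [mul_assoc]

/-- For i ≥ 1 two neighbouring factors of G_A are exchanged. For i = 0 in types B and C, the last
factor of F(y_0) cancels the reflected first factor of G_A, and the middle factor h_0 commutes with
the rest. In type D, F(y_0) F(y_1) meets the first two factors of G_A; the h_1 and h_2 that remain
are reassembled by the Yang–Baxter relation of s_{1̂} and s_2, which leaves only h_{1̂}(y_0 + y_1).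
-/
theorem FU_mul_GU {n : ℕ} (hn : 3 ≤ n) (i : ℕ) (hi : i < n) (y : ℕ → Par) :
    ((parPre X i y).map (FU X n)).prod * GU X n (parAct X i y) =
      GU X n y * hU X i (parRoot X i y) := by
  obtain _ | i := i
  · have key : X ≠ .D → FU X n (y 0) * GU X n (fun j => if j = 0 then -y 0 else y j) =
        GU X n y * midU X (y 0) := by
      intro hX
      have hm : midIdx X = 0 := by cases X <;> simp_all [midIdx]
      rw [GU_eq n (n + 1) (by omega), GU_eq n (n + 1) (by omega), tailU_succ, tailU_succ,
        tailU_congr (k := 0 + 1) (y' := y) fun j hj _ => if_neg (by omega), FU, hm, if_pos rfl]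
      have hc : Commute (midU X (y 0)) (tailU X n 1 n y) :=
        commute_tailU fun j hj z => midU_comm (by omega) _ z
      rw [mul_assoc, inv_mul_cancel_left, mul_assoc, zero_add, hc.eq, mul_assoc]
    cases X with
    | B => simpa [parPre, parAct, parRoot, midU] using key (by simp)
    | C => simpa [parPre, parAct, parRoot, midU] using key (by simp)
    | D =>
      simp only [parPre, parAct, parRoot, List.map_cons, List.map_nil, List.prod_cons,
        List.prod_nil, mul_one]
      rw [GU_eq n (n + 1 + 1) (by omega), GU_eq n (n + 1 + 1) (by omega), tailU_succ, tailU_succ,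
        tailU_succ, tailU_succ, tailU_congr (k := 0 + 1 + 1) (y' := y) fun j hj _ => by
          rw [if_neg (by omega), if_neg (by omega)]]
      have hF := conj_mul_conj (FU_data (X := .D) n hn).1 AU_comm (hU_add .D _)
        (FU_data (X := .D) n hn).2 (y 0) (y 1)
      change FU .D n (y 0) * FU .D n (y 1) = _ at hF
      change _ = AU .D n 2 (y 0) * AU .D n 2 (y 1) * (hU .D 2 (-y 1) *
        (hU .D 0 (y 0) * hU .D 1 (y 0)) * hU .D 2 (y 0 + y 1) * (hU .D 0 (y 1) * hU .D 1 (y 1)) *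
        hU .D 2 (-y 0)) * ((AU .D n 2 (-y 0))⁻¹ * (AU .D n 2 (-y 1))⁻¹) at hF
      simp only [zero_add, if_true, one_ne_zero, if_false, Nat.reduceAdd]
      generalize y 0 = a at *
      generalize y 1 = b at *
      have hT : Commute (hU .D 0 (a + b)) (tailU .D n 2 n y) := 
        commute_tailU fun j hj z => hU_zero_comm hj _ _
      have h1 (z : Par) : AU .D n 1 z = AU .D n 2 z * hU .D 1 z := AU_succ (by omega) z
      have h2 (z : Par) : AU .D n 2 z = AU .D n 3 z * hU .D 2 z := AU_succ (by omega) z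
      have h3 (z w : Par) : hU .D 1 w * AU .D n 3 z = AU .D n 3 z * hU .D 1 w :=
        (commute_AU fun k hk _ => hU_comm_of_le hk one_ne_zero _ _).eq
      have h4 (z : Par) : AU .D n 3 z = AU .D n 2 z * hU .D 2 (-z) := by
        rw [h2, hU_neg, mul_inv_cancel_right]
      have e1 : (AU .D n 2 (-a))⁻¹ * (AU .D n 2 (-b))⁻¹ * (AU .D n 1 (-b) * AU .D n 2 (-a)) =
          hU .D 2 a * hU .D 1 (-b) * hU .D 2 (-a) := by
        calc _ = (AU .D n 2 (-a))⁻¹ * (hU .D 1 (-b) * AU .D n 3 (-a)) * hU .D 2 (-a) := by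
              rw [h1, mul_assoc, mul_assoc (AU .D n 2 (-b)), inv_mul_cancel_left, h2 (-a)]
              simp only [mul_assoc]
          _ = _ := by
              rw [h3, h4, neg_neg, ← mul_assoc, ← mul_assoc, inv_mul_cancel, one_mul]
      have e2 : AU .D n 1 a * AU .D n 2 b = AU .D n 2 a * AU .D n 2 b * (hU .D 2 (-b) *
          hU .D 1 a * hU .D 2 b) := by
        calc _ = AU .D n 2 a * (hU .D 1 a * AU .D n 3 b) * hU .D 2 b := by
              rw [h1, h2 b]; simp only [mul_assoc]
          _ = _ := by rw [h3, h4]; simp only [mul_assoc]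
      have b02 := BraidRel.hU_braid .braid_D a b
      have gn (z : Par) : hU .D 2 (-z) * hU .D 2 z = 1 := by rw [← hU_add, neg_add_cancel, hU_zero]
      have c01 : hU .D 0 a * hU .D 1 a = hU .D 1 a * hU .D 0 a :=
        BraidRel.hU_comm .comm_D_one a a
      calc FU .D n a * (FU .D n b) * (AU .D n 1 (-b) * (AU .D n 2 (-a) * tailU .D n 2 n y)) =
          AU .D n 2 a * AU .D n 2 b * (hU .D 2 (-b) * (hU .D 0 a * hU .D 1 a) * hU .D 2 (a + b) *
          (hU .D 0 b * hU .D 1 b) * hU .D 2 (-a)) * ((AU .D n 2 (-a))⁻¹ * (AU .D n 2 (-b))⁻¹ *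
          (AU .D n 1 (-b) * AU .D n 2 (-a))) * tailU .D n 2 n y := by
            rw [hF]; simp only [mul_assoc]
        _ = AU .D n 2 a * AU .D n 2 b * hU .D 2 (-b) * hU .D 1 a * (hU .D 0 a * hU .D 2 (a + b) *
            hU .D 0 b) * (hU .D 1 b * ((hU .D 2 (-a) * hU .D 2 a) * (hU .D 1 (-b) *
            hU .D 2 (-a)))) * tailU .D n 2 n y := by
            rw [e1, c01]; simp only [mul_assoc]
        _ = AU .D n 1 a * AU .D n 2 b * (hU .D 0 (a + b) * tailU .D n 2 n y) := by
            rw [gn, b02, one_mul, hU_neg .D 1, mul_inv_cancel_left, e2]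
            have : hU .D 2 a * hU .D 2 (-a) = 1 := by rw [← hU_add, add_neg_cancel, hU_zero]
            simp only [mul_assoc]
            rw [← mul_assoc (hU .D 2 a), this, one_mul]
        _ = _ := by rw [hT.eq]; simp only [mul_assoc]
  · have : parPre X (i + 1) y = [] := by cases X <;> rfl
    have h2 : parAct X (i + 1) y = fun j => y (Equiv.swap i (i + 1) j) := by cases X <;> rfl
    have h3 : parRoot X (i + 1) y = -y i + y (i + 1) := by cases X <;> rfl
    rw [this, h2, h3, List.map_nil, List.prod_nil, one_mul, GU_swap hi]

/-- The product `G_A(c)⁻¹ F(z_1) ⋯ F(z_r) G_A(y)`. -/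
noncomputable def GFG (X : CType) (n : ℕ) (c : ℕ → Par) (z : List Par) (y : ℕ → Par) :
    (IdAlg X)ˣ :=
  (GU X n c)⁻¹ * (z.map (FU X n)).prod * GU X n y

/-- The F commute, so the inserted ones can be moved next to G_A, where `FU_mul_GU` applies. -/
theorem GFG_step {n : ℕ} (hn : 3 ≤ n) (i : ℕ) (hi : i < n) (c : ℕ → Par) (z : List Par)
    (y : ℕ → Par) :
    GFG X n c (parPre X i y ++ z) (parAct X i y) = GFG X n c z y * hU X i (parRoot X i y) := by
  have hc : Commute ((parPre X i y).map (FU X n)).prod (z.map (FU X n)).prod := by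
    refine Commute.list_prod_left _ _ fun x hx => Commute.list_prod_right _ _ fun w hw => ?_
    obtain ⟨x, -, rfl⟩ := List.mem_map.mp hx
    obtain ⟨w, -, rfl⟩ := List.mem_map.mp hw
    exact FU_comm hn x w
  rw [GFG, GFG, List.map_append, List.prod_append, hc.eq]
  simp only [mul_assoc]
  rw [FU_mul_GU hn i hi]

theorem GFG_self (n : ℕ) (c : ℕ → Par) : GFG X n c [] c = 1 := by
  simp [GFG]

end

/-! ### Transfer of statements from the factors h_i to the product G_A⁻¹ F G_A -/

section Transfer

variable {X : CType}

/-- A unit of the idCoxeter algebra acting by right multiplication. -/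
noncomputable def actU (T : (IdAlg X)ˣ) (m : Weyl X →₀ Ser) : Weyl X →₀ Ser :=
  MulOpposite.unop (T : IdAlg X) m

theorem actU_one (m : Weyl X →₀ Ser) : actU 1 m = m := rfl

theorem actU_mul (T S : (IdAlg X)ˣ) (m : Weyl X →₀ Ser) : actU (T * S) m = actU S (actU T m) := rfl

theorem actU_inv_actU (T : (IdAlg X)ˣ) (m : Weyl X →₀ Ser) : actU T⁻¹ (actU T m) = m := by
  rw [← actU_mul, mul_inv_cancel, actU_one]

theorem actU_actU_inv (T : (IdAlg X)ˣ) (m : Weyl X →₀ Ser) : actU T (actU T⁻¹ m) = m := by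
  rw [← actU_mul, inv_mul_cancel, actU_one]

theorem actU_hU (i : ℕ) (y : Par) (m : Weyl X →₀ Ser) :
    actU (hU X i y) m = m + y.1 • rightMul X i m := rfl

/-- The pairs of units that a map intertwines. -/
def interU (Φ : (Weyl X →₀ Ser) → (Weyl X →₀ Ser)) : Subgroup ((IdAlg X)ˣ × (IdAlg X)ˣ) where
  carrier := {p | ∀ m, Φ (actU p.1 m) = actU p.2 (Φ m)}
  one_mem' _ := rfl
  mul_mem' {p q} hp hq m := by
    rw [Prod.fst_mul, Prod.snd_mul, actU_mul, actU_mul, hq, hp]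
  inv_mem' {p} hp m := by
    have h := hp (actU p.1⁻¹ m)
    rw [actU_actU_inv] at h
    rw [Prod.fst_inv, Prod.snd_inv, h, actU_inv_actU]

theorem prod_mk_list_prod_mem {Γ Γ' ι : Type*} [Group Γ] [Group Γ'] (H : Subgroup (Γ × Γ'))
    (l : List ι) (f : ι → Γ) (g : ι → Γ') (h : ∀ k ∈ l, (f k, g k) ∈ H) :
    ((l.map f).prod, (l.map g).prod) ∈ H := by
  induction l with
  | nil => exact H.one_mem
  | cons k l ih =>
    rw [List.map_cons, List.map_cons, List.prod_cons, List.prod_cons]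
    exact H.mul_mem (h k (by simp)) (ih fun k' hk' => h k' (by simp [hk']))

theorem mk_mul_mem {Γ Γ' : Type*} [Group Γ] [Group Γ'] {H : Subgroup (Γ × Γ')} {a c : Γ}
    {b d : Γ'} (h : (a, b) ∈ H) (h' : (c, d) ∈ H) : (a * c, b * d) ∈ H := H.mul_mem h h'

theorem mk_inv_mem {Γ Γ' : Type*} [Group Γ] [Group Γ'] {H : Subgroup (Γ × Γ')} {a : Γ} {b : Γ'}
    (h : (a, b) ∈ H) : (a⁻¹, b⁻¹) ∈ H := H.inv_mem h

section Param

variable (H : Subgroup ((IdAlg X)ˣ × (IdAlg X)ˣ)) (p : Par →+ Par) {n m : ℕ}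

theorem mem_midU (h : ∀ i < 2, ∀ y, (hU X i y, hU X i (p y)) ∈ H) (y : Par) :
    (midU X y, midU X (p y)) ∈ H := by
  cases X with
  | B => exact h 0 (by omega) y
  | C =>
    have := h 0 (by omega) (y + y)
    rwa [map_add] at this
  | D => exact mk_mul_mem (h 0 (by omega) y) (h 1 (by omega) y)

theorem mem_FU (hm : ∀ i < 2, ∀ y, (hU X i y, hU X i (p y)) ∈ H)
    (h : ∀ i y, (AU X n i y, AU X m i (p y)) ∈ H) (y : Par) :
    (FU X n y, FU X m (p y)) ∈ H := by
  have h1 := h (midIdx X + 1) (-y)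
  rw [map_neg] at h1
  exact mk_mul_mem (mk_mul_mem (h _ _) (mem_midU H p hm y)) (mk_inv_mem h1)

theorem mem_GU (hmn : m ≤ n) (h : ∀ i y, (AU X n i y, AU X m i (p y)) ∈ H) (y : ℕ → Par) :
    (GU X n y, GU X m fun k => p (y k)) ∈ H := by
  rw [GU_eq n n (by omega), GU_eq m n (by omega)]
  exact prod_mk_list_prod_mem H _ _ _ fun k _ => h _ _

/-- Products and inverses stay in a subgroup of pairs, so a property of the whole product is checked
on its factors. The uses are the truncation to a parabolic subgroup, the change of parameters and
the bound on orders. Two ranks n and m are allowed for the sake of the truncation. -/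
theorem mem_GFG (hmn : m ≤ n) (hm : ∀ i < 2, ∀ y, (hU X i y, hU X i (p y)) ∈ H)
    (h : ∀ i y, (AU X n i y, AU X m i (p y)) ∈ H) (c : ℕ → Par) (z : List Par) (y : ℕ → Par) :
    (GFG X n c z y, GFG X m (fun k => p (c k)) (z.map p) fun k => p (y k)) ∈ H := by
  refine mk_mul_mem (mk_mul_mem (mk_inv_mem (mem_GU H p hmn h c)) ?_) (mem_GU H p hmn h y)
  rw [List.map_map]
  exact prod_mk_list_prod_mem H _ _ _ fun k _ => mem_FU H p hm h k

theorem mem_GFG_self (h : ∀ i y, (hU X i y, hU X i (p y)) ∈ H) (c : ℕ → Par) (z : List Par)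
    (y : ℕ → Par) :
    (GFG X n c z y, GFG X n (fun k => p (c k)) (z.map p) fun k => p (y k)) ∈ H :=
  mem_GFG H p le_rfl (fun i _ => h i)
    (fun _ _ => prod_mk_list_prod_mem H _ _ _ fun _ _ => h _ _) c z y

end Param

/-- The coefficient of `u_w` in a unit. -/
noncomputable def coU (T : (IdAlg X)ˣ) (w : Weyl X) : Ser := actU T (Finsupp.single 1 1) w

/-! ### Restriction to a parabolic subgroup -/

open Classical in
theorem filter_rightMul_of_lt {m i : ℕ} (hm : 2 ≤ m) (hi : i < m) (f : Weyl X →₀ Ser) :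
    (rightMul X i f).filter (FixGT m) = rightMul X i (f.filter (FixGT m)) := by
  induction f using Finsupp.induction_linear with
  | zero => rw [map_zero, Finsupp.filter_zero, map_zero]
  | add f g hf hg => rw [map_add, Finsupp.filter_add, hf, hg, Finsupp.filter_add, map_add]
  | single w c =>
    by_cases hw : FixGT m w
    · rw [Finsupp.filter_single_of_pos _ hw, rightMul_single_desc]
      split_ifs with hd
      · exact Finsupp.filter_single_of_pos _ hw
      · exact Finsupp.filter_single_of_pos _ ((fixGT_mul_s_iff hm hi w).mpr hw)
    · rw [Finsupp.filter_single_of_neg _ hw, rightMul_single_desc, map_zero]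
      split_ifs with hd
      · exact Finsupp.filter_single_of_neg _ hw
      · exact Finsupp.filter_single_of_neg _ fun h => hw ((fixGT_mul_s_iff hm hi w).mp h)

open Classical in
-- Every basis element produced by right multiplication by u_i has i as a descent, whereas an
-- element that fixes all integers above m ≤ i has no such descent.
theorem filter_rightMul_of_le {m i : ℕ} (hm : 2 ≤ m) (hi : m ≤ i) (f : Weyl X →₀ Ser) :
    (rightMul X i f).filter (FixGT m) = 0 := by
  induction f using Finsupp.induction_linear with
  | zero => rw [map_zero, Finsupp.filter_zero]
  | add f g hf hg => rw [map_add, Finsupp.filter_add, hf, hg, add_zero]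
  | single w c =>
    rw [rightMul_single_desc]
    split_ifs with hd
    · exact Finsupp.filter_single_of_neg _ fun h => (not_desc_of_fixGT hm hi h).1 hd
    · refine Finsupp.filter_single_of_neg _ fun h => ?_
      have := (not_desc_of_fixGT hm hi h).1
      rw [desc_mul_s] at this
      exact this hd

open Classical in
theorem hU_mem_filter {m : ℕ} (hm : 2 ≤ m) (i : ℕ) (y : Par) :
    (hU X i y, if i < m then hU X i y else 1) ∈
      interU (X := X) (fun f => f.filter (FixGT m)) := by
  intro f
  dsimp only
  rw [actU_hU, Finsupp.filter_add, Finsupp.filter_smul]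
  split_ifs with hi
  · rw [actU_hU, filter_rightMul_of_lt hm hi]
  · rw [actU_one, filter_rightMul_of_le hm (not_lt.mp hi), smul_zero, add_zero]

open Classical in
theorem AU_mem_filter {m n : ℕ} (hm : 2 ≤ m) (hmn : m ≤ n) (i : ℕ) (y : Par) :
    (AU X n i y, AU X m i y) ∈ interU (X := X) (fun f => f.filter (FixGT m)) := by
  by_cases hi : n ≤ i
  · rw [AU_of_le hi, AU_of_le (hmn.trans hi)]
    exact Subgroup.one_mem _
  · obtain ⟨d, hd⟩ : ∃ d, n = i + d := ⟨n - i, by omega⟩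
    clear hi
    induction d generalizing i with
    | zero =>
      rw [AU_of_le (by omega), AU_of_le (by omega)]
      exact Subgroup.one_mem _
    | succ d ih =>
      have h := Subgroup.mul_mem _ (ih (i + 1) (by omega)) (hU_mem_filter hm i y)
      rw [Prod.mk_mul_mk, ← AU_succ (by omega)] at h
      split_ifs at h with him
      · rwa [← AU_succ him] at h
      · have h1 : AU X m (i + 1) y = AU X m i y := by
          rw [AU_of_le (by omega), AU_of_le (by omega)]
        rwa [mul_one, h1] at h

/-- The truncation to the elements that fix all integers above m replaces h_i by 1 for i ≥ m. The
coefficient of such a v is therefore the same for every rank n ≥ m. -/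
theorem coU_GFG_of_fixGT {m n : ℕ} (hm : 2 ≤ m) (hmn : m ≤ n) (c : ℕ → Par) (z : List Par)
    (y : ℕ → Par) {v : Weyl X} (hv : FixGT m v) :
    coU (GFG X n c z y) v = coU (GFG X m c z y) v := by
  classical
  have h := mem_GFG (interU (X := X) fun f => f.filter (FixGT m)) (AddMonoidHom.id Par) hmn
    (fun i hi y => by simpa [show i < m by omega] using hU_mem_filter (X := X) hm i y)
    (AU_mem_filter hm hmn) c z y (Finsupp.single 1 1)
  dsimp only at h
  rw [Finsupp.filter_single_of_pos _ (fun k _ => rfl)] at h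
  have h2 := DFunLike.congr_fun h v
  rw [Finsupp.filter_apply_pos _ _ hv] at h2
  simpa [coU] using h2

/-! ### Change of parameters -/

/-- The evaluation of parameters at a point. -/
noncomputable def Pt.par (q : Pt) : Par →+ Par :=
  AddMonoidHom.mk' (fun y => ⟨q.ev y.1, q.constantCoeff_ev y.2⟩)
    fun x y => Subtype.ext (q.ev_oplus x.1 y.1)

theorem mapRange_rightMul (q : Pt) (i : ℕ) (f : Weyl X →₀ Ser) :
    Finsupp.mapRange.addMonoidHom (q.ev : Ser →+ Ser) (rightMul X i f) =
      rightMul X i (Finsupp.mapRange.addMonoidHom (q.ev : Ser →+ Ser) f) := by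
  classical
  induction f using Finsupp.induction_linear with
  | zero => simp
  | add f g hf hg => rw [map_add, map_add, hf, hg, map_add, map_add]
  | single w c =>
    rw [Finsupp.mapRange.addMonoidHom_apply, Finsupp.mapRange.addMonoidHom_apply,
      rightMul_single_desc, Finsupp.mapRange_single, rightMul_single_desc]
    split_ifs
    · rw [Finsupp.mapRange_single]
      congr 1
      exact (map_mul q.ev _ _).trans (by rw [Pt.ev_C]; rfl)
    · rw [Finsupp.mapRange_single]

theorem ev_coU_GFG (q : Pt) (n : ℕ) (c : ℕ → Par) (z : List Par) (y : ℕ → Par) (v : Weyl X) :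
    q.ev (coU (GFG X n c z y) v) =
      coU (GFG X n (fun k => q.par (c k)) (z.map q.par) fun k => q.par (y k)) v := by
  have hU : ∀ i y, (hU X i y, hU X i (q.par y)) ∈
      interU (X := X) (Finsupp.mapRange.addMonoidHom (q.ev : Ser →+ Ser)) := by
    intro i y f
    dsimp only
    rw [actU_hU, actU_hU, map_add, ← mapRange_rightMul]
    congr 1
    ext w : 1
    exact map_mul q.ev _ _
  have h := mem_GFG_self _ q.par hU (n := n) c z y (Finsupp.single 1 1)
  have h2 := DFunLike.congr_fun h v
  rw [Finsupp.mapRange.addMonoidHom_apply, Finsupp.mapRange.addMonoidHom_apply,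
    Finsupp.mapRange_single] at h2
  simpa [coU] using h2

/-! ### Degrees -/

/-- The elements in which the order of the coefficient of `u_w` is at least `ℓ(w)`. -/
def lowBound (X : CType) : AddSubmonoid (Weyl X →₀ Ser) where
  carrier := {f | ∀ w, (len X w : ℕ∞) ≤ (f w).order}
  zero_mem' w := by simp
  add_mem' {f g} hf hg w :=
    (le_min (hf w) (hg w)).trans MvPowerSeries.min_order_le_add

theorem single_mem_lowBound {w : Weyl X} {c : Ser} (h : (len X w : ℕ∞) ≤ c.order) :
    Finsupp.single w c ∈ lowBound X := by
  classical
  intro v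
  rw [Finsupp.single_apply]
  split_ifs with hv
  · rwa [← hv]
  · simp

/-- One generator increases the length by at most 1, and its argument has no constant term, so the
order grows at least as fast as the length. -/
theorem smul_rightMul_mem_lowBound (i : ℕ) (y : Par) {f : Weyl X →₀ Ser} (hf : f ∈ lowBound X) :
    y.1 • rightMul X i f ∈ lowBound X := by
  classical
  rw [← Finsupp.sum_single f, Finsupp.sum, map_sum, Finset.smul_sum]
  refine AddSubmonoid.sum_mem _ fun w _ => ?_
  have hy : (1 : ℕ∞) ≤ y.1.order := MvPowerSeries.one_le_order_iff_constCoeff_eq_zero.mpr y.2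
  rw [rightMul_single_desc]
  split_ifs
  · rw [Finsupp.smul_single, smul_eq_mul]
    refine single_mem_lowBound ((hf w).trans ?_)
    exact (le_add_self.trans MvPowerSeries.le_order_mul).trans
      (le_add_self.trans MvPowerSeries.le_order_mul)
  · rw [Finsupp.smul_single, smul_eq_mul]
    refine single_mem_lowBound (le_trans ?_ MvPowerSeries.le_order_mul)
    calc (len X (w * s X i) : ℕ∞) ≤ ((len X w + 1 : ℕ) : ℕ∞) := by
          exact_mod_cast len_mul_s_le w i
      _ ≤ y.1.order + (f w).order := by
          rw [add_comm]; push_cast; exact add_le_add hy (hf w)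

/-- The units that preserve the bound on orders. -/
def boundedU (X : CType) : Subgroup (IdAlg X)ˣ where
  carrier := {T | ∀ f ∈ lowBound X, actU T f ∈ lowBound X ∧ actU T⁻¹ f ∈ lowBound X}
  one_mem' f hf := by rw [inv_one, actU_one]; exact ⟨hf, hf⟩
  mul_mem' {T S} hT hS f hf := by
    rw [mul_inv_rev, actU_mul, actU_mul]
    exact ⟨(hS _ (hT f hf).1).1, (hT _ (hS f hf).2).2⟩
  inv_mem' {T} hT f hf := by rw [inv_inv]; exact (hT f hf).symm

theorem len_one : len X (1 : Weyl X) = 0 := by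
  have := len_le (X := X) []
  exact Nat.le_zero.mp this

theorem len_le_order_coU_GFG (n : ℕ) (c : ℕ → Par) (z : List Par) (y : ℕ → Par) (v : Weyl X) :
    (len X v : ℕ∞) ≤ (coU (GFG X n c z y) v).order := by
  have hU : ∀ i y, (hU X i y, hU X i (AddMonoidHom.id Par y)) ∈ (boundedU X).prod ⊤ := by
    intro i y
    refine Subgroup.mem_prod.mpr ⟨fun f hf => ?_, trivial⟩
    dsimp only
    rw [← hU_neg, actU_hU, actU_hU]
    exact ⟨add_mem hf (smul_rightMul_mem_lowBound i _ hf),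
      add_mem hf (smul_rightMul_mem_lowBound i _ hf)⟩
  have h := (Subgroup.mem_prod.mp (mem_GFG_self _ _ hU (n := n) c z y)).1
  refine (h (Finsupp.single 1 1) (single_mem_lowBound ?_)).1 v
  rw [len_one]
  exact zero_le

end Transfer

/-! ### Existence of the limit that defines the double Grothendieck polynomials -/

section Limit

variable {X : CType}

/-- A variable as a parameter. -/
noncomputable def varPar (v : Var) : Par := ⟨MvPowerSeries.X v, MvPowerSeries.constantCoeff_X v⟩

theorem coeffU_val (T : (IdAlg X)ˣ) (w : Weyl X) : coeffU X (T : IdAlg X) w = coU T w := rfl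

theorem prod_map_FU (n : ℕ) (l : List ℕ) :
    (((l.map fun k => varPar (.x k)).map (FU X n)).prod : IdAlg X) =
      (l.map fun k => F1 X n (xv k)).prod := by
  induction l with
  | nil => rfl
  | cons k l ih =>
    rw [List.map_cons, List.map_cons, List.prod_cons, Units.val_mul, ih, FU_val, List.map_cons,
      List.prod_cons]
    rfl

theorem GFG_val (n : ℕ) : (GFG X n (fun k => -varPar (.b k))
    ((List.range n).map fun k => varPar (.x k)) (fun k => varPar (.a k)) : IdAlg X) = GG X n := by
  rw [GFG, Units.val_mul, Units.val_mul, prod_map_FU, ← Ring.inverse_unit, GU_val, GU_val]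
  rfl

theorem grothN_eq (n : ℕ) (w : Weyl X) :
    grothN X n w = coU (GFG X n (fun k => -varPar (.b k)) ((List.range n).map fun k => varPar (.x k))
      fun k => varPar (.a k)) w := by
  rw [← coeffU_val, GFG_val, grothN]

theorem FU_zero (n : ℕ) : FU X n 0 = 1 := by
  have : midU X 0 = 1 := by
    cases X with
    | B => exact hU_zero _ _
    | C => exact (congrArg _ (add_zero _)).trans (hU_zero _ _)
    | D => exact (congrArg₂ _ (hU_zero _ _) (hU_zero _ _)).trans (mul_one _)
  rw [FU, this, AU_zero, neg_zero, AU_zero, mul_one, inv_one, mul_one]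

theorem GFG_append_zero (n : ℕ) (c : ℕ → Par) (z z' : List Par) (y : ℕ → Par)
    (hz : ∀ x ∈ z', x = 0) : GFG X n c (z ++ z') y = GFG X n c z y := by
  have : (z'.map (FU X n)).prod = 1 := by
    refine List.prod_eq_one fun x hx => ?_
    obtain ⟨x, hx', rfl⟩ := List.mem_map.mp hx
    rw [hz x hx', FU_zero]
  rw [GFG, GFG, List.map_append, List.prod_append, this, mul_one]

theorem varPar_kill_mem {S : Set Var} {v : Var} (h : v ∈ S) :
    (Pt.kill S).par (varPar v) = varPar v :=
  Subtype.ext ((Pt.ev_X _ _).trans (Pt.kill_mem h))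

theorem varPar_kill_notMem {S : Set Var} {v : Var} (h : v ∉ S) :
    (Pt.kill S).par (varPar v) = 0 :=
  Subtype.ext ((Pt.ev_X _ _).trans (Pt.kill_notMem h))

/-- The variables other than `x_k, x_{k+1}, …`. -/
def xBelow (k : ℕ) : Set Var := {v | ∀ j, v = .x j → j < k}

/-- Factors F whose argument is set to 0 are trivial, and v lies in the parabolic subgroup of rank
m. The right side no longer involves n, which is the stability behind the limit. -/
theorem kill_xBelow_grothN {m k n : ℕ} (hm : 2 ≤ m) (hmn : m ≤ n) (hk : k ≤ n) {v : Weyl X}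
    (hv : FixGT m v) :
    (Pt.kill (xBelow k)).ev (grothN X n v) = coU (GFG X m (fun k => -varPar (.b k))
      ((List.range k).map fun k => varPar (.x k)) fun k => varPar (.a k)) v := by
  obtain ⟨t, rfl⟩ := Nat.exists_eq_add_of_le hk
  rw [grothN_eq, coU_GFG_of_fixGT hm hmn _ _ _ hv, ev_coU_GFG, List.range_eq_range',
    List.range_eq_range', ← List.range'_append_1, List.map_append, List.map_append,
    GFG_append_zero]
  · congr 2
    · funext j
      rw [map_neg, varPar_kill_mem (by rintro _ ⟨⟩)]
    · rw [List.map_map]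
      refine List.map_congr_left fun j hj => varPar_kill_mem ?_
      rintro _ ⟨⟩
      rw [List.mem_range'_1] at hj
      omega
    · funext j
      exact varPar_kill_mem (by rintro _ ⟨⟩)
  · intro x hx
    rw [List.map_map] at hx
    obtain ⟨j, hj, rfl⟩ := List.mem_map.mp hx
    rw [List.mem_range'_1] at hj
    refine varPar_kill_notMem fun h => ?_
    have := h j rfl
    omega

/-- An upper bound for the indices of the variables `x` in a monomial. -/
def xBound (d : Var →₀ ℕ) : ℕ :=
  d.support.sup fun v => match v with | .x j => j + 1 | _ => 0

theorem mem_xBelow {d : Var →₀ ℕ} {n : ℕ} (hn : xBound d ≤ n) :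
    ∀ v ∈ d.support, v ∈ xBelow n := by
  rintro v hv j rfl
  exact (Finset.le_sup (f := fun v => match v with | Var.x j => j + 1 | _ => 0) hv).trans hn

theorem coeff_grothN_eq {m n n' : ℕ} (hm : 2 ≤ m) {v : Weyl X} (hv : FixGT m v) {d : Var →₀ ℕ}
    (hn : m ≤ n) (hn' : m ≤ n') (hd : xBound d ≤ n) (hd' : xBound d ≤ n') :
    MvPowerSeries.coeff d (grothN X n v) = MvPowerSeries.coeff d (grothN X n' v) := by
  rw [← Pt.coeff_kill (xBelow (xBound d)) _ d (mem_xBelow le_rfl), kill_xBelow_grothN hm hn hd hv,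
    ← Pt.coeff_kill (xBelow (xBound d)) (grothN X n' v) d (mem_xBelow le_rfl),
    kill_xBelow_grothN hm hn' hd' hv]

theorem exists_isFormalLim (v : Weyl X) : ∃ F, IsFormalLim (fun n => grothN X n v) F := by
  obtain ⟨m, hm, hv⟩ := exists_fixGT v
  -- The coefficient at d is constant once n reaches both the rank needed for v and the number of x
  -- in the monomial, so its value at this index is taken.
  let F : Ser := fun d => MvPowerSeries.coeff d (grothN X (max m (xBound d)) v)
  have hF (d : Var →₀ ℕ) : MvPowerSeries.coeff d F =
    MvPowerSeries.coeff d (grothN X (max m (xBound d)) v) := rfl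
  clear_value F
  refine ⟨F, fun d => ?_⟩
  filter_upwards [Filter.eventually_ge_atTop (max m (xBound d))] with n hn
  rw [hF]
  exact coeff_grothN_eq hm hv (by omega) (by omega) (by omega) (by omega)

theorem isFormalLim_groth (v : Weyl X) : IsFormalLim (fun n => grothN X n v) (groth X v) := by
  rw [groth, formalLim, dif_pos (exists_isFormalLim v)]
  exact (exists_isFormalLim v).choose_spec

theorem coeff_groth {m n : ℕ} (hm : 2 ≤ m) {v : Weyl X} (hv : FixGT m v) {d : Var →₀ ℕ}
    (hn : m ≤ n) (hd : xBound d ≤ n) :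
    MvPowerSeries.coeff d (groth X v) = MvPowerSeries.coeff d (grothN X n v) := by
  obtain ⟨N, hN⟩ := Filter.eventually_atTop.mp (isFormalLim_groth v d)
  rw [← hN (max N n) (le_max_left _ _)]
  exact coeff_grothN_eq hm hv (by omega) hn (by omega) hd

theorem len_le_order_grothN (n : ℕ) (v : Weyl X) : (len X v : ℕ∞) ≤ (grothN X n v).order := by
  rw [grothN_eq]
  exact len_le_order_coU_GFG _ _ _ _ _

theorem len_le_order_groth (v : Weyl X) : (len X v : ℕ∞) ≤ (groth X v).order := by
  refine MvPowerSeries.le_order fun d hd => ?_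
  obtain ⟨m, hm, hv⟩ := exists_fixGT v
  rw [coeff_groth (n := max m (xBound d)) hm hv (by omega) (by omega)]
  exact MvPowerSeries.coeff_of_lt_order (hd.trans_le (len_le_order_grothN _ _))

end Limit

/-! ### Supersymmetric functions as power series -/

theorem Pt.coeff_kill_eq_zero (S : Set Var) (f : Ser) (d : Var →₀ ℕ) {v : Var} (hv : v ∈ d.support)
    (hvS : v ∉ S) : MvPowerSeries.coeff d ((kill S).ev f) = 0 := by
  rw [ev, MvPowerSeries.substAlgHom_apply, MvPowerSeries.coeff_subst (kill S).hasSubst]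
  refine finsum_eq_zero_of_forall_eq_zero fun e => ?_
  by_cases h : ∀ v ∈ e.support, v ∈ S
  · have : (e.prod fun s e => (kill S).val s ^ e) = MvPowerSeries.monomial e 1 := by
      rw [MvPowerSeries.monomial_one_eq]
      exact Finset.prod_congr rfl fun v hv => by simp only [kill_mem (h v hv)]
    have hne : d ≠ e := by
      rintro rfl
      exact hvS (h v hv)
    rw [this, MvPowerSeries.coeff_monomial_ne hne, smul_zero]
  · push Not at h
    obtain ⟨w, hw, hw'⟩ := h
    have : (e.prod fun s e => (kill S).val s ^ e) = 0 := by
      refine Finset.prod_eq_zero hw ?_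
      simp only [kill_notMem hw']
      exact zero_pow (by simpa using hw)
    rw [this, map_zero, smul_zero]

/-- The extension of coefficients. -/
noncomputable def toQ : ZBeta →+* Polynomial ℚ := Polynomial.mapRingHom (Int.castRingHom ℚ)

theorem toQ_X : toQ Polynomial.X = β := by simp [toQ, β]

/-- A power series in `x` with integral coefficients as an element of the ambient ring. -/
noncomputable def ofX (f : MvPowerSeries ℕ ZBeta) : Ser :=
  MvPowerSeries.map toQ (MvPowerSeries.rename Var.x f)

/-- The evaluation of a polynomial with integral coefficients. -/
noncomputable def polyEv {n : ℕ} (g : Fin n → Ser) : MvPolynomial (Fin n) ZBeta →+* Ser :=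
  MvPolynomial.eval₂Hom (MvPowerSeries.C.comp toQ) g

theorem ev_polyEv (q : Pt) {n : ℕ} (g : Fin n → Ser) (p : MvPolynomial (Fin n) ZBeta) :
    q.ev (polyEv g p) = polyEv (fun k => q.ev (g k)) p := by
  have : (q.ev : Ser →+* Ser).comp (polyEv g) = polyEv fun k => q.ev (g k) := by
    refine MvPolynomial.ringHom_ext (fun c => ?_) fun k => ?_
    · simp [polyEv]
    · simp [polyEv]
  exact RingHom.congr_fun this p

theorem polyEv_perm {n : ℕ} {p : MvPolynomial (Fin n) ZBeta} (hp : p.IsSymmetric)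
    (σ : Equiv.Perm (Fin n)) (g : Fin n → Ser) : polyEv (g ∘ σ) p = polyEv g p := by
  conv_rhs => rw [← hp σ, polyEv, MvPolynomial.coe_eval₂Hom, MvPolynomial.eval₂_rename]
  rfl

/-- The variables as an embedding. -/
def xEmb : ℕ ↪ Var := ⟨Var.x, fun _ _ h => by injection h⟩

theorem coeff_ofX_embDomain (f : MvPowerSeries ℕ ZBeta) (e : ℕ →₀ ℕ) :
    MvPowerSeries.coeff (Finsupp.embDomain xEmb e) (ofX f) = toQ (MvPowerSeries.coeff e f) := by
  rw [ofX, MvPowerSeries.coeff_map]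
  exact congrArg toQ (MvPowerSeries.coeff_embDomain_rename xEmb f e)

theorem coeff_ofX_eq_zero (f : MvPowerSeries ℕ ZBeta) {d : Var →₀ ℕ} {v : Var}
    (hv : v ∈ d.support) (hx : ∀ k, v ≠ .x k) : MvPowerSeries.coeff d (ofX f) = 0 := by
  classical
  rw [ofX, MvPowerSeries.coeff_map, MvPowerSeries.coeff_rename_eq_zero, map_zero]
  rintro ⟨e, rfl⟩
  obtain ⟨k, -, hk⟩ := Finset.mem_image.mp (Finsupp.mapDomain_support hv)
  exact hx k hk.symm

theorem exists_embDomain {ι κ : Type*} (e : ι ↪ κ) (d : κ →₀ ℕ)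
    (h : ∀ v ∈ d.support, v ∈ Set.range e) : ∃ d', d = Finsupp.embDomain e d' := by
  refine ⟨d.comapDomain e e.injective.injOn, ?_⟩
  rw [Finsupp.embDomain_comapDomain]
  exact fun v hv => h v hv

/-- The monomials that survive on both sides involve only x_1, …, x_n, and there the coefficients
are those of the restriction to `Fin n`. -/
theorem kill_ofX_congr {n : ℕ} {f g : MvPowerSeries ℕ ZBeta}
    (h : MvPowerSeries.killCompl (Fin.valEmbedding : Fin n ↪ ℕ) f =
      MvPowerSeries.killCompl (Fin.valEmbedding : Fin n ↪ ℕ) g) :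
    (kill (xBelow n)).ev (ofX f) = (kill (xBelow n)).ev (ofX g) := by
  ext1 d
  by_cases h1 : ∀ v ∈ d.support, v ∈ xBelow n
  · rw [coeff_kill _ _ _ h1, coeff_kill _ _ _ h1]
    by_cases h2 : ∀ v ∈ d.support, ∃ k, Var.x k = v
    · obtain ⟨e, rfl⟩ := exists_embDomain xEmb d h2
      obtain ⟨e, rfl⟩ := exists_embDomain (Fin.valEmbedding : Fin n ↪ ℕ) e fun k hk =>
        ⟨⟨k, h1 (.x k) (by
          rw [Finsupp.mem_support_iff] at hk ⊢
          exact (Finsupp.embDomain_apply_self xEmb e k).trans_ne hk) k rfl⟩, rfl⟩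
      rw [coeff_ofX_embDomain, coeff_ofX_embDomain, ← MvPowerSeries.coeff_killCompl, h,
        MvPowerSeries.coeff_killCompl]
    · push Not at h2
      obtain ⟨v, hv, hx⟩ := h2
      rw [coeff_ofX_eq_zero f hv fun k hk => hx k hk.symm,
        coeff_ofX_eq_zero g hv fun k hk => hx k hk.symm]
  · push Not at h1
    obtain ⟨v, hv, hx⟩ := h1
    rw [coeff_kill_eq_zero _ _ _ hv hx, coeff_kill_eq_zero _ _ _ hv hx]

theorem ofX_coe {n : ℕ} (p : MvPolynomial (Fin n) ZBeta) :
    ofX (MvPolynomial.rename (Fin.val : Fin n → ℕ) p : MvPolynomial ℕ ZBeta) =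
      polyEv (fun k => xv k) p := by
  induction p using MvPolynomial.induction_on with
  | C c => simp [ofX, polyEv]
  | add p q hp hq =>
    rw [map_add, map_add, MvPolynomial.coe_add, ← hp, ← hq]
    simp only [ofX, map_add]
  | mul_X p k hp =>
    rw [map_mul, map_mul, MvPolynomial.coe_mul, ← hp]
    simp only [ofX, map_mul]
    congr 1
    simp [polyEv, xv]

theorem kill_ofX {n : ℕ} {f : MvPowerSeries ℕ ZBeta} {p : MvPolynomial (Fin n) ZBeta}
    (h : MvPowerSeries.killCompl (Fin.valEmbedding : Fin n ↪ ℕ) f = (p : MvPowerSeries (Fin n) ZBeta)) :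
    (kill (xBelow n)).ev (ofX f) = polyEv (fun k => xv k) p := by
  rw [kill_ofX_congr (g := (MvPolynomial.rename (Fin.val : Fin n → ℕ) p : MvPolynomial ℕ ZBeta)),
    ofX_coe, ev_polyEv]
  · congr 1
    congr 1
    funext k
    rw [ev_xv]
    exact kill_mem fun j hj => by injection hj with hj; rw [← hj]; exact k.2
  · rw [h, ← MvPowerSeries.rename_coe]
    exact (MvPowerSeries.killCompl_rename_app (e := (Fin.valEmbedding : Fin n ↪ ℕ)) _).symm

/-- At a point with only n nonzero values of x the series may be replaced by its polynomial in n
variables, to which the conditions defining `SSn` apply. -/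
theorem ev_ofX {n : ℕ} {f : MvPowerSeries ℕ ZBeta} {p : MvPolynomial (Fin n) ZBeta}
    (h : MvPowerSeries.killCompl (Fin.valEmbedding : Fin n ↪ ℕ) f = (p : MvPowerSeries (Fin n) ZBeta))
    (q : Pt) (hq : ∀ j, n ≤ j → q.val (.x j) = 0) :
    q.ev (ofX f) = polyEv (fun k => q.val (.x k)) p := by
  have : q.comp (kill (xBelow n)) = q := by
    refine ext' (fun k => ?_) (fun k => ?_) fun k => ?_
    · rw [comp_val]
      by_cases hk : k < n
      · rw [kill_mem, ev_X]
        exact fun j hj => by injection hj with hj; omega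
      · rw [kill_notMem, map_zero, hq k (by omega)]
        exact fun hj => hk (hj k rfl)
    all_goals
      rw [comp_val, kill_mem, ev_X]
      rintro _ ⟨⟩
  rw [← this, ← ev_ev, kill_ofX h, ev_polyEv, this]
  simp only [ev_xv]

theorem ext_kill {f g : Ser} (N : ℕ)
    (h : ∀ n, N ≤ n → (kill (xBelow n)).ev f = (kill (xBelow n)).ev g) : f = g := by
  ext1 d
  have hd := mem_xBelow (le_max_left (xBound d) N)
  rw [← coeff_kill _ f d hd, h _ (le_max_right _ _), coeff_kill _ g d hd]

/-- Specialisation of the generic identity in t and the remaining x. With finitely many variables,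
every family without constant term may be substituted. -/
theorem polyEv_cancel {n : ℕ} {p : MvPolynomial (Fin n) ZBeta} (hp : substPair n p = substZero n p)
    {t : Ser} (ht : MvPowerSeries.constantCoeff t = 0) {g : ℕ → Ser}
    (hg : ∀ k, MvPowerSeries.constantCoeff (g k) = 0) :
    polyEv (fun k => if k.val = 0 then t else if k.val = 1 then bar β t else g k) p =
      polyEv (fun k => if k.val < 2 then 0 else g k) p := by
  have hs : MvPowerSeries.HasSubst
      (fun o : Option (Fin n) => o.elim t fun k => g k : Option (Fin n) → Ser) :=
    MvPowerSeries.hasSubst_of_constantCoeff_zero (by rintro (_ | k); exacts [ht, hg k])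
  let E : MvPowerSeries (Option (Fin n)) ZBeta →+* Ser :=
    (MvPowerSeries.substAlgHom (R := Polynomial ℚ) hs : _ →+* Ser).comp (MvPowerSeries.map toQ)
  have hC (c : ZBeta) : E (MvPowerSeries.C c) = MvPowerSeries.C (toQ c) := by
    simp only [E, RingHom.comp_apply, MvPowerSeries.map_C]
    exact (MvPowerSeries.substAlgHom (R := Polynomial ℚ) hs).commutes (toQ c)
  have hX (o : Option (Fin n)) : E (MvPowerSeries.X o) = o.elim t fun k => g k := by
    simp only [E, RingHom.comp_apply, MvPowerSeries.map_X]
    exact MvPowerSeries.substAlgHom_X hs o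
  have hbar : E (bar Polynomial.X (MvPowerSeries.X none)) = bar β t := by
    rw [map_bar_of E (c := β) (by rw [hC, toQ_X]) (MvPowerSeries.constantCoeff_X _)
      (by rw [hX]; exact ht), hX]
    rfl
  have e1 : E.comp (substPair n : MvPolynomial (Fin n) ZBeta →+* _) =
      polyEv (fun k => if k.val = 0 then t else if k.val = 1 then bar β t else g k) := by
    refine MvPolynomial.ringHom_ext (fun c => ?_) fun k => ?_
    · simp only [RingHom.comp_apply, RingHom.coe_coe, substPair, MvPolynomial.aeval_C, polyEv,
        MvPolynomial.coe_eval₂Hom, MvPolynomial.eval₂_C]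
      exact hC c
    · simp only [RingHom.comp_apply, RingHom.coe_coe, substPair, MvPolynomial.aeval_X, polyEv,
        MvPolynomial.coe_eval₂Hom, MvPolynomial.eval₂_X]
      split_ifs
      · exact hX none
      · exact hbar
      · exact hX (some k)
  have e2 : E.comp (substZero n : MvPolynomial (Fin n) ZBeta →+* _) =
      polyEv (fun k => if k.val < 2 then 0 else g k) := by
    refine MvPolynomial.ringHom_ext (fun c => ?_) fun k => ?_
    · simp only [RingHom.comp_apply, RingHom.coe_coe, substZero, MvPolynomial.aeval_C, polyEv,
        MvPolynomial.coe_eval₂Hom, MvPolynomial.eval₂_C]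
      exact hC c
    · simp only [RingHom.comp_apply, RingHom.coe_coe, substZero, MvPolynomial.aeval_X, polyEv,
        MvPolynomial.coe_eval₂Hom, MvPolynomial.eval₂_X]
      split_ifs
      · exact map_zero E
      · exact hX (some k)
  rw [← e1, ← e2]
  exact congrArg E hp

theorem kill_xBelow_x {n k : ℕ} (h : k < n) : (kill (xBelow n)).val (.x k) = xv k :=
  kill_mem fun j hj => by injection hj with hj; omega

theorem kill_xBelow_x_of_le {n k : ℕ} (h : n ≤ k) : (kill (xBelow n)).val (.x k) = 0 :=
  kill_notMem fun hj => by have := hj k rfl; omega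

theorem ofX_mem_dom {f : MvPowerSeries ℕ ZBeta} (hf : f ∈ SS) : ofX f ∈ dom := by
  have hzero : ∀ q : Pt, (cons 0 (map_zero _) q).ev (ofX f) = q.ev (ofX f) := by
    have h0 : (cons 0 (map_zero _) one).ev (ofX f) = ofX f := by
      refine ext_kill 0 fun n _ => ?_
      obtain ⟨p, hp, hfp⟩ := hf (n + 1)
      -- A zero in front is moved behind the n variables x by a rotation of n + 1 arguments; there
      -- it agrees with x_{n+1} = 0.
      rw [ev_ev, ev_ofX hfp, ev_ofX hfp, ← polyEv_perm hp.1 (finRotate (n + 1))]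
      · congr 1
        congr 1
        funext ⟨k, hk⟩
        by_cases hkn : k < n
        · simp only [Function.comp_apply]
          rw [finRotate_of_lt hkn]
          exact ev_xv _ _
        · obtain rfl : k = n := by omega
          simp only [Function.comp_apply]
          rw [finRotate_last', kill_xBelow_x_of_le le_rfl]
          exact map_zero _
      · exact fun j hj => kill_xBelow_x_of_le (by omega)
      · intro j hj
        obtain ⟨j, rfl⟩ : ∃ k, j = k + 1 := ⟨j - 1, by omega⟩
        exact (ev_xv _ _).trans (kill_xBelow_x_of_le (by omega))
    intro q
    conv_rhs => rw [← h0, ev_ev, comp_cons, comp_one]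
    simp only [map_zero]
  refine ⟨fun k => ?_, ?_, ?_⟩
  · refine ext_kill (k + 2) fun n hn => ?_
    obtain ⟨p, hp, hfp⟩ := hf n
    rw [ev_ev, ev_ofX hfp, ev_ofX hfp, ← polyEv_perm hp.1
      (Equiv.swap ⟨k, by omega⟩ ⟨k + 1, by omega⟩)]
    · congr 1
      congr 1
      funext j
      rw [Function.comp_apply, comp_val]
      change (kill (xBelow n)).ev (xv (Equiv.swap k (k + 1) _)) = _
      rw [ev_xv]
      congr 2
      simp only [Equiv.swap_apply_def]
      split_ifs <;> simp_all [Fin.ext_iff]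
    · exact fun j hj => kill_xBelow_x_of_le hj
    · intro j hj
      rw [comp_val]
      change (kill (xBelow n)).ev (xv (Equiv.swap k (k + 1) j)) = _
      rw [ev_xv, Equiv.swap_apply_of_ne_of_ne (by omega) (by omega)]
      exact kill_xBelow_x_of_le hj
  · rw [hzero, ev_one]
  -- Supersymmetry compares the cancelling pair with two zeros, so two zeros are first inserted on
  -- the right side.
  · rw [← hzero (tail one), ← hzero (cons 0 _ (tail one))]
    refine ext_kill 1 fun n hn => ?_
    obtain ⟨p, hp, hfp⟩ := hf (n + 1)
    rw [ev_ev, ev_ev, ev_ofX hfp, ev_ofX hfp]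
    · convert polyEv_cancel (hp.2 (by omega)) (constantCoeff_xv 0)
        (g := fun j => (kill (xBelow n)).ev (xv (j - 1)))
        (fun j => constantCoeff_ev _ (constantCoeff_xv _)) using 2
      · refine congrArg polyEv (funext ?_)
        rintro ⟨k, hk⟩
        rcases k with _ | _ | k
        · exact (ev_xv _ _).trans (kill_xBelow_x (by omega))
        · refine (ev_bar _ (constantCoeff_xv 0)).trans ?_
          rw [ev_xv, kill_xBelow_x (by omega)]
          rfl
        · rfl
      · refine congrArg polyEv (funext ?_)
        rintro ⟨k, hk⟩
        rcases k with _ | _ | k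
        · exact map_zero _
        · exact map_zero _
        · simp
    all_goals
      intro j hj
      obtain ⟨j, rfl⟩ : ∃ k, j = k + 2 := ⟨j - 2, by omega⟩
      change (kill (xBelow n)).ev (xv (j + 1)) = 0
      rw [ev_xv, kill_xBelow_x_of_le (by omega)]

/-- An induction principle: a subring that contains the constants, the images of `SS` and the
variables a, b contains the whole image of the tensor product. -/
theorem toSer_mem (D : Subring Ser) (hC : ∀ c, MvPowerSeries.C c ∈ D)
    (hs : ∀ f ∈ SS, ofX f ∈ D) (ha : ∀ k, av k ∈ D) (hb : ∀ k, bv k ∈ D)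
    (F : (SS ⊗[ZBeta] RBeta) ⊗[ZBeta] RBeta) : toSer F ∈ D := by
  have hpoly : ∀ (g : ℕ → Var), (∀ k, (MvPowerSeries.X (g k) : Ser) ∈ D) → ∀ p : RBeta,
      MvPowerSeries.map toQ (MvPolynomial.aeval (fun i => (MvPowerSeries.X (g i) :
        MvPowerSeries Var ZBeta)) p) ∈ D := by
    intro g hg p
    induction p using MvPolynomial.induction_on with
    | C c =>
      rw [MvPolynomial.aeval_C]
      have : MvPowerSeries.map toQ (algebraMap ZBeta (MvPowerSeries Var ZBeta) c) =
        MvPowerSeries.C (toQ c) := MvPowerSeries.map_C _ _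
      rw [this]
      exact hC _
    | add p q hp hq => rw [map_add, map_add]; exact add_mem hp hq
    | mul_X p k hp =>
      rw [map_mul, map_mul, MvPolynomial.aeval_X, MvPowerSeries.map_X]
      exact mul_mem hp (hg k)
  induction F using TensorProduct.induction_on with
  | zero => rw [map_zero]; exact zero_mem _
  | add x y hx hy => rw [map_add]; exact add_mem hx hy
  | tmul F q =>
    induction F using TensorProduct.induction_on with
    | zero => rw [TensorProduct.zero_tmul, map_zero]; exact zero_mem _
    | add x y hx hy => rw [TensorProduct.add_tmul, map_add]; exact add_mem hx hy
    | tmul f p =>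
      have : toSer ((f ⊗ₜ[ZBeta] p) ⊗ₜ[ZBeta] q) = ofX f.1 *
          MvPowerSeries.map toQ (MvPolynomial.aeval (fun i => (MvPowerSeries.X (Var.a i) :
            MvPowerSeries Var ZBeta)) p) *
          MvPowerSeries.map toQ (MvPolynomial.aeval (fun i => (MvPowerSeries.X (Var.b i) :
            MvPowerSeries Var ZBeta)) q) := by
        rw [ofX, ← map_mul, ← map_mul]
        rfl
      rw [this]
      exact mul_mem (mul_mem (hs _ f.2) (hpoly _ ha p)) (hpoly _ hb q)

theorem toSer_mem_dom (F : (SS ⊗[ZBeta] RBeta) ⊗[ZBeta] RBeta) : toSer F ∈ dom := by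
  refine toSer_mem dom.toSubring (C_mem_dom ·) (fun f hf => ofX_mem_dom hf) (fun k => ?_)
    (fun k => ?_) F
  · exact mem_dom (fun _ _ => by simp) (fun _ => by simp) fun _ _ _ => by simp
  · exact mem_dom (fun _ _ => by simp) (fun _ => by simp) fun _ _ _ => by simp

/-! ### Dependence on the variables `a`, `b` -/

/-- The variables other than `a_k`, `b_k` for `k ≥ N`. -/
def abBelow (N : ℕ) : Set Var := {v | (∀ j, v = .a j → j < N) ∧ ∀ j, v = .b j → j < N}

theorem x_mem_abBelow (N k : ℕ) : Var.x k ∈ abBelow N := ⟨by rintro _ ⟨⟩, by rintro _ ⟨⟩⟩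

theorem a_mem_abBelow {N k : ℕ} : Var.a k ∈ abBelow N ↔ k < N :=
  ⟨fun h => h.1 k rfl, fun h => ⟨by rintro _ ⟨⟩; exact h, by rintro _ ⟨⟩⟩⟩

theorem b_mem_abBelow {N k : ℕ} : Var.b k ∈ abBelow N ↔ k < N :=
  ⟨fun h => h.2 k rfl, fun h => ⟨by rintro _ ⟨⟩, by rintro _ ⟨⟩; exact h⟩⟩

/-- The power series in all `x` and in `a_k`, `b_k` for `k < N`. -/
noncomputable def dep (N : ℕ) : Subalgebra (Polynomial ℚ) Ser :=
  AlgHom.equalizer (kill (abBelow N)).ev (AlgHom.id _ _)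

theorem mem_dep {N : ℕ} {f : Ser} : f ∈ dep N ↔ (kill (abBelow N)).ev f = f := Iff.rfl

theorem X_mem_dep {N : ℕ} {v : Var} (h : v ∈ abBelow N) : (MvPowerSeries.X v : Ser) ∈ dep N := by
  rw [mem_dep, ev_X, kill_mem h]

theorem xv_mem_dep (N k : ℕ) : xv k ∈ dep N := X_mem_dep (x_mem_abBelow N k)
theorem av_mem_dep {N k : ℕ} (h : k < N) : av k ∈ dep N := X_mem_dep (a_mem_abBelow.mpr h)
theorem bv_mem_dep {N k : ℕ} (h : k < N) : bv k ∈ dep N := X_mem_dep (b_mem_abBelow.mpr h)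

theorem bar_mem_dep {N : ℕ} {f : Ser} (hf : MvPowerSeries.constantCoeff f = 0) (h : f ∈ dep N) :
    bar β f ∈ dep N := by
  rw [mem_dep] at h ⊢
  rw [ev_bar _ hf, h]

theorem oplus_mem_dep {N : ℕ} {f g : Ser} (hf : f ∈ dep N) (hg : g ∈ dep N) :
    oplus β f g ∈ dep N :=
  add_mem (add_mem hf hg) (mul_mem (mul_mem (Subalgebra.algebraMap_mem _ β) hf) hg)

theorem ev_congr_of_mem_dep {N : ℕ} {f : Ser} (hf : f ∈ dep N) {p q : Pt}
    (h : ∀ v ∈ abBelow N, p.val v = q.val v) : p.ev f = q.ev f := by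
  have e : p.comp (kill (abBelow N)) = q.comp (kill (abBelow N)) := by
    ext1
    funext v
    rw [comp_val, comp_val]
    by_cases hv : v ∈ abBelow N
    · rw [kill_mem hv, ev_X, ev_X, h v hv]
    · rw [kill_notMem hv, map_zero, map_zero]
  have hf' := mem_dep.mp hf
  calc p.ev f = p.ev ((kill (abBelow N)).ev f) := by rw [hf']
    _ = q.ev ((kill (abBelow N)).ev f) := by rw [ev_ev, ev_ev, e]
    _ = q.ev f := by rw [hf']

theorem ev_mem_dep {N M : ℕ} {f : Ser} (hf : f ∈ dep N) {q : Pt}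
    (h : ∀ v ∈ abBelow N, q.val v ∈ dep M) : q.ev f ∈ dep M := by
  rw [mem_dep, ev_ev]
  exact ev_congr_of_mem_dep hf fun v hv => mem_dep.mp (h v hv)

theorem dep_mono {N M : ℕ} (h : N ≤ M) : dep N ≤ dep M := by
  intro f hf
  rw [← ev_one f]
  exact ev_mem_dep hf fun v hv => X_mem_dep
    ⟨fun j hj => (hv.1 j hj).trans_le h, fun j hj => (hv.2 j hj).trans_le h⟩

section

variable {X : CType}

theorem sAct_eq_self_of_mem_dep {N i : ℕ} (hi : N < i) {f : Ser} (hf : f ∈ dep N) :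
    sAct X i f = f := by
  obtain ⟨i, rfl⟩ : ∃ j, i = j + 1 := ⟨i - 1, by omega⟩
  conv_rhs => rw [← ev_one f]
  refine ev_congr_of_mem_dep (p := sPt X (i + 1)) hf fun v hv => ?_
  cases v with
  | x k => exact sPt_succ_x X i k
  | a k =>
    have := a_mem_abBelow.mp hv
    rw [sPt_succ_a, Equiv.swap_apply_of_ne_of_ne (by omega) (by omega)]
    rfl
  | b k => exact sPt_b X _ k

theorem psiOp_eq_zero_of_mem_dep {N i : ℕ} (hi : N < i) {f : Ser} (hf : f ∈ dep N) (hd : f ∈ dom) :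
    psiOp X i f = 0 :=
  psiOp_eq_zero X i hd (sAct_eq_self_of_mem_dep hi hf)

theorem sPt_mem_dep {N i : ℕ} (hN : 1 ≤ N) (hi : i ≤ N) {v : Var} (hv : v ∈ abBelow N) :
    (sPt X i).val v ∈ dep (N + 1) := by
  cases v with
  | b k =>
    rw [sPt_b]
    exact bv_mem_dep ((b_mem_abBelow.mp hv).trans_le (Nat.le_succ N))
  | x k =>
    rcases i with _ | i
    · have h0 := av_mem_dep (N := N + 1) (k := 0) (by omega)
      have h1 := av_mem_dep (N := N + 1) (k := 1) (by omega)
      cases X with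
      | B => rcases k with _ | k; exacts [h0, xv_mem_dep _ _]
      | C => rcases k with _ | k; exacts [h0, xv_mem_dep _ _]
      | D => rcases k with _ | _ | k; exacts [h0, h1, xv_mem_dep _ _]
    · rw [sPt_succ_x]
      exact xv_mem_dep _ _
  | a k =>
    have hk := a_mem_abBelow.mp hv
    rcases i with _ | i
    · have h0 := bar_mem_dep (constantCoeff_av 0) (av_mem_dep (N := N + 1) (k := 0) (by omega))
      have h1 := bar_mem_dep (constantCoeff_av 1) (av_mem_dep (N := N + 1) (k := 1) (by omega))
      cases X with
      | B => rcases k with _ | k; exacts [h0, av_mem_dep (by omega)]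
      | C => rcases k with _ | k; exacts [h0, av_mem_dep (by omega)]
      | D => rcases k with _ | _ | k; exacts [h1, h0, av_mem_dep (by omega)]
    · rw [sPt_succ_a]
      refine av_mem_dep ?_
      rw [Equiv.swap_apply_def]
      split_ifs <;> omega

theorem cf_mem_dep {N i : ℕ} (hN : 1 ≤ N) (hi : i ≤ N) : cf X i ∈ dep (N + 1) := by
  rcases i with _ | i
  · have h0 := av_mem_dep (N := N + 1) (k := 0) (by omega)
    have h1 := av_mem_dep (N := N + 1) (k := 1) (by omega)
    cases X with
    | B => rw [cf_zero_B]; exact h0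
    | C => rw [cf_zero_C]; exact oplus_mem_dep h0 h0
    | D => rw [cf_zero_D]; exact oplus_mem_dep h0 h1
  · rw [cf_succ]
    exact oplus_mem_dep (bar_mem_dep (constantCoeff_av i) (av_mem_dep (by omega)))
      (av_mem_dep (by omega))

/-- For i ≤ N both s_i f and the root involve indices below N + 1 only, and the root is cancelled
from s_i f − f. For i > N the operator kills f. -/
theorem psiOp_mem_dep {N i : ℕ} (hN : 1 ≤ N) {f : Ser} (hf : f ∈ dep N) (hd : f ∈ dom) :
    psiOp X i f ∈ dep (N + 1) := by
  by_cases hi : i ≤ N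
  · have h1 : sAct X i f ∈ dep (N + 1) := by
      rw [sAct_eq_ev]
      exact ev_mem_dep hf fun v hv => sPt_mem_dep hN hi hv
    have h2 : cf X i * psiOp X i f ∈ dep (N + 1) := by
      have h3 := (dep (N + 1)).sub_mem h1 (dep_mono (Nat.le_succ N) hf)
      have h4 : sAct X i f - f = cf X i * psiOp X i f := by
        rw [sAct_eq' X i hd, add_sub_cancel_left]
      rwa [h4] at h3
    have h3 := mem_dep.mp h2
    rw [map_mul, mem_dep.mp (cf_mem_dep hN hi)] at h3
    exact mem_dep.mpr (mul_left_cancel₀ (cf_ne_zero X i) h3)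
  · rw [psiOp_eq_zero_of_mem_dep (not_le.mp hi) hf hd]
    exact zero_mem _

theorem psiWord_mem_dep {N : ℕ} (hN : 1 ≤ N) {f : Ser} (hf : f ∈ dep N) (hd : f ∈ dom)
    (l : List ℕ) : psiWord X l f ∈ dep (N + l.length) := by
  induction l with
  | nil => exact hf
  | cons i l ih =>
    exact psiOp_mem_dep (N := N + l.length) (by omega) ih (psiWord_mem_dom X l hd)

/-- Each operator extends the range of indices by at most 1, and a letter beyond the current range
would kill the series. -/
theorem le_of_psiWord_ne_zero {N : ℕ} (hN : 1 ≤ N) {f : Ser} (hf : f ∈ dep N) (hd : f ∈ dom)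
    {l : List ℕ} (h : psiWord X l f ≠ 0) : ∀ i ∈ l, i ≤ N + l.length := by
  induction l with
  | nil => simp
  | cons i l ih =>
    have hl : psiWord X l f ≠ 0 := fun h0 => h (by
      change psiOp X i (psiWord X l f) = 0
      rw [h0, psiOp_zero])
    intro j hj
    rw [List.length_cons]
    rcases List.mem_cons.mp hj with rfl | hj
    · by_contra hlt
      exact h (psiOp_eq_zero_of_mem_dep (by omega) (psiWord_mem_dep hN hf hd l)
        (psiWord_mem_dom X l hd))
    · have := ih hl j hj
      omega

theorem psi_mem_dep {N : ℕ} (hN : 1 ≤ N) {f : Ser} (hf : f ∈ dep N) (hd : f ∈ dom) (v : Weyl X) :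
    psi X v f ∈ dep (N + len X v) := psiWord_mem_dep hN hf hd _

/-- Such v have reduced words of bounded length in a finite alphabet. -/
theorem finite_psi_ne_zero {N : ℕ} (hN : 1 ≤ N) {f : Ser} (hf : f ∈ dep N) (hd : f ∈ dom) (D : ℕ) :
    {v : Weyl X | len X v ≤ D ∧ psi X v f ≠ 0}.Finite := by
  refine ((List.finite_length_le (Fin (N + D + 1)) D).image
    fun l => wordProd X (l.map Fin.val)).subset ?_
  rintro v ⟨hv, hne⟩
  have hl := le_of_psiWord_ne_zero hN hf hd hne
  have hlen : (reducedWord X v).length = len X v := rfl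
  refine ⟨(reducedWord X v).pmap (fun i hi => ⟨i, hi⟩) fun i hi => ?_, ?_, ?_⟩
  · have := hl i hi
    omega
  · simpa [hlen] using hv
  · simp only [List.map_pmap, List.pmap_eq_map, List.map_id']
    exact wordProd_reducedWord v

end

theorem exists_toSer_mem_dep (F : (SS ⊗[ZBeta] RBeta) ⊗[ZBeta] RBeta) :
    ∃ N, 1 ≤ N ∧ toSer F ∈ dep N := by
  let D : Subring Ser :=
    { carrier := {f | ∃ N, f ∈ dep N}
      mul_mem' := fun {f g} ⟨N, hf⟩ ⟨M, hg⟩ => ⟨max N M,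
        mul_mem (dep_mono (le_max_left N M) hf) (dep_mono (le_max_right N M) hg)⟩
      one_mem' := ⟨0, one_mem _⟩
      add_mem' := fun {f g} ⟨N, hf⟩ ⟨M, hg⟩ => ⟨max N M,
        add_mem (dep_mono (le_max_left N M) hf) (dep_mono (le_max_right N M) hg)⟩
      zero_mem' := ⟨0, zero_mem _⟩
      neg_mem' := fun {f} ⟨N, hf⟩ => ⟨N, neg_mem hf⟩ }
  obtain ⟨N, hN⟩ : toSer F ∈ D := by
    refine toSer_mem D (fun c => ⟨0, Subalgebra.algebraMap_mem _ c⟩) (fun f _ => ⟨0, ?_⟩)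
      (fun k => ⟨k + 1, av_mem_dep (Nat.lt_succ_self k)⟩)
      (fun k => ⟨k + 1, bv_mem_dep (Nat.lt_succ_self k)⟩) F
    rw [mem_dep]
    ext1 d
    by_cases h : ∀ v ∈ d.support, v ∈ abBelow 0
    · exact coeff_kill _ _ _ h
    · push Not at h
      obtain ⟨v, hv, hv'⟩ := h
      rw [coeff_kill_eq_zero _ _ _ hv hv', coeff_ofX_eq_zero f hv]
      rintro k rfl
      exact hv' (x_mem_abBelow 0 k)
  exact ⟨N + 1, by omega, dep_mono (Nat.le_succ N) hN⟩

section Localization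

variable {X : CType}

/-! ### Localization at an element of the Weyl group -/

theorem wPt_concat (l : List ℕ) (i : ℕ) : wPt X (l ++ [i]) = (wPt X l).comp (sPt X i) := by
  induction l with
  | nil => rw [List.nil_append, wPt_cons, wPt_nil, comp_one, one_comp]
  | cons j l ih => rw [List.cons_append, wPt_cons, ih, wPt_cons, comp_assoc]

/-- The point with the values `z` at `x`, `y` at `a` and `b` at `b`. -/
structure Represents (p : Pt) (z : List Par) (y : ℕ → Par) : Prop where
  x (k : ℕ) : p.val (.x k) = (z.getD k 0).1
  a (k : ℕ) : p.val (.a k) = (y k).1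
  b (k : ℕ) : p.val (.b k) = bv k

theorem represents_locPt : Represents locPt [] fun k => -varPar (.b k) :=
  ⟨fun _ => rfl, fun _ => rfl, fun _ => rfl⟩

theorem Represents.ev_cf {p : Pt} {z : List Par} {y : ℕ → Par} (hp : Represents p z y) (i : ℕ) :
    p.ev (cf X i) = (parRoot X i y).1 := by
  have hb (k : ℕ) : p.ev (bar β (av k)) = (-y k).1 := by
    rw [ev_bar _ (constantCoeff_av k), ev_av, hp.a]; rfl
  have ha (k : ℕ) : p.ev (av k) = (y k).1 := by rw [ev_av, hp.a]
  rcases i with _ | i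
  · cases X with
    | B => rw [cf_zero_B, ha]; rfl
    | C => rw [cf_zero_C, ev_oplus, ha]; rfl
    | D => rw [cf_zero_D, ev_oplus, ha, ha]; rfl
  · rw [cf_succ, ev_oplus, hb, ha]
    cases X <;> rfl

theorem Represents.comp {p : Pt} {z : List Par} {y : ℕ → Par} (hp : Represents p z y) (i : ℕ) :
    Represents (p.comp (sPt X i)) (parPre X i y ++ z) (parAct X i y) := by
  have hb (k : ℕ) : p.ev (bar β (av k)) = (-y k).1 := by
    rw [ev_bar _ (constantCoeff_av k), ev_av, hp.a]; rfl
  have ha (k : ℕ) : p.ev (av k) = (y k).1 := by rw [ev_av, hp.a]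
  have hx (k : ℕ) : p.ev (xv k) = (z.getD k 0).1 := by rw [ev_xv, hp.x]
  refine ⟨fun k => ?_, fun k => ?_, fun k => ?_⟩
  · rw [comp_val]
    rcases i with _ | i
    · cases X with
      | B => rcases k with _ | k; exacts [ha 0, hx k]
      | C => rcases k with _ | k; exacts [ha 0, hx k]
      | D => rcases k with _ | _ | k; exacts [ha 0, ha 1, hx k]
    · rw [sPt_succ_x, hx]
      cases X <;> rfl
  · rw [comp_val]
    rcases i with _ | i
    · cases X with
      | B => rcases k with _ | k; exacts [hb 0, ha _]
      | C => rcases k with _ | k; exacts [hb 0, ha _]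
      | D => rcases k with _ | _ | k; exacts [hb 1, hb 0, ha _]
    · rw [sPt_succ_a, ha]
      cases X <;> rfl
  · rw [comp_val, sPt_b, ev_bv, hp.b]

/-- The pairing of an element of the idCoxeter algebra with the values of `ψ_v` at `e`. -/
noncomputable def pairing (X : CType) (f : Ser) : (Weyl X →₀ Ser) →ₗ[Ser] Ser :=
  Finsupp.linearCombination Ser fun v => locE (psi X v f)

theorem pairing_single (f : Ser) (v : Weyl X) (c : Ser) :
    pairing X f (Finsupp.single v c) = c * locE (psi X v f) := by
  rw [pairing, Finsupp.linearCombination_single, smul_eq_mul]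

/-- The values of ψ_v ψ_i follow the rule for u_v u_i, so ψ_i is adjoint to right multiplication by
u_i. -/
theorem pairing_psiOp (i : ℕ) {f : Ser} (hf : f ∈ dom) (m : Weyl X →₀ Ser) :
    pairing X (psiOp X i f) m = pairing X f (rightMul X i m) := by
  classical
  induction m using Finsupp.induction_linear with
  | zero => rw [map_zero, map_zero, map_zero]
  | add m m' h h' => rw [map_add, map_add, map_add, h, h']
  | single v c =>
    rw [rightMul_single_desc, pairing_single]
    split_ifs with hd
    · rw [psi_psiOp_of_desc hd hf, pairing_single, map_mul]
      have : locE (MvPowerSeries.C β) = MvPowerSeries.C β := ev_C locPt β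
      rw [this]
      ring
    · rw [psi_psiOp_of_not_desc hd hf, pairing_single]

/-- The state of the parameters `x`, `a` after a word. -/
def runWord (X : CType) {P : Type*} [Neg P] (l : List ℕ) (st : List P × (ℕ → P)) :
    List P × (ℕ → P) :=
  l.foldl (fun st i => (parPre X i st.2 ++ st.1, parAct X i st.2)) st

theorem runWord_append {P : Type*} [Neg P] (l l' : List ℕ) (st : List P × (ℕ → P)) :
    runWord X (l ++ l') st = runWord X l' (runWord X l st) := List.foldl_append

theorem runWord_concat {P : Type*} [Neg P] (l : List ℕ) (i : ℕ) (st : List P × (ℕ → P)) :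
    runWord X (l ++ [i]) st = (parPre X i (runWord X l st).2 ++ (runWord X l st).1,
      parAct X i (runWord X l st).2) := runWord_append l [i] st

theorem represents_wPt (l : List ℕ) :
    Represents (locPt.comp (wPt X l)) (runWord X l ([], fun k => -varPar (.b k))).1
      (runWord X l ([], fun k => -varPar (.b k))).2 := by
  induction l using List.reverseRecOn with
  | nil => rw [wPt_nil, comp_one]; exact represents_locPt
  | append_singleton l i ih =>
    rw [runWord_concat, wPt_concat, ← comp_assoc]
    exact ih.comp i

/-- Both sides obey the same recursion when a letter i is appended. On the left s_i f = f + ᾱ_i ψ_i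
f; on the right `GFG_step` multiplies by h_i at the value of ᾱ_i, and u_i is moved onto f as ψ_i. -/
theorem ev_wPt_eq_pairing {n : ℕ} (hn : 3 ≤ n) (l : List ℕ) (hl : ∀ i ∈ l, i < n) {f : Ser}
    (hf : f ∈ dom) :
    (locPt.comp (wPt X l)).ev f = pairing X f (actU (GFG X n (fun k => -varPar (.b k))
      (runWord X l ([], fun k => -varPar (.b k))).1 (runWord X l ([], fun k => -varPar (.b k))).2)
      (Finsupp.single 1 1)) := by
  induction l using List.reverseRecOn generalizing f with
  | nil =>
    change (locPt.comp one).ev f = pairing X f (actU (GFG X n _ [] fun k => -varPar (.b k)) _)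
    rw [GFG_self, actU_one, pairing_single, psi_one, one_mul, comp_one]
    rfl
  | append_singleton l i ih =>
    have hl' : ∀ j ∈ l, j < n := fun j hj => hl j (List.mem_append_left _ hj)
    have hi : i < n := hl i (by simp)
    rw [runWord_concat]
    dsimp only
    rw [GFG_step hn i hi, actU_mul, actU_hU, map_add, map_smul,
      ← pairing_psiOp i hf, ← ih hl' hf, ← ih hl' (psiOp_mem_dom X i hf), wPt_concat, ← comp_assoc,
      ← ev_ev, ← sAct_eq_ev, sAct_eq' X i hf, map_add, map_mul, (represents_wPt l).ev_cf, smul_eq_mul]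

end Localization

section Word

variable {X : CType}

/-! ### A long word -/

theorem runWord_nil {P : Type*} [Neg P] (st : List P × (ℕ → P)) : runWord X [] st = st := rfl

theorem runWord_cons {P : Type*} [Neg P] (i : ℕ) (l : List ℕ) (st : List P × (ℕ → P)) :
    runWord X (i :: l) st = runWord X l (parPre X i st.2 ++ st.1, parAct X i st.2) := rfl

theorem parAct_succ {P : Type*} [Neg P] (i : ℕ) (y : ℕ → P) :
    parAct X (i + 1) y = fun j => y (Equiv.swap i (i + 1) j) := by cases X <;> rfl

theorem parPre_succ {P : Type*} (i : ℕ) (y : ℕ → P) : parPre X (i + 1) y = [] := by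
  cases X <;> rfl

/-- The word `1, 2, …, m`. -/
def shiftWord (m : ℕ) : List ℕ := List.range' 1 m

theorem runWord_shiftWord {P : Type*} [Neg P] (m : ℕ) (z : List P) (y : ℕ → P) :
    (runWord X (shiftWord m) (z, y)).1 = z ∧
    (∀ j < m, (runWord X (shiftWord m) (z, y)).2 j = y (j + 1)) ∧
    (runWord X (shiftWord m) (z, y)).2 m = y 0 ∧
    ∀ j, m < j → (runWord X (shiftWord m) (z, y)).2 j = y j := by
  induction m with
  | zero =>
    rw [shiftWord, List.range'_zero, runWord_nil]
    exact ⟨rfl, by simp, rfl, fun _ _ => rfl⟩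
  | succ m ih =>
    obtain ⟨h1, h2, h3, h4⟩ := ih
    have hw : shiftWord (m + 1) = shiftWord m ++ [m + 1] := by
      rw [shiftWord, shiftWord, ← List.range'_append_1, List.range'_one, add_comm 1 m]
    rw [hw, runWord_concat, parAct_succ, parPre_succ]
    refine ⟨h1, fun j hj => ?_, ?_, fun j hj => ?_⟩
    · dsimp only
      by_cases hjm : j = m
      · subst hjm
        rw [Equiv.swap_apply_left, h4 _ (Nat.lt_succ_self _)]
      · rw [Equiv.swap_apply_of_ne_of_ne hjm (by omega), h2 j (by omega)]
    · dsimp only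
      rw [Equiv.swap_apply_right, h3]
    · dsimp only
      rw [Equiv.swap_apply_of_ne_of_ne (by omega) (by omega), h4 j (by omega)]

/-- The sequence `y` agrees with the sequence `c` shifted by `k`, up to the index `N` of `c`. -/
def IsShift {P : Type*} (N k : ℕ) (c y : ℕ → P) : Prop := ∀ j, k + j < N → y j = c (k + j)

theorem isShift_shiftWord {P : Type*} [Neg P] {N k : ℕ} {c y : ℕ → P}
    (h : ∀ j, k + j < N → j ≠ 0 → y j = c (k + j)) (z : List P) :
    (runWord X (shiftWord (N - 1)) (z, y)).1 = z ∧
      IsShift N (k + 1) c (runWord X (shiftWord (N - 1)) (z, y)).2 := by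
  obtain ⟨h1, h2, -, -⟩ := runWord_shiftWord (X := X) (N - 1) z y
  refine ⟨h1, fun j hj => ?_⟩
  rw [h2 j (by omega), h _ (by omega) (by omega)]
  congr 1
  omega

theorem lt_of_mem_shiftWord {N i : ℕ} (h : i ∈ shiftWord (N - 1)) : i < N := by
  rw [shiftWord, List.mem_range'_1] at h
  omega

/-- Each pass of the word 1, 2, …, N − 1 carries the first parameter behind the other ones in range.
Discarding parameters in this way leaves x untouched. -/
theorem exists_word_shift {P : Type*} [Neg P] {N : ℕ} (c : ℕ → P) (t : ℕ) :
    ∃ l : List ℕ, (∀ i ∈ l, i < N) ∧ (runWord X l ([], c)).1 = [] ∧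
      IsShift N t c (runWord X l ([], c)).2 := by
  induction t with
  | zero => exact ⟨[], by simp, rfl, fun j _ => by rw [zero_add]; rfl⟩
  | succ t ih =>
    obtain ⟨l, h1, h2, h3⟩ := ih
    obtain ⟨h4, h5⟩ := isShift_shiftWord (X := X) (fun j hj _ => h3 j hj) (runWord X l ([], c)).1
    refine ⟨l ++ shiftWord (N - 1), fun i hi => ?_, ?_, ?_⟩
    · rcases List.mem_append.mp hi with hi | hi
      exacts [h1 i hi, lt_of_mem_shiftWord hi]
    · rw [runWord_append]
      exact h4.trans h2
    · rw [runWord_append]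
      exact h5

/-- The letter 0 copies the first parameter to x and replaces it by its inverse; the shift then
removes it from the range under control. -/
theorem runWord_zero_shiftWord {P : Type*} [Neg P] (hX : X ≠ .D) {N k : ℕ} {c y : ℕ → P}
    (hk : k < N) (h : IsShift N k c y) (z : List P) :
    (runWord X (0 :: shiftWord (N - 1)) (z, y)).1 = c k :: z ∧
      IsShift N (k + 1) c (runWord X (0 :: shiftWord (N - 1)) (z, y)).2 := by
  have h0 : parPre X 0 y = [c k] := by
    have : parPre X 0 y = [y 0] := by cases X <;> first | rfl | exact absurd rfl hX
    rw [this, h 0 (by omega)]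
    rfl
  have h1 : ∀ j, j ≠ 0 → parAct X 0 y j = y j := by
    intro j hj
    cases X with
    | B => exact if_neg hj
    | C => exact if_neg hj
    | D => exact absurd rfl hX
  rw [runWord_cons, h0]
  exact isShift_shiftWord (fun j hj hj0 => (h1 j hj0).trans (h j hj)) _

/-- In type D parameters reach x only in pairs, so all types are treated two at a time. The order in
which the pair arrives depends on the type. -/
theorem exists_word_two {P : Type*} [Neg P] {N k : ℕ} (hN : 3 ≤ N) (hk : k + 1 < N) {c : ℕ → P} :
    ∃ l : List ℕ, (∀ i ∈ l, i < N) ∧ ∃ L : List ℕ, L.Perm [k, k + 1] ∧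
      ∀ (z : List P) (y : ℕ → P), IsShift N k c y →
        (runWord X l (z, y)).1 = L.map c ++ z ∧ IsShift N (k + 2) c (runWord X l (z, y)).2 := by
  have hl : ∀ i ∈ (0 :: shiftWord (N - 1)), i < N := by
    intro i hi
    rcases List.mem_cons.mp hi with rfl | hi
    exacts [by omega, lt_of_mem_shiftWord hi]
  by_cases hX : X = .D
  · subst hX
    refine ⟨(0 :: shiftWord (N - 1)) ++ shiftWord (N - 1), fun i hi => ?_, [k, k + 1],
      List.Perm.refl _, fun z y hy => ?_⟩
    · rcases List.mem_append.mp hi with hi | hi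
      exacts [hl i hi, lt_of_mem_shiftWord hi]
    · obtain ⟨h1, h2, -, -⟩ := runWord_shiftWord (X := .D) (N - 1) (parPre .D 0 y ++ z)
        (parAct .D 0 y)
      rw [runWord_append, runWord_cons]
      dsimp only
      generalize runWord CType.D (shiftWord (N - 1)) (parPre .D 0 y ++ z, parAct .D 0 y) = st at *
      obtain ⟨z', y'⟩ := st
      dsimp only at h1 h2
      subst h1
      obtain ⟨h3, h4⟩ := isShift_shiftWord (X := .D) (N := N) (k := k + 1) (c := c) (y := y')
        (fun j hj hj0 => by
          rw [h2 j (by omega)]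
          have : parAct .D 0 y (j + 1) = y (j + 1) := by simp [parAct, hj0]
          rw [this, hy _ (by omega)]
          congr 1
          omega) (parPre .D 0 y ++ z)
      refine ⟨h3.trans ?_, h4⟩
      change y 0 :: y 1 :: z = c k :: c (k + 1) :: z
      rw [hy 0 (by omega), hy 1 hk, add_zero]
  · refine ⟨(0 :: shiftWord (N - 1)) ++ (0 :: shiftWord (N - 1)), fun i hi => ?_, [k + 1, k],
      List.Perm.swap _ _ _, fun z y hy => ?_⟩
    · rcases List.mem_append.mp hi with hi | hi
      exacts [hl i hi, hl i hi]
    · obtain ⟨h1, h2⟩ := runWord_zero_shiftWord hX (by omega) hy z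
      rw [runWord_append]
      generalize runWord X (0 :: shiftWord (N - 1)) (z, y) = st at *
      obtain ⟨z', y'⟩ := st
      obtain ⟨h3, h4⟩ := runWord_zero_shiftWord hX hk h2 z'
      refine ⟨h3.trans ?_, h4⟩
      dsimp only at h1
      rw [h1]
      rfl

theorem exists_word_localize {P : Type*} [Neg P] {N : ℕ} (hN : 3 ≤ N) (c : ℕ → P) (k m : ℕ)
    (hm : k + 2 * m ≤ N) :
    ∃ l : List ℕ, (∀ i ∈ l, i < N) ∧ ∃ L : List ℕ, L.Perm (List.range' k (2 * m)) ∧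
      (runWord X l ([], c)).1 = L.map c ∧ IsShift N (k + 2 * m) c (runWord X l ([], c)).2 := by
  induction m with
  | zero =>
    obtain ⟨l, h1, h2, h3⟩ := exists_word_shift (X := X) (N := N) c k
    exact ⟨l, h1, [], List.Perm.refl _, h2, h3⟩
  | succ m ih =>
    obtain ⟨l, h1, L, h2, h3, h4⟩ := ih (by omega)
    obtain ⟨l', h1', L', h2', h3'⟩ := exists_word_two (X := X) (k := k + 2 * m) hN (by omega) (c := c)
    obtain ⟨h5, h6⟩ := h3' (runWord X l ([], c)).1 _ h4
    refine ⟨l ++ l', fun i hi => ?_, L' ++ L, ?_, ?_, ?_⟩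
    · rcases List.mem_append.mp hi with hi | hi
      exacts [h1 i hi, h1' i hi]
    · have : List.range' k (2 * (m + 1)) = List.range' k (2 * m) ++ [k + 2 * m, k + 2 * m + 1] := by
        rw [mul_add, ← List.range'_append_1]
        rfl
      rw [this]
      exact (h2'.append h2).trans List.perm_append_comm
    · rw [runWord_append, List.map_append, ← h3]
      exact h5
    · rw [runWord_append]
      exact h6

end Word

section Interpolation

variable {X : CType}

/-! ### The interpolation formula -/

/-- The substitution `b_{L_j} = x̄_j`, `b_{2n+j} = ā_j`. -/
noncomputable def backPt (n : ℕ) (L : List ℕ) : Pt where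
  val
    | .x k => xv k
    | .a k => av k
    | .b i => if i < n then bv i else if i < 2 * n then bar β (xv (L.idxOf i)) else
        if i < 3 * n then bar β (av (i - 2 * n)) else bv i
  hasSubst := by
    refine hasSubst_of_finite one id (Var.b '' Set.Iio (3 * n)) ((Set.finite_Iio _).image _) ?_
      (fun _ _ _ _ h => h) ?_
    · rintro (k | k | k)
      · exact constantCoeff_xv k
      · exact constantCoeff_av k
      · dsimp only
        split_ifs
        · exact constantCoeff_bv k
        · exact constantCoeff_bar (constantCoeff_xv _)
        · exact constantCoeff_bar (constantCoeff_av _)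
        · exact constantCoeff_bv k
    · rintro (k | k | k) hk
      · rfl
      · rfl
      · have hk' : ¬ k < 3 * n := fun h => hk ⟨k, h, rfl⟩
        dsimp only
        rw [if_neg (by omega), if_neg (by omega), if_neg hk']
        rfl

theorem backPt_b_of_lt {n i : ℕ} (L : List ℕ) (hi : i < n) :
    (backPt n L).par (-varPar (.b i)) = -varPar (.b i) := by
  rw [map_neg]
  congr 1
  exact Subtype.ext ((ev_X _ _).trans (if_pos hi))

theorem backPt_b_mid {n i : ℕ} (L : List ℕ) (hi : n ≤ i) (hi' : i < 2 * n) :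
    (backPt n L).par (-varPar (.b i)) = varPar (.x (L.idxOf i)) := by
  rw [map_neg, neg_eq_iff_eq_neg]
  refine Subtype.ext ((ev_X _ _).trans ?_)
  change (if i < n then bv i else if i < 2 * n then bar β (xv (L.idxOf i)) else
        if i < 3 * n then bar β (av (i - 2 * n)) else bv i) = _
  rw [if_neg (by omega), if_pos hi']
  rfl

theorem backPt_b_top {n j : ℕ} (L : List ℕ) (hj : j < n) :
    (backPt n L).par (-varPar (.b (2 * n + j))) = varPar (.a j) := by
  rw [map_neg, neg_eq_iff_eq_neg]
  refine Subtype.ext ((ev_X _ _).trans ?_)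
  change (if 2 * n + j < n then bv (2 * n + j) else if 2 * n + j < 2 * n then
    bar β (xv (L.idxOf (2 * n + j))) else
        if 2 * n + j < 3 * n then bar β (av (2 * n + j - 2 * n)) else bv (2 * n + j)) = _
  rw [if_neg (by omega), if_neg (by omega), if_pos (by omega), Nat.add_sub_cancel_left]
  rfl

theorem map_idxOf_eq_range {L : List ℕ} (hL : L.Nodup) :
    L.map (fun i => L.idxOf i) = List.range L.length := by
  refine List.ext_getElem (by simp) fun k h1 h2 => ?_
  rw [List.getElem_map, List.getElem_range, hL.idxOf_getElem]

theorem GFG_congr {n : ℕ} {c c' : ℕ → Par} {z : List Par} {y y' : ℕ → Par}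
    (hc : ∀ j, j + 1 < n → c j = c' j) (hy : ∀ j, j + 1 < n → y j = y' j) :
    GFG X n c z y = GFG X n c' z y' := by
  rw [GFG, GFG, GU_congr hc, GU_congr hy]

/-- The coefficient of v sees only the first m − 1 entries of c and of y. Since m ≤ n, these entries
of c are fixed by the substitution, those of y become a, and the arguments of F become the x in the
order of `grothN`. -/
theorem backPt_coU {m n N : ℕ} (hm : 2 ≤ m) (hmn : m ≤ n) (hnN : n ≤ N) {L : List ℕ}
    (hL : L.Perm (List.range' n n)) {y : ℕ → Par} (hy : ∀ j < n, y j = -varPar (.b (2 * n + j)))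
    {v : Weyl X} (hv : FixGT m v) :
    (backPt n L).ev (coU (GFG X N (fun k => -varPar (.b k)) (L.map fun k => -varPar (.b k)) y) v) =
      grothN X n v := by
  have hlen : L.length = n := hL.length_eq.trans List.length_range'
  have hz : (L.map fun k => -varPar (.b k)).map (backPt n L).par =
      (List.range n).map fun k => varPar (.x k) := by
    have h1 : (List.range n) = L.map fun i => L.idxOf i := by
      rw [map_idxOf_eq_range (hL.nodup_iff.mpr (List.nodup_range')), hlen]
    rw [h1, List.map_map, List.map_map]
    refine List.map_congr_left fun i hi => ?_
    have := List.mem_range'_1.mp (hL.mem_iff.mp hi)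
    exact backPt_b_mid L this.1 (by omega)
  rw [grothN_eq, ev_coU_GFG, hz, coU_GFG_of_fixGT hm (hmn.trans hnN) _ _ _ hv,
    coU_GFG_of_fixGT hm hmn _ _ _ hv]
  refine congrArg (fun T => coU T v)
    (GFG_congr (fun j hj => backPt_b_of_lt L (by omega)) fun j hj => ?_)
  rw [hy j (by omega), backPt_b_top L (by omega)]

/-- The localization placed x and a at independent variables b outside the range of f, so it can be
undone; only the x beyond the first n are lost. -/
theorem backPt_ev_localize {n : ℕ} {L : List ℕ} (hL : L.Perm (List.range' n n)) {p : Pt}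
    {y : ℕ → Par} (hp : Represents p (L.map fun k => -varPar (.b k)) y)
    (hy : ∀ j < n, y j = -varPar (.b (2 * n + j))) {f : Ser} (hf : f ∈ dep n) :
    (backPt n L).ev (p.ev f) = (kill (xBelow n)).ev f := by
  have hlen : L.length = n := hL.length_eq.trans List.length_range'
  rw [ev_ev]
  refine ev_congr_of_mem_dep hf fun v hv => ?_
  rw [comp_val]
  cases v with
  | x k =>
    rw [hp.x]
    by_cases hk : k < n
    · rw [kill_xBelow_x hk, List.getD_eq_getElem _ _ (by simpa [hlen] using hk), List.getElem_map]
      have hmem := List.mem_range'_1.mp (hL.mem_iff.mp (List.getElem_mem (l := L) (n := k) (by omega)))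
      have := congrArg Subtype.val (backPt_b_mid L hmem.1 (by omega))
      rw [(hL.nodup_iff.mpr (List.nodup_range')).idxOf_getElem] at this
      exact this
    · rw [kill_xBelow_x_of_le (by omega), List.getD_eq_default _ _ (by simp [hlen]; omega)]
      exact map_zero _
  | a k =>
    have hk := a_mem_abBelow.mp hv
    rw [hp.a, hy k hk, kill_mem (by rintro _ ⟨⟩)]
    exact congrArg Subtype.val (backPt_b_top L hk)
  | b k =>
    have hk := b_mem_abBelow.mp hv
    rw [hp.b, kill_mem (by rintro _ ⟨⟩), ev_bv]
    exact if_pos hk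

/-- The localized series involves only the first block of b, which the substitution fixes. -/
theorem backPt_ev_locE (n : ℕ) (L : List ℕ) {f : Ser} (hf : f ∈ dep n) :
    (backPt n L).ev (locE f) = locE f := by
  rw [locE_eq_ev, ev_ev]
  refine ev_congr_of_mem_dep hf fun v hv => ?_
  rw [comp_val]
  have hb (k : ℕ) (hk : k < n) : (backPt n L).ev (bv k) = bv k := (ev_bv _ _).trans (if_pos hk)
  cases v with
  | x k => exact map_zero _
  | a k =>
    have := hb k (a_mem_abBelow.mp hv)
    change (backPt n L).ev (bar β (bv k)) = bar β (bv k)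
    rw [ev_bar _ (constantCoeff_bv k), this]
  | b k => exact hb k (b_mem_abBelow.mp hv)

theorem coeff_mul_eq_zero_of_lt_order {f g : Ser} {d : Var →₀ ℕ} (h : (d.degree : ℕ∞) < g.order) :
    MvPowerSeries.coeff d (f * g) = 0 :=
  MvPowerSeries.coeff_of_lt_order (h.trans_le (le_add_self.trans MvPowerSeries.le_order_mul))

/-- The 3n parameters b are used in three blocks of length n: for the localized coefficients, for x
and for a. Localizing along a long word and substituting back turns the pairing formula into an
identity for the coefficient at d. -/
theorem coeff_eq_sum_grothN {N₀ n : ℕ} (hN₀ : 1 ≤ N₀) {f : Ser} (hf : f ∈ dep N₀) (hd : f ∈ dom)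
    (d : Var →₀ ℕ) {S : Finset (Weyl X)} (hS : ∀ v, len X v ≤ d.degree → psi X v f ≠ 0 → v ∈ S)
    (hSl : ∀ v ∈ S, len X v ≤ d.degree) (hn : 1 ≤ n) (hne : Even n) (hnd : N₀ + d.degree ≤ n)
    (hx : xBound d ≤ n) (hm : ∀ v ∈ S, ∃ m, 2 ≤ m ∧ m ≤ n ∧ FixGT m v) :
    MvPowerSeries.coeff d f =
      ∑ v ∈ S, MvPowerSeries.coeff d (locE (psi X v f) * grothN X n v) := by
  classical
  -- The words supply the x in pairs, hence n = 2k.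
  obtain ⟨k, hk⟩ := hne
  obtain ⟨l, h1, L, h2, h3, h4⟩ := exists_word_localize (X := X) (N := 3 * n) (by omega)
    (fun k => -varPar (.b k)) n k (by omega)
  rw [show 2 * k = n by omega] at h2 h4
  have hrep := represents_wPt (X := X) l
  have hev := ev_wPt_eq_pairing (X := X) (n := 3 * n) (by omega) l h1 hd
  rw [h3] at hrep hev
  generalize (runWord X l ([], fun k => -varPar (.b k))).2 = y at hrep hev h4
  have hy : ∀ j < n, y j = -varPar (.b (2 * n + j)) := fun j hj => by
    rw [h4 j (by omega)]
    congr 3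
    omega
  rw [← coeff_kill (xBelow n) f d (mem_xBelow hx),
    ← backPt_ev_localize h2 hrep hy (dep_mono (by omega) hf), hev, pairing,
    Finsupp.linearCombination_apply, Finsupp.sum, map_sum, map_sum]
  have hord (v : Weyl X) := len_le_order_coU_GFG (3 * n) (fun k => (backPt n L).par (-varPar (.b k)))
    ((L.map fun k => -varPar (.b k)).map (backPt n L).par) (fun k => (backPt n L).par (y k)) v
  simp only [smul_eq_mul, map_mul]
  change ∑ v ∈ _, MvPowerSeries.coeff d ((backPt n L).ev (coU _ v) * _) = _
  -- The pairing runs over the support of the localized product, not over S. Terms outside S vanish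
  -- because ψ_v f = 0 or because their order exceeds the degree of d; terms of S outside the
  -- support vanish by `backPt_coU`.
  refine Finset.sum_congr_of_eq_on_inter ?_ ?_ ?_
  · intro v hv hvS
    by_cases hp : psi X v f = 0
    · rw [hp, map_zero, map_zero, mul_zero, map_zero]
    · rw [mul_comm]
      refine coeff_mul_eq_zero_of_lt_order ?_
      rw [ev_coU_GFG]
      refine lt_of_lt_of_le ?_ (hord v)
      have : ¬ len X v ≤ d.degree := fun h => hvS (hS v h hp)
      exact_mod_cast not_le.mp this
  · intro v hvS hv
    obtain ⟨m, hm2, hmn, hfix⟩ := hm v hvS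
    rw [← backPt_coU hm2 hmn (show n ≤ 3 * n by omega) h2 hy hfix]
    have : coU (GFG X (3 * n) (fun k => -varPar (.b k)) (L.map fun k => -varPar (.b k)) y) v = 0 :=
      Finsupp.notMem_support_iff.mp hv
    rw [this, map_zero, mul_zero, map_zero]
  · intro v _ hvS
    obtain ⟨m, hm2, hmn, hfix⟩ := hm v hvS
    have hl := hSl v hvS
    rw [backPt_coU hm2 hmn (by omega) h2 hy hfix, backPt_ev_locE, mul_comm]
    exact dep_mono (by omega) (psi_mem_dep hN₀ hf hd v)

/-- The coefficient of the product at d uses the coefficients of the second factor only at divisors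
of the monomial, for which the same n suffices. -/
theorem coeff_mul_groth {m n : ℕ} (hm : 2 ≤ m) {v : Weyl X} (hv : FixGT m v) {d : Var →₀ ℕ}
    (hn : m ≤ n) (hd : xBound d ≤ n) (f : Ser) :
    MvPowerSeries.coeff d (f * groth X v) = MvPowerSeries.coeff d (f * grothN X n v) := by
  classical
  rw [MvPowerSeries.coeff_mul, MvPowerSeries.coeff_mul]
  refine Finset.sum_congr rfl fun e he => ?_
  rw [coeff_groth hm hv hn]
  refine le_trans (Finset.sup_mono fun w hw => ?_) hd
  have := Finset.HasAntidiagonal.mem_antidiagonal.mp he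
  rw [← this, Finsupp.mem_support_iff, Finsupp.add_apply]
  have := Finsupp.mem_support_iff.mp hw
  omega

theorem isFormalSum_psi {N₀ : ℕ} (hN₀ : 1 ≤ N₀) {f : Ser} (hf : f ∈ dep N₀) (hd : f ∈ dom) :
    IsFormalSum (fun v : Weyl X => locE (psi X v f) * groth X v) f := by
  classical
  intro d
  have hfin := finite_psi_ne_zero (X := X) hN₀ hf hd d.degree
  have hsub : {v : Weyl X | MvPowerSeries.coeff d (locE (psi X v f) * groth X v) ≠ 0} ⊆
      {v : Weyl X | len X v ≤ d.degree ∧ psi X v f ≠ 0} := by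
    intro v hv
    refine ⟨?_, fun h => hv ?_⟩
    · by_contra hlt
      refine hv (coeff_mul_eq_zero_of_lt_order (lt_of_lt_of_le ?_ (len_le_order_groth v)))
      exact_mod_cast not_le.mp hlt
    · rw [h, map_zero, zero_mul, map_zero]
  refine ⟨hfin.subset hsub, ?_⟩
  rw [finsum_eq_sum_of_support_subset (s := hfin.toFinset) _
    (by rw [Set.Finite.coe_toFinset]; exact hsub)]
  choose m hm2 hmfix using fun v : Weyl X => exists_fixGT v
  -- A common bound for all requirements on n; doubling it makes n even, and N₀ ≥ 1 makes it
  -- positive.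
  let M := hfin.toFinset.sup m + N₀ + d.degree + xBound d
  have hmM : ∀ v ∈ hfin.toFinset, m v ≤ 2 * M := fun v hv => by
    have := Finset.le_sup (f := m) hv
    simp only [M]
    omega
  have hx : xBound d ≤ 2 * M := by simp only [M]; omega
  rw [coeff_eq_sum_grothN (n := 2 * M) hN₀ hf hd d (S := hfin.toFinset)
    (fun v h h' => hfin.mem_toFinset.mpr ⟨h, h'⟩) (fun v hv => (hfin.mem_toFinset.mp hv).1)
    (by simp only [M]; omega) (even_two_mul M) (by simp only [M]; omega) hx
    fun v hv => ⟨m v, hm2 v, hmM v hv, hmfix v⟩]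
  exact Finset.sum_congr rfl fun v hv => coeff_mul_groth (hm2 v) (hmfix v) (hmM v hv) hx _

end Interpolation

end DoubleGroth

/-- Interpolation formula. The first three clauses say that the objects of the formula exist: the
limit that defines `𝒢_w^X`, the exactness of all divisions in the iterated divided differences of
`F`, and the independence of `ψ_v^{(a)} F` of the reduced word of `v`. -/
theorem proposition16 (X : CType) (F : (SS ⊗[ZBeta] RBeta) ⊗[ZBeta] RBeta) :
    (∀ w : Weyl X, IsFormalLim (fun n => grothN X n w) (groth X w)) ∧
    (∀ (l : List ℕ) (i : ℕ),
      IsPi X i (psiWord X l (toSer F)) (piOp X i (psiWord X l (toSer F)))) ∧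
    (∀ (v : Weyl X) (l : List ℕ), IsReducedWord X v l →
      psiWord X l (toSer F) = psi X v (toSer F)) ∧
    IsFormalSum (fun v : Weyl X => locE (psi X v (toSer F)) * groth X v) (toSer F) := by
  have hd := toSer_mem_dom F
  obtain ⟨N, hN, hf⟩ := exists_toSer_mem_dep F
  exact ⟨isFormalLim_groth, fun l i => isPi_piOp X i (psiWord_mem_dom X l hd),
    fun v l hl => psi_eq_psiWord hl hd, isFormalSum_psi hN hf hd⟩
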